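/- **Set-up.** Let $\tilde\phi(x,\xi)=\phi(x)+\xi x^{r}$ be a generic degree-wise Puiseux series: $\phi=\sum_e a_e x^e$ is a finite sum with $e\in\mathbb Q$, $a_e\in\mathbb C$, all its exponents are larger than $r\in\mathbb Q$, and $\xi$ is an indeterminate. Let $(q_1,p_1),\dots,(q_{l+1},p_{l+1})$ be its formal Puiseux pairs, i.e. $(q_1,p_1),\dots,(q_l,p_l)$ are the Puiseux pairs of $\phi$ (so $p_j\ge 2$, $\gcd(q_j,p_j)=1$, $p_1\cdots p_l$ is the least common denominator of the exponents of $\phi$, and $q_j/(p_1\cdots p_j)$ is the largest exponent of $\phi$ outside $\frac1{p_1\cdots p_{j-1}}\mathbb Z$) and $r=q_{l+1}/(p_1\cdots p_{l+1})$ with $p_{l+1}\ge1$, $\gcd(q_{l+1},p_{l+1})=1$. For $1\le k\le l+1$ let $\phi_k$ be the sum of the terms of $\phi$ with exponent $>q_k/(p_1\cdots p_k)$, and for $0\neq f\in\mathbb C[x,x^{-1},y]$ put $$\delta_k(f)=p_1\cdots p_k\cdot\deg_x f\bigl(x,\phi_k(x)+\xi x^{q_k/(p_1\cdots p_k)}\bigr)\in\mathbb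 Z,\qquad \delta_k(0)=-\infty ;$$ $\delta:=\delta_{l+1}$. The *key forms* of $\delta$ are the elements $g_0=x,\ g_1=y,\ g_2,\dots,g_{n+1}$ of $\mathbb C[x,x^{-1},y]$ such that, with $w_j=\delta(g_j)$ and, for $1\le j\le n$, $\alpha_j=\min\{\alpha\in\mathbb Z_{>0}:\alpha w_j\in\mathbb Zw_0+\dots+\mathbb Zw_{j-1}\}$: (i) for $1\le j\le n$ there are $\theta_j\in\mathbb C^*$, $\beta_{j,0}\in\mathbb Z$ and integers $0\le\beta_{j,i}<\alpha_i$ ($1\le i<j$) with $w_{j+1}<\alpha_jw_j=\sum_{i<j}\beta_{j,i}w_i$ and $g_{j+1}=g_j^{\alpha_j}-\theta_j\prod_{i<j}g_i^{\beta_{j,i}}$; (ii) for every $0\ne h\in\mathbb C[x,x^{-1},y]$, $\delta(h)$ is the minimum of the weighted degrees (weights $w_0$ for $x$ and $w_j$ for $y_j$) of the $G\in\mathbb C[x,x^{-1},y_1,\dots,y_{n+1}]$ with $G(x,g_1,\dots,g_{n+1})=h$. The *essential key forms* $f_0=x,f_1,\dots,f_{l+1}$ are the subsequence formed by $g_0$,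 the $g_j$ with $1\le j\le n$ and $\alpha_j>1$, and $g_{n+1}$. Composing the recursions between consecutive essential key forms gives, for $1\le j\le l$, $f_{j+1}=f_j^{p_j}-\sum_{i=0}^{j_n}c_{j,i}f_0^{\beta^i_{j,0}}\cdots f_j^{\beta^i_{j,j}}$, with $c_{j,i}\in\mathbb C^*$, $\beta^i_{j,t}\in\mathbb Z$, $\beta^i_{j,t}\geq 0$ for $t\ge1$, and $\beta^0_{j,j}=0$, where the terms are listed in decreasing order of their $\delta$-values. Fix $k$ with $1\le k\le l+1$, and put $A_k=\mathbb C[x,y_1,\dots,y_k]$, $\tilde A_k=A_k[z]$, $\omega_j=\delta_k(f_j)$ for $0\le j\le k$. Let $\omega$ be the weighted degree on $\tilde A_k$ with weights $\omega_0$ for $x$, $\omega_j$ for $y_j$ and $1$ for $z$, and $\pi_k:A_k\to\mathbb C[x,x^{-1},y]$ the $\mathbb C$-algebra map with $x\mapsto x$, $y_j\mapsto f_j$. For $1\le j\le k-1$ put $$\tilde F_{j+1}=y_j^{p_j}-\sum_{i=0}^{j_n}c_{j,i}\,x^{\beta^i_{j,0}}y_1^{\beta^i_{j,1}}\cdots y_j^{\beta^i_{j,j}}\,z^{\,p_j\omega_j-\sum_t\beta^i_{j,t}\omega_t},\qquad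 H_{j+1}=y_j^{p_j}-c_{j,0}\,x^{\beta^0_{j,0}}y_1^{\beta^0_{j,1}}\cdots y_{j-1}^{\beta^0_{j,j-1}} .$$ Let $\mathbb C[x,y]^{\delta_k}=\bigoplus_{d\ge0}\{f\in\mathbb C[x,y]:\delta_k(f)\le d\}$, and write $(f)_d$ for the copy of $f$ in degree $d$. Order the monomials of $A_k$ by $\prec_k$: compare $\omega$ first; in case of a tie, the exponent vector that is smaller at the right-most entry where the two differ is the smaller one. **Statement.** Assume $f_j\in\mathbb C[x,y]$ and $\delta_k(f_j)>0$ for all $0\le j\le k$. Then the $\omega_j$ are positive integers, $\omega_{j+1}<p_j\omega_j$, $\beta^i_{j,0}\ge0$ and $\sum_t\beta^i_{j,t}\omega_t\le p_j\omega_j$ for $1\le j\le k-1$ and all $i$ (so that the $\tilde F_{j+1}$ and $H_{j+1}$ are polynomials), and: 1. Let $\tilde J_k\subseteq\tilde A_k$ be the ideal generated by the $y_{j+1}z^{p_j\omega_j-\omega_{j+1}}-\tilde F_{j+1}$, $1\le j\le k-1$. There is an isomorphism of graded $\mathbb C$-algebras $\tilde A_k/\tilde J_k\cong\mathbb C[x,y]^{\delta_k}$,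 given by $z\mapsto(1)_1$, $x\mapsto(x)_{\omega_0}$, $y_j\mapsto(f_j)_{\omega_j}$. Moreover this presents $\operatorname{Proj}\mathbb C[x,y]^{\delta_k}$ as a weighted complete intersection: the $k-1$ generators are weighted homogeneous of positive degree and $\dim\tilde A_k/\tilde J_k=\dim\tilde A_k-(k-1)$. 2. Let $J_k\subseteq A_k$ be the ideal generated by the leading weighted homogeneous forms (with respect to $\omega$) of all $F\in A_k$ with $\delta_k(\pi_k(F))<\omega(F)$. Then $(H_k,\dots,H_2)$ is a Gröbner basis of $J_k$ with respect to $\prec_k$. -/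

import Mathlib

open Polynomial

noncomputable section

namespace KeyFormsAtInfinity

/-- `ℂ[x, x⁻¹][y]`; the outer polynomial variable is `y`. -/
abbrev LaurentXY : Type := Polynomial (LaurentPolynomial ℂ)

/-- `ℂ[x, y] = ℂ[x][y]`; the outer polynomial variable is `y`. -/
abbrev PolyXY : Type := Polynomial (Polynomial ℂ)

/-- The inclusion `ℂ[x, y] → ℂ[x, x⁻¹, y]`. -/
def incl : PolyXY →ₐ[ℂ] LaurentXY :=
  Polynomial.mapAlgHom Polynomial.toLaurentAlg

/-! ### Degree-wise Puiseux polynomials -/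

/-- All exponents of the Puiseux polynomial `φ` lie in `(1/N)ℤ`. -/
def ExponentsIn (N : ℕ) (φ : ℚ →₀ ℂ) : Prop :=
  ∀ e ∈ φ.support, ∃ a : ℤ, e = a / N

/-- A generic degree-wise Puiseux series `φ(x) + ξ x ^ r` (`φ` a finite sum of terms `c x ^ e`,
`e ∈ ℚ`, all with `e > r`) together with its formal Puiseux pairs
`(q 1, p 1), …, (q (l + 1), p (l + 1))`: the first `l` of these are the Puiseux pairs of `φ`, and
the last one is given by `r = q (l + 1) / (p 1 ⋯ p (l + 1))`.
The values of `q`, `p` at other indices play no role. -/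
structure GenericPuiseux where
  φ : ℚ →₀ ℂ
  r : ℚ
  r_lt : ∀ e ∈ φ.support, r < e
  l : ℕ
  q : ℕ → ℤ
  p : ℕ → ℕ
  two_le : ∀ j, 1 ≤ j → j ≤ l → 2 ≤ p j
  last_pos : 1 ≤ p (l + 1)
  coprime : ∀ j, 1 ≤ j → j ≤ l + 1 → IsCoprime (q j) (p j : ℤ)
  /-- the polydromy order of `φ` is `p 1 ⋯ p l` -/
  polydromy : IsLeast {N : ℕ | 0 < N ∧ ExponentsIn N φ} (∏ i ∈ Finset.Icc 1 l, p i)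
  /-- the part of `φ` of degree `> q j / (p 1 ⋯ p j)` has exponents in `(1 / (p 1 ⋯ p (j-1))) ℤ` -/
  pair_above : ∀ j, 1 ≤ j → j ≤ l →
    ExponentsIn (∏ i ∈ Finset.Icc 1 (j - 1), p i)
      (φ.filter fun e => (q j : ℚ) / ((∏ i ∈ Finset.Icc 1 j, p i : ℕ) : ℚ) < e)
  /-- the part of `φ` of degree `≥ q j / (p 1 ⋯ p j)` does not -/
  pair_at : ∀ j, 1 ≤ j → j ≤ l →
    ¬ ExponentsIn (∏ i ∈ Finset.Icc 1 (j - 1), p i)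
      (φ.filter fun e => (q j : ℚ) / ((∏ i ∈ Finset.Icc 1 j, p i : ℕ) : ℚ) ≤ e)
  r_eq : r = (q (l + 1) : ℚ) / ((∏ i ∈ Finset.Icc 1 (l + 1), p i : ℕ) : ℚ)

/-- Finite sums of terms `c(ξ) x ^ e` with `c(ξ) ∈ ℂ[ξ]` and `e ∈ ℚ`. -/
abbrev PuiseuxXi : Type := AddMonoidAlgebra (Polynomial ℂ) ℚ

/-- The degree in `x`, with `deg 0 = ⊥`. -/
def degX (h : PuiseuxXi) : WithBot ℚ := h.supDegree WithBot.some

/-- The inclusion `ℂ[x, x⁻¹] → ⋃ ℂ[ξ][x^{1/N}, x^{-1/N}]`. -/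
def laurentToPuiseux : LaurentPolynomial ℂ →+* PuiseuxXi :=
  (AddMonoidAlgebra.mapDomainRingHom (Polynomial ℂ) (Int.castAddHom ℚ)).comp
    (AddMonoidAlgebra.mapRingHom ℤ (Polynomial.C : ℂ →+* Polynomial ℂ))

namespace GenericPuiseux

variable (D : GenericPuiseux)

/-- `p 1 ⋯ p k` -/
def P (k : ℕ) : ℕ := ∏ i ∈ Finset.Icc 1 k, D.p i

/-- The exponent `q k / (p 1 ⋯ p k)`; for `k = l + 1` this is `r`. -/
def expo (k : ℕ) : ℚ := (D.q k : ℚ) / (D.P k : ℚ)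

/-- `φ_k(x) + ξ x ^ (q k / (p 1 ⋯ p k))`, where `φ_k` consists of the terms of `φ` of degree
larger than `q k / (p 1 ⋯ p k)`. -/
def series (k : ℕ) : PuiseuxXi :=
  AddMonoidAlgebra.ofCoeff
      ((D.φ.filter fun e => D.expo k < e).mapRange Polynomial.C Polynomial.C_0) +
    AddMonoidAlgebra.single (D.expo k) (Polynomial.X : Polynomial ℂ)

/-- The substitution of the `k`-th generic series for `y`. -/
def subst (k : ℕ) : LaurentXY →+* PuiseuxXi :=
  Polynomial.eval₂RingHom laurentToPuiseux (D.series k)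

/-- The semidegree `δ_k`: `δ_k(f) = p 1 ⋯ p k * deg_x (f(x, φ_k(x) + ξ x ^ (q k / (p 1 ⋯ p k))))`,
with the convention `δ_k(0) = ⊥`. For `1 ≤ k ≤ l + 1` its values on `f ≠ 0` are integers. -/
def semidegree (k : ℕ) (f : LaurentXY) : WithBot ℚ :=
  (degX (D.subst k f)).map fun s => (D.P k : ℚ) * s

/-- The semidegree `δ = δ_{l+1}` with generic degree-wise Puiseux series `φ(x) + ξ x ^ r`. -/
def fullSemidegree : LaurentXY → WithBot ℚ := D.semidegree (D.l + 1)

end GenericPuiseux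

/-! ### Key forms and essential key forms -/

/-- The weighted degree on `B = ℂ[x, x⁻¹][y_1, …, y_N]` with weights `ω 0` for `x` and `ω j` for
`y_j` (the variable `y_j` has index `j - 1` in `Fin N`); the value at `0` is `⊥`. -/
def weightedDegB {N : ℕ} (ω : ℕ → ℚ) (G : MvPolynomial (Fin N) (LaurentPolynomial ℂ)) :
    WithBot ℚ :=
  G.support.sup fun m => (MvPolynomial.coeff m G).coeff.support.sup fun a =>
    (((a : ℚ) * ω 0 + ∑ i, (m i : ℚ) * ω (i.val + 1) : ℚ) : WithBot ℚ)

/-- The sequence of key forms `g 0, …, g (n + 1)` of `δ`, with the numbers `α j`, `θ j` and the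
exponents `β₀ j` (of `g 0 = x`) and `β j i` (of `g i`, `1 ≤ i < j`) of its recursion,
`1 ≤ j ≤ n`. Values at other indices play no role. -/
structure KeyForms (δ : LaurentXY → WithBot ℚ) where
  n : ℕ
  g : ℕ → LaurentXY
  α : ℕ → ℕ
  β₀ : ℕ → ℤ
  β : ℕ → ℕ → ℕ
  θ : ℕ → ℂ
  /-- the values `δ (g j)` -/
  ω : ℕ → ℚ
  ω_eq : ∀ j ≤ n + 1, δ (g j) = (ω j : WithBot ℚ)
  g_zero : g 0 = Polynomial.C (LaurentPolynomial.T 1)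
  g_one : g 1 = Polynomial.X
  α_min : ∀ j, 1 ≤ j → j ≤ n →
    IsLeast {a : ℕ | 0 < a ∧ (a : ℚ) * ω j ∈ AddSubgroup.closure (ω '' Set.Iio j)} (α j)
  β_lt : ∀ j i, 1 ≤ i → i < j → j ≤ n → β j i < α i
  ω_rel : ∀ j, 1 ≤ j → j ≤ n →
    (α j : ℚ) * ω j = (β₀ j : ℚ) * ω 0 + ∑ i ∈ Finset.Ico 1 j, (β j i : ℚ) * ω i
  ω_lt : ∀ j, 1 ≤ j → j ≤ n → ω (j + 1) < (α j : ℚ) * ω j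
  θ_ne : ∀ j, 1 ≤ j → j ≤ n → θ j ≠ 0
  g_succ : ∀ j, 1 ≤ j → j ≤ n →
    g (j + 1) = g j ^ α j -
      θ j • (Polynomial.C (LaurentPolynomial.T (β₀ j)) * ∏ i ∈ Finset.Ico 1 j, g i ^ β j i)
  /-- `δ(h)` is the least weighted degree of the polynomials `G` with `G(x, g 1, …, g (n+1)) = h` -/
  generating : ∀ h : LaurentXY, h ≠ 0 →
    IsLeast ((weightedDegB ω) '' {G : MvPolynomial (Fin (n + 1)) (LaurentPolynomial ℂ) |
      MvPolynomial.aeval (fun i : Fin (n + 1) => g (i.val + 1)) G = h}) (δ h)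

namespace KeyForms

variable {δ : LaurentXY → WithBot ℚ} (K : KeyForms δ)

/-- The `s`-th element (counting from `0`) of `{0} ∪ {j : 1 ≤ j ≤ n, α j > 1} ∪ {n + 1}`. -/
def essIdx (s : ℕ) : ℕ :=
  Nat.nth (fun j => j = 0 ∨ (1 ≤ j ∧ j ≤ K.n ∧ 1 < K.α j) ∨ j = K.n + 1) s

/-- The essential key forms `f 0, f 1, …`: the key forms `g j` with `j = 0`, or `1 ≤ j ≤ n` and
`α j > 1`, or `j = n + 1`. -/
def ess (s : ℕ) : LaurentXY := K.g (K.essIdx s)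

/-- The steps of the recursion `g j ↦ g (j + 1)` that lead from `f s` to `f (s + 1)`, so that
`f (s+1) = f s ^ α - ∑ i ∈ steps s, θ i * x ^ (β₀ i) * ∏ t, f t ^ β i (essIdx t)`. The first of
them is `i = essIdx s`. -/
def steps (s : ℕ) : Finset ℕ := Finset.Ico (K.essIdx s) (K.essIdx (s + 1))

/-- The exponents, in `A_k = ℂ[x, y_1, …, y_k]`, of the monomial that is subtracted at step `i`:
variable `0` is `x`, variable `t ≥ 1` is `y_t`. The exponent `β₀ i` of `x` has to be nonnegative
for this to be meaningful. -/
def expoA (k i : ℕ) : Fin (k + 1) →₀ ℕ :=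
  Finsupp.equivFunOnFinite.symm fun t =>
    if t.val = 0 then (K.β₀ i).toNat
    else if K.essIdx t.val < i then K.β i (K.essIdx t.val) else 0

end KeyForms

/-! ### The polynomial rings `A_k`, `A_k[z]`, the ideals, and the forms -/

/-- `A_k = ℂ[x, y_1, …, y_k]`; variable `0` is `x` and variable `t ≥ 1` is `y_t`. -/
abbrev A (k : ℕ) : Type := MvPolynomial (Fin (k + 1)) ℂ

/-- `A_k[z]`; variable `none` is `z`. -/
abbrev Az (k : ℕ) : Type := MvPolynomial (Option (Fin (k + 1))) ℂ

section Setup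

variable (D : GenericPuiseux) (K : KeyForms D.fullSemidegree) (k : ℕ)

/-- The weights `ω_j = δ_k(f_j)`, for positive values; `ω_0` is the weight of `x`. -/
def weight (j : ℕ) : ℕ := ⌊(D.semidegree k (K.ess j)).unbotD 0⌋₊

/-- The weights on `A_k`. -/
def weightA (t : Fin (k + 1)) : ℕ := weight D K k t.val

/-- The weights on `A_k[z]`; `z` has weight `1`. -/
def weightAz : Option (Fin (k + 1)) → ℕ
  | none => 1
  | some t => weightA D K k t

/-- `π_k : A_k → ℂ[x, x⁻¹, y]`, `x ↦ x`, `y_j ↦ f_j`. -/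
def piA : A k →ₐ[ℂ] LaurentXY :=
  MvPolynomial.aeval fun t : Fin (k + 1) => K.ess t.val

/-- `F ↦ π_k(F|_{z = 1})` on `A_k[z]`. -/
def piAz : Az k →ₐ[ℂ] LaurentXY :=
  MvPolynomial.aeval fun v : Option (Fin (k + 1)) =>
    match v with
    | none => 1
    | some t => K.ess t.val

/-- The variable `y_j` as an index in `Fin (k + 1)`, for `j ≤ k`. -/
def yIdx (j : ℕ) : Fin (k + 1) := Fin.ofNat (k + 1) j

/-- The homogenization `F̃_{j+1} ∈ A_k[z]`, `1 ≤ j ≤ k - 1`, of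
`F_{j+1} = y_j ^ p_j - ∑ i, c_{j,i} x ^ β^i_{j,0} y_1 ^ β^i_{j,1} ⋯ y_j ^ β^i_{j,j}`. -/
def homF (j : ℕ) : Az k :=
  MvPolynomial.X (some (yIdx k j)) ^ D.p j -
    ∑ i ∈ K.steps j,
      MvPolynomial.rename some (MvPolynomial.monomial (K.expoA k i) (K.θ i)) *
        MvPolynomial.X none ^
          (D.p j * weight D K k j - Finsupp.weight (weightA D K k) (K.expoA k i))

/-- The generators `y_{j+1} z ^ (p_j ω_j - ω_{j+1}) - F̃_{j+1}`, `1 ≤ j ≤ k - 1`. -/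
def relGen (j : ℕ) : Az k :=
  MvPolynomial.X (some (yIdx k (j + 1))) *
      MvPolynomial.X none ^ (D.p j * weight D K k j - weight D K k (j + 1)) -
    homF D K k j

/-- The family of the `k - 1` generators. -/
def relFamily (i : Fin (k - 1)) : Az k := relGen D K k (i.val + 1)

/-- The ideal `J̃_k`. -/
def idealJz : Ideal (Az k) := Ideal.span (Set.range (relFamily D K k))

/-- The leading form `H_{j+1} = y_j ^ p_j - c_{j,0} x ^ β^0_{j,0} y_1 ^ β^0_{j,1} ⋯`. -/
def leadH (j : ℕ) : A k :=
  MvPolynomial.X (yIdx k j) ^ D.p j -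
    MvPolynomial.monomial (K.expoA k (K.essIdx j)) (K.θ (K.essIdx j))

/-- The ideal `J_k` generated by the leading weighted homogeneous forms of all `F ∈ A_k` with
`δ_k(π_k(F)) < ω(F)`. -/
def idealJ : Ideal (A k) :=
  Ideal.span {L | ∃ F : A k,
    D.semidegree k (piA D K k F) <
        (((MvPolynomial.weightedTotalDegree (weightA D K k) F : ℕ) : ℚ) : WithBot ℚ) ∧
    L = MvPolynomial.weightedHomogeneousComponent (weightA D K k)
        (MvPolynomial.weightedTotalDegree (weightA D K k) F) F}

end Setup

/-! ### The graded ring of a semidegree -/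

namespace GenericPuiseux

variable (D : GenericPuiseux)

lemma semidegree_le_coe_iff (k : ℕ) (f : LaurentXY) (b : ℚ) :
    D.semidegree k f ≤ (b : WithBot ℚ) ↔
      ∀ e ∈ (D.subst k f).coeff.support, (D.P k : ℚ) * e ≤ b := by
  have hmono : Monotone fun s : ℚ => (D.P k : ℚ) * s := fun a b h =>
    mul_le_mul_of_nonneg_left h (Nat.cast_nonneg _)
  have hmap : D.semidegree k f =
      (D.subst k f).coeff.support.sup fun e => (((D.P k : ℚ) * e : ℚ) : WithBot ℚ) := by
    unfold semidegree degX AddMonoidAlgebra.supDegree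
    exact Finset.apply_sup_eq_sup_comp_of_linearOrder _ (WithBot.monotone_map_iff.2 hmono) rfl
  rw [hmap, Finset.sup_le_iff]
  simp only [WithBot.coe_le_coe]

lemma semidegree_mul_le {k : ℕ} {f f' : LaurentXY} {a b : ℚ}
    (h : D.semidegree k f ≤ (a : WithBot ℚ)) (h' : D.semidegree k f' ≤ (b : WithBot ℚ)) :
    D.semidegree k (f * f') ≤ ((a + b : ℚ) : WithBot ℚ) := by
  classical
  rw [semidegree_le_coe_iff] at *
  intro e he
  rw [map_mul] at he
  obtain ⟨u, hu, v, hv, rfl⟩ := Finset.mem_add.1 (AddMonoidAlgebra.support_coeff_mul_subset _ _ he)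
  rw [mul_add]
  exact add_le_add (h u hu) (h' v hv)

lemma semidegree_algebraMap_le (k : ℕ) (c : ℂ) :
    D.semidegree k (incl (algebraMap ℂ PolyXY c)) ≤ ((0 : ℚ) : WithBot ℚ) := by
  rw [semidegree_le_coe_iff]
  intro e he
  have h1 : D.subst k (incl (algebraMap ℂ PolyXY c)) =
      AddMonoidAlgebra.single (0 : ℚ) (Polynomial.C c) := by
    rw [AlgHom.commutes]
    simp only [subst, laurentToPuiseux, Polynomial.algebraMap_apply, RingHom.comp_apply,
      Polynomial.coe_eval₂RingHom, Polynomial.eval₂_C]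
    rw [LaurentPolynomial.algebraMap_apply, ← LaurentPolynomial.single_eq_C,
      AddMonoidAlgebra.mapRingHom_single, AddMonoidAlgebra.mapDomainRingHom_apply,
      AddMonoidAlgebra.mapDomain_single, map_zero, Algebra.algebraMap_self, RingHom.id_apply]
  rw [h1] at he
  have : e = 0 := by
    by_contra hne
    simp [AddMonoidAlgebra.coeff_single, Ne.symm hne] at he
  simp [this]

/-- `{f ∈ ℂ[x, y] : δ_k(f) ≤ d}` (with `0` included). -/
def filtration (k d : ℕ) : Submodule ℂ PolyXY where
  carrier := {f | D.semidegree k (incl f) ≤ ((d : ℚ) : WithBot ℚ)}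
  zero_mem' := by
    change D.semidegree k (incl 0) ≤ _
    rw [semidegree_le_coe_iff]
    simp
  add_mem' := by
    classical
    intro f f' h h'
    change D.semidegree k (incl (f + f')) ≤ _
    change D.semidegree k (incl f) ≤ _ at h
    change D.semidegree k (incl f') ≤ _ at h'
    rw [semidegree_le_coe_iff] at *
    intro e he
    rw [map_add, map_add, AddMonoidAlgebra.coeff_add] at he
    rcases Finset.mem_union.1 (Finsupp.support_add he) with h1 | h1
    · exact h e h1
    · exact h' e h1
  smul_mem' := by
    intro c f h
    change D.semidegree k (incl f) ≤ _ at h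
    change D.semidegree k (incl (c • f)) ≤ _
    rw [Algebra.smul_def, map_mul]
    simpa using D.semidegree_mul_le (D.semidegree_algebraMap_le k c) h

instance (k : ℕ) : SetLike.GradedMonoid (D.filtration k) where
  one_mem := by
    have := D.semidegree_algebraMap_le k 1
    rw [map_one] at this
    change D.semidegree k (incl 1) ≤ _
    simpa using this
  mul_mem := by
    intro i j f f' h h'
    change D.semidegree k (incl (f * f')) ≤ _
    rw [map_mul]
    simpa using D.semidegree_mul_le h h'

/-- The graded ring `ℂ[x, y]^{δ_k} = ⨁_{d ≥ 0} {f : δ_k(f) ≤ d}`. -/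
abbrev gradedRing (k : ℕ) : Type := DirectSum ℕ fun d => D.filtration k d

end GenericPuiseux

/-! ### Monomial order, Gröbner bases, weighted complete intersections -/

/-- Exponent vectors, ordered first by weight and then by the right-most differing entry. -/
def WeightColex {N : ℕ} (_w : Fin N → ℕ) : Type := Fin N →₀ ℕ

namespace WeightColex

variable {N : ℕ} (w : Fin N → ℕ)

instance : AddCommMonoid (WeightColex w) := inferInstanceAs (AddCommMonoid (Fin N →₀ ℕ))

/-- The identity map. -/
def of : (Fin N →₀ ℕ) ≃+ WeightColex w := AddEquiv.refl (Fin N →₀ ℕ)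

/-- The order is pulled back along this map. -/
def key (a : WeightColex w) : ℕ ×ₗ Colex (Fin N →₀ ℕ) :=
  toLex (Finsupp.weight w ((of w).symm a), toColex ((of w).symm a))

lemma key_injective : Function.Injective (key w) := by
  intro a b h
  have h2 := congrArg (fun z => (ofLex z).2) h
  exact h2

lemma key_add (a b : WeightColex w) : key w (a + b) = key w a + key w b := by
  unfold key
  rw [map_add, map_add]
  rfl

instance : LinearOrder (WeightColex w) := LinearOrder.lift' (key w) (key_injective w)

lemma key_le_key {a b : WeightColex w} : key w a ≤ key w b ↔ a ≤ b := Iff.rfl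

instance : IsOrderedAddMonoid (WeightColex w) where
  add_le_add_left a b h c := by
    rw [← key_le_key, key_add, key_add]
    exact add_le_add_left ((key_le_key w).2 h) _

instance : WellFoundedLT (WeightColex w) :=
  ⟨InvImage.wf (key w) (inferInstance : WellFoundedLT (ℕ ×ₗ Colex (Fin N →₀ ℕ))).wf⟩

end WeightColex

/-- The monomial order `≺`: compare weights first, then the right-most entry that differs. -/
def weightOrder {N : ℕ} (w : Fin N → ℕ) : MonomialOrder (Fin N) where
  syn := WeightColex w
  toSyn := WeightColex.of w
  toSyn_monotone := by
    intro a b h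
    rw [← WeightColex.key_le_key]
    obtain ⟨c, rfl⟩ := exists_add_of_le h
    rw [map_add, WeightColex.key_add]
    refine le_add_of_nonneg_right ?_
    rw [Prod.Lex.le_iff]
    rcases Nat.eq_zero_or_pos (Finsupp.weight w c) with h0 | h0
    · right
      exact ⟨h0.symm, Finsupp.toColex_monotone (zero_le)⟩
    · left
      exact h0

lemma weightOrder_lt_iff {N : ℕ} (w : Fin N → ℕ) (a b : Fin N →₀ ℕ) :
    (weightOrder w).toSyn a < (weightOrder w).toSyn b ↔
      Finsupp.weight w a < Finsupp.weight w b ∨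
        (Finsupp.weight w a = Finsupp.weight w b ∧
          ∃ i, (∀ j, i < j → a j = b j) ∧ a i < b i) := by
  change toLex (Finsupp.weight w a, toColex a) < toLex (Finsupp.weight w b, toColex b) ↔ _
  rw [Prod.Lex.toLex_lt_toLex]
  rfl

/-- `G` is a Gröbner basis of the ideal `I`: `G ⊆ I` is finite and the leading terms of the
elements of `G` generate the ideal generated by the leading terms of the elements of `I`. -/
def IsGroebnerBasis {σ : Type} (m : MonomialOrder σ) (G : Set (MvPolynomial σ ℂ))
    (I : Ideal (MvPolynomial σ ℂ)) : Prop :=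
  G.Finite ∧ G ⊆ I ∧
    Ideal.span (m.leadingTerm '' G) = Ideal.span (m.leadingTerm '' (I : Set (MvPolynomial σ ℂ)))

/-- The polynomials `r_1, …, r_c` define a weighted complete intersection in the weighted
projective space with the positive weights `w`: they are weighted homogeneous, of positive degree,
and the dimension of their common zero locus is smaller by exactly `c`. -/
def IsWeightedCompleteIntersection {σ : Type} (w : σ → ℕ) {c : ℕ}
    (rel : Fin c → MvPolynomial σ ℂ) : Prop :=
  (∀ v, 0 < w v) ∧
  (∀ i, ∃ d, 0 < d ∧ MvPolynomial.IsWeightedHomogeneous w (rel i) d) ∧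
  ringKrullDim (MvPolynomial σ ℂ ⧸ Ideal.span (Set.range rel)) + (c : WithBot ℕ∞) =
    ringKrullDim (MvPolynomial σ ℂ)

end KeyFormsAtInfinity

end

/-!
Substituting `y = φ_k(x) + ξ x ^ r_k` in `f`, where `r_k = q_k / (p_1 ⋯ p_k)`, let `c_f(ξ)` be the
coefficient of the highest power of `x`, which computes `δ_k(f)` and is multiplicative in `f`. For
the essential key forms `f_j` with `j < k` it is a nonzero constant, while for `f_k` it is a
polynomial of degree one in `ξ`. A monomial in `x, f_1, …, f_k` is called standard if its exponent
at `f_j` is less than `p_j` for `1 ≤ j < k`. By uniqueness of mixed radix expansions, standard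
monomials of equal weight have different exponents at `f_k`. Hence their top coefficients have
different degrees in `ξ` and cannot cancel, so that `δ_k` of a combination of standard monomials is
its weighted degree.

The relations rewrite every polynomial, without raising its degree, as a combination of standard
monomials. Together with the absence of cancellation this shows that they generate the kernel of
`Ã_k → ℂ[x, y]^{δ_k}`, that this map is surjective, and that no leading monomial of an element of
`J_k` is standard. The quotient is a finite extension of the polynomial ring `ℂ[z, x, y_k]`,
which gives its dimension.
-/

noncomputable section

namespace KeyFormsAtInfinity

/-! ### Top terms -/

section HasTop

variable {R Γ ι : Type*} [LinearOrder Γ]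

/-- The top term of `H` at `v`: all exponents of `H` are at most `v`, and `c` is the coefficient
at `v`. Since `c = 0` is allowed, cancellation of top terms needs no case distinction. -/
def HasTop [Semiring R] (H : AddMonoidAlgebra R Γ) (v : Γ) (c : R) : Prop :=
  (∀ e, v < e → H.coeff e = 0) ∧ H.coeff v = c

namespace HasTop

section Semiring

variable [Semiring R] {H H' : AddMonoidAlgebra R Γ} {v v' : Γ} {c c' : R}

lemma le_of_coeff_ne_zero (h : HasTop H v c) {e : Γ} (he : H.coeff e ≠ 0) : e ≤ v :=
  not_lt.1 fun hlt => he (h.1 e hlt)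

lemma add (h : HasTop H v c) (h' : HasTop H' v c') : HasTop (H + H') v (c + c') :=
  ⟨fun e he => by simp [h.1 e he, h'.1 e he], by simp [h.2, h'.2]⟩

lemma of_lt (h : HasTop H v c) (hv : v < v') : HasTop H v' 0 :=
  ⟨fun e he => h.1 e (hv.trans he), h.1 v' hv⟩

lemma single (v : Γ) (c : R) : HasTop (AddMonoidAlgebra.single v c) v c :=
  ⟨fun e he => by simp [he.ne], by simp⟩

lemma sum (s : Finset ι) {H : ι → AddMonoidAlgebra R Γ} {c : ι → R}
    (h : ∀ i ∈ s, HasTop (H i) v (c i)) : HasTop (∑ i ∈ s, H i) v (∑ i ∈ s, c i) := by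
  constructor
  · intro e he
    rw [AddMonoidAlgebra.coeff_sum, Finsupp.finsetSum_apply]
    exact Finset.sum_eq_zero fun i hi => (h i hi).1 e he
  · rw [AddMonoidAlgebra.coeff_sum, Finsupp.finsetSum_apply]
    exact Finset.sum_congr rfl fun i hi => (h i hi).2

lemma le_of_ne_zero (h : HasTop H v c) (h' : HasTop H v' c') (hc : c ≠ 0) : v ≤ v' :=
  h'.le_of_coeff_ne_zero (h.2.trans_ne hc)

lemma unique (h : HasTop H v c) (h' : HasTop H v' c') (hc : c ≠ 0) (hc' : c' ≠ 0) :
    v = v' ∧ c = c' := by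
  have hv : v = v' := (h.le_of_ne_zero h' hc).antisymm (h'.le_of_ne_zero h hc')
  exact ⟨hv, by rw [← h.2, hv, h'.2]⟩

lemma exists_ne_zero (hH : H ≠ 0) : ∃ v c, c ≠ 0 ∧ HasTop H v c := by
  have hs : H.coeff.support.Nonempty :=
    Finsupp.support_nonempty_iff.2 (AddMonoidAlgebra.coeff_eq_zero.not.2 hH)
  obtain ⟨v, hv, hmax⟩ := H.coeff.support.exists_max_image id hs
  refine ⟨v, H.coeff v, Finsupp.mem_support_iff.1 hv, fun e he => ?_, rfl⟩
  by_contra hne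
  exact (hmax e (Finsupp.mem_support_iff.2 hne)).not_gt he

lemma mul [AddCommMonoid Γ] [IsOrderedCancelAddMonoid Γ] (h : HasTop H v c)
    (h' : HasTop H' v' c') : HasTop (H * H') (v + v') (c * c') := by
  constructor
  · intro e he
    rw [AddMonoidAlgebra.coeff_mul]
    refine Finset.sum_eq_zero fun a ha => Finset.sum_eq_zero fun b hb => if_neg fun hab => ?_
    exact ((add_le_add (h.le_of_coeff_ne_zero (Finsupp.mem_support_iff.1 ha))
      (h'.le_of_coeff_ne_zero (Finsupp.mem_support_iff.1 hb))).trans_lt he).ne hab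
  · rw [← h.2, ← h'.2]
    refine AddMonoidAlgebra.coeff_mul_add_of_uniqueAdd fun a b ha hb hab => ?_
    exact (add_eq_add_iff_eq_and_eq (h.le_of_coeff_ne_zero (Finsupp.mem_support_iff.1 ha))
      (h'.le_of_coeff_ne_zero (Finsupp.mem_support_iff.1 hb))).1 hab

lemma pow [AddCommMonoid Γ] [IsOrderedCancelAddMonoid Γ] (h : HasTop H v c) (n : ℕ) :
    HasTop (H ^ n) (n • v) (c ^ n) := by
  induction n with
  | zero =>
    rw [pow_zero, pow_zero, zero_nsmul]
    exact single 0 1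
  | succ n ih => simpa only [pow_succ, succ_nsmul] using ih.mul h

end Semiring

lemma sub [Ring R] {H H' : AddMonoidAlgebra R Γ} {v : Γ} {c c' : R} (h : HasTop H v c)
    (h' : HasTop H' v c') : HasTop (H - H') v (c - c') :=
  ⟨fun e he => by simp [h.1 e he, h'.1 e he], by simp [h.2, h'.2]⟩

lemma prod [CommSemiring R] [AddCommMonoid Γ] [IsOrderedCancelAddMonoid Γ] (s : Finset ι)
    {H : ι → AddMonoidAlgebra R Γ} {v : ι → Γ} {c : ι → R}
    (h : ∀ i ∈ s, HasTop (H i) (v i) (c i)) :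
    HasTop (∏ i ∈ s, H i) (∑ i ∈ s, v i) (∏ i ∈ s, c i) := by
  classical
  induction s using Finset.induction_on with
  | empty => exact single 0 1
  | insert a s ha ih =>
    rw [Finset.prod_insert ha, Finset.prod_insert ha, Finset.sum_insert ha]
    exact (h a (by simp)).mul (ih fun i hi => h i (by simp [hi]))

end HasTop

end HasTop

lemma HasTop.degX_eq {H : PuiseuxXi} {v : ℚ} {c : ℂ[X]} (h : HasTop H v c) (hc : c ≠ 0) :
    degX H = (v : WithBot ℚ) := by
  refine le_antisymm (Finset.sup_le fun e he => WithBot.coe_le_coe.2 ?_) ?_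
  · exact h.le_of_coeff_ne_zero (Finsupp.mem_support_iff.1 he)
  · exact Finset.le_sup (f := WithBot.some) (Finsupp.mem_support_iff.2 (by rwa [h.2]))

/-! ### Substitutions for `ξ` -/

/-- Puiseux polynomials over `ℂ`, viewed as Puiseux polynomials over `ℂ[ξ]`. -/
def constXi : AddMonoidAlgebra ℂ ℚ →+* PuiseuxXi := AddMonoidAlgebra.mapRingHom ℚ C

/-- The inclusion of the Laurent polynomials into the Puiseux polynomials over `ℂ`. -/
def laurentIncl : LaurentPolynomial ℂ →+* AddMonoidAlgebra ℂ ℚ :=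
  AddMonoidAlgebra.mapDomainRingHom ℂ (Int.castAddHom ℚ)

/-- The substitution `ξ ↦ 0`. -/
def atZero : PuiseuxXi →+* AddMonoidAlgebra ℂ ℚ := AddMonoidAlgebra.mapRingHom ℚ constantCoeff

/-- The substitution `ξ ↦ τ`. -/
def specialize (τ : PuiseuxXi) : PuiseuxXi →+* PuiseuxXi :=
  AddMonoidAlgebra.liftNCRingHom (Polynomial.aeval τ : ℂ[X] →ₐ[ℂ] PuiseuxXi).toRingHom
    (AddMonoidAlgebra.of ℂ[X] ℚ) fun _ _ => Commute.all _ _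

lemma constXi_single (e : ℚ) (c : ℂ) :
    constXi (AddMonoidAlgebra.single e c) = AddMonoidAlgebra.single e (C c) :=
  AddMonoidAlgebra.mapRingHom_single ..

lemma coeff_constXi (H : AddMonoidAlgebra ℂ ℚ) (e : ℚ) : (constXi H).coeff e = C (H.coeff e) :=
  AddMonoidAlgebra.coeff_mapRingHom ..

lemma coeff_atZero (H : PuiseuxXi) (e : ℚ) : (atZero H).coeff e = (H.coeff e).coeff 0 :=
  AddMonoidAlgebra.coeff_mapRingHom ..

lemma atZero_constXi (H : AddMonoidAlgebra ℂ ℚ) : atZero (constXi H) = H := by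
  ext e
  rw [coeff_atZero, coeff_constXi, coeff_C_zero]

lemma laurentIncl_single (a : ℤ) (c : ℂ) :
    laurentIncl (AddMonoidAlgebra.single a c) = AddMonoidAlgebra.single (a : ℚ) c := by
  rw [laurentIncl, AddMonoidAlgebra.mapDomainRingHom_apply, AddMonoidAlgebra.mapDomain_single]
  rfl

lemma laurentToPuiseux_eq (a : LaurentPolynomial ℂ) :
    laurentToPuiseux a = constXi (laurentIncl a) :=
  (RingHom.congr_fun
    (AddMonoidAlgebra.mapRingHom_comp_mapDomainRingHom (C : ℂ →+* ℂ[X]) (Int.castAddHom ℚ)) a).symm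

lemma laurentToPuiseux_T (a : ℤ) :
    laurentToPuiseux (LaurentPolynomial.T a) = AddMonoidAlgebra.single (a : ℚ) 1 := by
  rw [laurentToPuiseux_eq, LaurentPolynomial.T, laurentIncl_single, constXi_single, C_1]

lemma algebraMap_puiseux (c : ℂ) :
    algebraMap ℂ PuiseuxXi c = AddMonoidAlgebra.single 0 (C c) := rfl

lemma specialize_single (τ : PuiseuxXi) (e : ℚ) (c : ℂ[X]) :
    specialize τ (AddMonoidAlgebra.single e c) =
      Polynomial.aeval τ c * AddMonoidAlgebra.single e 1 := by
  rw [specialize, AddMonoidAlgebra.liftNCRingHom_single]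
  rfl

lemma specialize_constXi (τ : PuiseuxXi) (H : AddMonoidAlgebra ℂ ℚ) :
    specialize τ (constXi H) = constXi H := by
  induction H using AddMonoidAlgebra.induction_linear with
  | zero => simp only [map_zero]
  | add p q hp hq => simp only [map_add, hp, hq]
  | single e c =>
    rw [constXi_single, specialize_single, aeval_C, algebraMap_puiseux,
      AddMonoidAlgebra.single_mul_single, zero_add, mul_one]

lemma HasTop.aeval {τ : PuiseuxXi} {a : ℂ} (hτ : HasTop τ 0 (C a)) (c : ℂ[X]) :
    HasTop (Polynomial.aeval τ c) 0 (C (c.eval a)) := by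
  induction c using Polynomial.induction_on' with
  | add p q hp hq => simpa using hp.add hq
  | monomial n b =>
    rw [Polynomial.aeval_monomial, algebraMap_puiseux]
    simpa using (HasTop.single 0 (C b)).mul (hτ.pow n)

lemma HasTop.specialize {τ : PuiseuxXi} {a : ℂ} (hτ : HasTop τ 0 (C a)) {H : PuiseuxXi} {v : ℚ}
    {c : ℂ[X]} (h : HasTop H v c) : HasTop (specialize τ H) v (C (c.eval a)) := by
  have hterm : ∀ e ∈ H.coeff.support, HasTop
      (KeyFormsAtInfinity.specialize τ (AddMonoidAlgebra.single e (H.coeff e)))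
      v (if e = v then C (c.eval a) else 0) := by
    intro e he
    have htop : HasTop (KeyFormsAtInfinity.specialize τ (AddMonoidAlgebra.single e (H.coeff e))) e
        (C ((H.coeff e).eval a)) := by
      rw [specialize_single]
      simpa using (hτ.aeval (H.coeff e)).mul (HasTop.single e 1)
    split_ifs with hev
    · subst hev
      rwa [h.2] at htop ⊢
    · exact htop.of_lt ((h.le_of_coeff_ne_zero (Finsupp.mem_support_iff.1 he)).lt_of_ne hev)
  have hH : ∑ e ∈ H.coeff.support, AddMonoidAlgebra.single e (H.coeff e) = H :=
    AddMonoidAlgebra.sum_coeff_single H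
  have hsum := HasTop.sum _ hterm
  rw [← map_sum, hH, Finset.sum_ite_eq' H.coeff.support v] at hsum
  convert hsum using 1
  split_ifs with hv
  · rfl
  · rw [← h.2, Finsupp.notMem_support_iff.1 hv, eval_zero, C_0]

/-! ### The exponents that accompany a power of `ξ` -/

/-- The Puiseux polynomials all of whose terms `ξ ^ m x ^ E` satisfy `E ∈ m e + Γ`. -/
def gradedSubring (e : ℚ) (Γ : AddSubgroup ℚ) : Subring PuiseuxXi where
  carrier := {H | ∀ E m, (H.coeff E).coeff m ≠ 0 → E - m * e ∈ Γ}
  zero_mem' E m hne := absurd rfl hne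
  one_mem' := by
    intro E m hne
    rw [AddMonoidAlgebra.one_def, AddMonoidAlgebra.coeff_single, Finsupp.single_apply] at hne
    split_ifs at hne with hE
    · rw [coeff_one, ite_ne_right_iff] at hne
      simp [← hE, hne.1]
    · exact absurd rfl hne
  add_mem' {H H'} h h' := by
    intro E m hne
    by_cases hzero : (H.coeff E).coeff m = 0
    · exact h' E m (by simpa [hzero] using hne)
    · exact h E m hzero
  neg_mem' h := fun E m hne => h E m (by simpa using hne)
  mul_mem' {H H'} h h' := by
    intro E m hne
    rw [AddMonoidAlgebra.coeff_mul, Finsupp.sum, finsetSum_coeff] at hne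
    obtain ⟨a, -, ha⟩ := Finset.exists_ne_zero_of_sum_ne_zero hne
    rw [Finsupp.sum, finsetSum_coeff] at ha
    obtain ⟨b, -, hb⟩ := Finset.exists_ne_zero_of_sum_ne_zero ha
    split_ifs at hb with hab
    · rw [coeff_mul] at hb
      obtain ⟨⟨i, j⟩, hij, hne⟩ := Finset.exists_ne_zero_of_sum_ne_zero hb
      have hsum := Γ.add_mem (h a i (left_ne_zero_of_mul hne)) (h' b j (right_ne_zero_of_mul hne))
      rw [← Finset.HasAntidiagonal.mem_antidiagonal.1 hij, ← hab]
      push_cast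
      convert hsum using 1
      ring
    · exact absurd rfl hb

lemma mem_gradedSubring {e : ℚ} {Γ : AddSubgroup ℚ} {H : PuiseuxXi} :
    H ∈ gradedSubring e Γ ↔ ∀ E m, (H.coeff E).coeff m ≠ 0 → E - m * e ∈ Γ := Iff.rfl

lemma constXi_mem_gradedSubring {e : ℚ} {Γ : AddSubgroup ℚ} {H : AddMonoidAlgebra ℂ ℚ}
    (h : ∀ E, H.coeff E ≠ 0 → E ∈ Γ) : constXi H ∈ gradedSubring e Γ := by
  rw [mem_gradedSubring]
  intro E m hne
  rw [coeff_constXi, coeff_C, ite_ne_right_iff] at hne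
  simpa [hne.1] using h E hne.2

lemma single_X_mem_gradedSubring (e : ℚ) (Γ : AddSubgroup ℚ) :
    AddMonoidAlgebra.single e X ∈ gradedSubring e Γ := by
  rw [mem_gradedSubring]
  intro E m hne
  rw [AddMonoidAlgebra.coeff_single, Finsupp.single_apply] at hne
  split_ifs at hne with hE
  · rw [coeff_X, ite_ne_right_iff] at hne
    simp [← hne.1, hE]
  · exact absurd rfl hne

/-! ### The derivative with respect to `ξ` -/

/-- The derivative with respect to `ξ`. -/
def derivXi : PuiseuxXi →+ PuiseuxXi where
  toFun H := AddMonoidAlgebra.map (Polynomial.derivative (R := ℂ)).toAddMonoidHom H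
  map_zero' := AddMonoidAlgebra.map_zero _
  map_add' := AddMonoidAlgebra.map_add _

lemma coeff_derivXi (H : PuiseuxXi) (e : ℚ) :
    (derivXi H).coeff e = derivative (H.coeff e) := rfl

lemma HasTop.derivXi {H : PuiseuxXi} {v : ℚ} {c : ℂ[X]} (h : HasTop H v c) :
    HasTop (derivXi H) v (derivative c) :=
  ⟨fun e he => by rw [coeff_derivXi, h.1 e he, derivative_zero], by rw [coeff_derivXi, h.2]⟩

lemma derivXi_single (e : ℚ) (c : ℂ[X]) :
    derivXi (AddMonoidAlgebra.single e c) = AddMonoidAlgebra.single e (derivative c) :=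
  AddMonoidAlgebra.map_single _ _ _

lemma derivXi_constXi (H : AddMonoidAlgebra ℂ ℚ) : derivXi (constXi H) = 0 := by
  ext1
  ext1 e
  rw [coeff_derivXi, coeff_constXi, derivative_C]
  rfl

lemma derivXi_mul (H H' : PuiseuxXi) :
    derivXi (H * H') = derivXi H * H' + H * derivXi H' := by
  induction H using AddMonoidAlgebra.induction_linear with
  | zero => simp only [zero_mul, map_zero, add_zero]
  | add p q hp hq =>
    rw [add_mul, map_add, hp, hq, map_add]
    ring
  | single e c =>
    induction H' using AddMonoidAlgebra.induction_linear with
    | zero => simp only [mul_zero, map_zero, add_zero]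
    | add p q hp hq =>
      rw [mul_add, map_add, hp, hq, map_add]
      ring
    | single e' c' =>
      simp only [AddMonoidAlgebra.single_mul_single, derivXi_single, derivative_mul,
        AddMonoidAlgebra.single_add]

/-! ### Puiseux pairs -/

/-- The group `(1 / N) ℤ`. -/
def fracGroup (N : ℕ) : AddSubgroup ℚ := AddSubgroup.zmultiples (1 / (N : ℚ))

lemma mem_fracGroup {N : ℕ} {e : ℚ} : e ∈ fracGroup N ↔ ∃ a : ℤ, e = a / N := by
  simp only [fracGroup, AddSubgroup.mem_zmultiples_iff, zsmul_eq_mul, mul_one_div, eq_comm]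

lemma fracGroup_le_of_dvd {M N : ℕ} (hN : N ≠ 0) (h : M ∣ N) : fracGroup M ≤ fracGroup N := by
  obtain ⟨c, rfl⟩ := h
  intro e he
  obtain ⟨a, rfl⟩ := mem_fracGroup.1 he
  refine mem_fracGroup.2 ⟨a * c, ?_⟩
  have hM : (M : ℚ) ≠ 0 := by exact_mod_cast left_ne_zero_of_mul hN
  have hc : (c : ℚ) ≠ 0 := by exact_mod_cast right_ne_zero_of_mul hN
  push_cast
  field_simp

namespace GenericPuiseux

variable (D : GenericPuiseux)

lemma P_zero : D.P 0 = 1 := rfl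

lemma P_succ (k : ℕ) : D.P (k + 1) = D.P k * D.p (k + 1) :=
  Finset.prod_Icc_succ_top (by lia) _

lemma P_dvd_P {k k' : ℕ} (h : k ≤ k') : D.P k ∣ D.P k' :=
  Finset.prod_dvd_prod_of_subset _ _ _ (Finset.Icc_subset_Icc_right h)

lemma p_pos {j : ℕ} (hj : 1 ≤ j) (hjl : j ≤ D.l + 1) : 0 < D.p j := by
  rcases Nat.lt_or_ge D.l j with h | h
  · obtain rfl : j = D.l + 1 := by lia
    exact D.last_pos
  · exact lt_of_lt_of_le two_pos (D.two_le j hj h)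

lemma P_pos {k : ℕ} (hk : k ≤ D.l + 1) : 0 < D.P k :=
  Finset.prod_pos fun _ hi => D.p_pos (Finset.mem_Icc.1 hi).1 ((Finset.mem_Icc.1 hi).2.trans hk)

lemma P_pos_rat {k : ℕ} (hk : k ≤ D.l + 1) : (0 : ℚ) < D.P k := by exact_mod_cast D.P_pos hk

lemma fracGroup_P_le {k k' : ℕ} (h : k ≤ k') (hk' : k' ≤ D.l + 1) :
    fracGroup (D.P k) ≤ fracGroup (D.P k') :=
  fracGroup_le_of_dvd (D.P_pos hk').ne' (D.P_dvd_P h)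

lemma intCast_mem_fracGroup_P {k : ℕ} (hk : k ≤ D.l + 1) (a : ℤ) : (a : ℚ) ∈ fracGroup (D.P k) :=
  D.fracGroup_P_le (Nat.zero_le k) hk (mem_fracGroup.2 ⟨a, by rw [P_zero, Nat.cast_one, div_one]⟩)

lemma expo_mem_fracGroup {k : ℕ} : D.expo k ∈ fracGroup (D.P k) := mem_fracGroup.2 ⟨D.q k, rfl⟩

lemma mul_expo_mem_fracGroup_iff {k : ℕ} (hk : k ≤ D.l) (a : ℤ) :
    a * D.expo (k + 1) ∈ fracGroup (D.P k) ↔ (D.p (k + 1) : ℤ) ∣ a := by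
  have hP := D.P_pos_rat (k := k) (by lia)
  have hp : (0 : ℚ) < D.p (k + 1) := by exact_mod_cast D.p_pos (by lia) (by lia)
  have hiff : ∀ b : ℤ, a * D.expo (k + 1) = b / D.P k ↔ a * D.q (k + 1) = D.p (k + 1) * b := by
    intro b
    rw [expo, P_succ, ← Int.cast_inj (α := ℚ)]
    push_cast
    field_simp
  simp only [mem_fracGroup, hiff]
  exact ⟨(D.coprime (k + 1) (by lia) (by lia)).symm.dvd_of_dvd_mul_right,
    fun h => h.mul_right _⟩

lemma expo_last : D.expo (D.l + 1) = D.r := D.r_eq.symm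

lemma mem_fracGroup_of_expo_lt {k : ℕ} (hk : k ≤ D.l) {e : ℚ} (he : D.φ e ≠ 0)
    (hlt : D.expo (k + 1) < e) : e ∈ fracGroup (D.P k) := by
  rw [mem_fracGroup]
  rcases hk.eq_or_lt with rfl | hk
  · exact D.polydromy.1.2 e (Finsupp.mem_support_iff.2 he)
  · refine D.pair_above (k + 1) (by lia) hk e ?_
    rw [Finsupp.support_filter, Finset.mem_filter]
    exact ⟨Finsupp.mem_support_iff.2 he, hlt⟩

lemma φ_expo_ne_zero {k : ℕ} (hk1 : 1 ≤ k) (hk : k ≤ D.l) : D.φ (D.expo k) ≠ 0 := by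
  obtain ⟨k, rfl⟩ := Nat.exists_eq_add_of_le' hk1
  have h := D.pair_at (k + 1) (by lia) hk
  simp only [ExponentsIn, not_forall] at h
  obtain ⟨e, he, hne⟩ := h
  rw [Finsupp.support_filter, Finset.mem_filter, Finsupp.mem_support_iff] at he
  rcases he.2.lt_or_eq with hlt | heq
  · exact absurd (mem_fracGroup.1 (D.mem_fracGroup_of_expo_lt (by lia) he.1 hlt)) hne
  · rw [show D.expo (k + 1) = e from heq]
    exact he.1

lemma expo_notMem_fracGroup {k : ℕ} (hk : k < D.l) : D.expo (k + 1) ∉ fracGroup (D.P k) := by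
  intro hmem
  have hdvd := (D.mul_expo_mem_fracGroup_iff hk.le 1).1 (by simpa using hmem)
  have hp := D.two_le (k + 1) (by lia) hk
  have hle := Int.le_of_dvd one_pos hdvd
  lia

lemma expo_succ_lt {k : ℕ} (hk1 : 1 ≤ k) (hk : k ≤ D.l) : D.expo (k + 1) < D.expo k := by
  rcases hk.eq_or_lt with rfl | hlt
  · rw [expo_last]
    exact D.r_lt _ (Finsupp.mem_support_iff.2 (D.φ_expo_ne_zero hk1 hk))
  · obtain ⟨m, rfl⟩ := Nat.exists_eq_add_of_le' hk1
    have hnot := D.expo_notMem_fracGroup hlt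
    rcases lt_trichotomy (D.expo (m + 1 + 1)) (D.expo (m + 1)) with h | h | h
    · exact h
    · exact absurd (h ▸ D.expo_mem_fracGroup) hnot
    · exact absurd (D.fracGroup_P_le (Nat.le_succ m) (by lia)
        (D.mem_fracGroup_of_expo_lt (by lia) (D.φ_expo_ne_zero (by lia) hlt) h)) hnot

lemma expo_lt {k k' : ℕ} (hk1 : 1 ≤ k) (h : k < k') (hk' : k' ≤ D.l + 1) :
    D.expo k' < D.expo k := by
  induction k', h using Nat.le_induction with
  | base => exact D.expo_succ_lt hk1 (by lia)
  | succ m h ih => exact (D.expo_succ_lt (by lia) (by lia)).trans (ih (by lia))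

/-! ### Substitution of the generic series -/

/-- The part `φ_k` of `φ` of degree larger than `q k / (p 1 ⋯ p k)`. -/
def above (k : ℕ) : AddMonoidAlgebra ℂ ℚ :=
  AddMonoidAlgebra.ofCoeff (D.φ.filter fun e => D.expo k < e)

lemma coeff_above (k : ℕ) (e : ℚ) :
    (D.above k).coeff e = if D.expo k < e then D.φ e else 0 :=
  Finsupp.filter_apply ..

lemma above_last : D.above (D.l + 1) = AddMonoidAlgebra.ofCoeff D.φ := by
  rw [above, (Finsupp.filter_eq_self_iff _ _).2 fun e he => ?_]
  rw [expo_last]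
  exact D.r_lt e (Finsupp.mem_support_iff.2 he)

lemma series_eq (k : ℕ) :
    D.series k = constXi (D.above k) + AddMonoidAlgebra.single (D.expo k) X := by
  rw [series]
  congr 1

@[simp] lemma subst_C (k : ℕ) (a : LaurentPolynomial ℂ) :
    D.subst k (C a) = laurentToPuiseux a :=
  eval₂_C ..

@[simp] lemma subst_X (k : ℕ) : D.subst k X = D.series k :=
  eval₂_X ..

lemma subst_smul (k : ℕ) (c : ℂ) (f : LaurentXY) :
    D.subst k (c • f) = AddMonoidAlgebra.single 0 (C c) * D.subst k f := by
  rw [Algebra.smul_def, map_mul, Polynomial.algebraMap_apply, subst_C]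
  congr 1
  rw [LaurentPolynomial.algebraMap_apply, ← LaurentPolynomial.single_eq_C, laurentToPuiseux_eq,
    laurentIncl_single, constXi_single, Int.cast_zero, Algebra.algebraMap_self, RingHom.id_apply]

lemma hasTop_smul {k : ℕ} {f : LaurentXY} {v : ℚ} {c : ℂ[X]} (a : ℂ)
    (h : HasTop (D.subst k f) v c) : HasTop (D.subst k (a • f)) v (C a * c) := by
  rw [subst_smul]
  simpa only [zero_add] using (HasTop.single 0 (C a)).mul h

lemma hasTop_subst_T (k : ℕ) (a : ℤ) :
    HasTop (D.subst k (C (LaurentPolynomial.T a))) a 1 := by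
  rw [subst_C, laurentToPuiseux_T]
  exact HasTop.single _ _

lemma semidegree_eq_of_hasTop {k : ℕ} {f : LaurentXY} {v : ℚ} {c : ℂ[X]}
    (h : HasTop (D.subst k f) v c) (hc : c ≠ 0) :
    D.semidegree k f = ((D.P k * v : ℚ) : WithBot ℚ) := by
  rw [semidegree, h.degX_eq hc, WithBot.map_coe]

lemma hasTop_of_semidegree_eq {k : ℕ} (hk : k ≤ D.l + 1) {f : LaurentXY} {w : ℚ}
    (h : D.semidegree k f = (w : WithBot ℚ)) :
    ∃ c, c ≠ 0 ∧ HasTop (D.subst k f) (w / D.P k) c := by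
  by_cases hzero : D.subst k f = 0
  · simp [semidegree, degX, hzero] at h
  · obtain ⟨v, c, hc, hv⟩ := HasTop.exists_ne_zero hzero
    rw [D.semidegree_eq_of_hasTop hv hc, WithBot.coe_inj] at h
    refine ⟨c, hc, ?_⟩
    rwa [← h, mul_div_cancel_left₀ _ (D.P_pos_rat hk).ne']

lemma subst_mem_gradedSubring {k : ℕ} (hk : k ≤ D.l) (f : LaurentXY) :
    D.subst (k + 1) f ∈ gradedSubring (D.expo (k + 1)) (fracGroup (D.P k)) := by
  have hlaurent : ∀ a : LaurentPolynomial ℂ,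
      laurentToPuiseux a ∈ gradedSubring (D.expo (k + 1)) (fracGroup (D.P k)) := by
    intro a
    rw [laurentToPuiseux_eq]
    refine constXi_mem_gradedSubring fun E hE => ?_
    obtain ⟨b, -, rfl⟩ := Finset.mem_image.1
      (Finsupp.mapDomain_support (Finsupp.mem_support_iff.2 hE))
    exact D.intCast_mem_fracGroup_P (by lia) b
  have hseries : D.series (k + 1) ∈ gradedSubring (D.expo (k + 1)) (fracGroup (D.P k)) := by
    rw [series_eq]
    refine add_mem (constXi_mem_gradedSubring fun E hE => ?_) (single_X_mem_gradedSubring _ _)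
    rw [coeff_above, ite_ne_right_iff] at hE
    exact D.mem_fracGroup_of_expo_lt hk hE.2 hE.1
  induction f using Polynomial.induction_on' with
  | add p q hp hq =>
    rw [map_add]
    exact add_mem hp hq
  | monomial n a =>
    rw [← C_mul_X_pow_eq_monomial, map_mul, map_pow, subst_C, subst_X]
    exact mul_mem (hlaurent a) (pow_mem hseries n)

/-- The value of `ξ` that turns the `k`-th generic series into the `k'`-th one. -/
def tail (k k' : ℕ) : PuiseuxXi :=
  (D.series k' - constXi (D.above k)) * AddMonoidAlgebra.single (-D.expo k) 1

lemma hasTop_tail {k k' : ℕ} (hk1 : 1 ≤ k) (h : k < k') (hk' : k' ≤ D.l + 1) :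
    HasTop (D.tail k k') 0 (C (D.φ (D.expo k))) := by
  have hlt := D.expo_lt hk1 h hk'
  have hdiff : HasTop (D.series k' - constXi (D.above k)) (D.expo k) (C (D.φ (D.expo k))) := by
    rw [series_eq]
    refine ⟨fun e he => ?_, ?_⟩
    · simp [coeff_constXi, coeff_above, he, hlt.trans he, (hlt.trans he).ne]
    · simp [coeff_constXi, coeff_above, hlt, hlt.ne]
  simpa only [tail, add_neg_cancel, mul_one] using hdiff.mul (HasTop.single (-D.expo k) 1)

lemma specialize_series (k k' : ℕ) : specialize (D.tail k k') (D.series k) = D.series k' := by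
  rw [series_eq, map_add, specialize_constXi, specialize_single, aeval_X, tail, mul_assoc,
    AddMonoidAlgebra.single_mul_single, neg_add_cancel, mul_one, ← AddMonoidAlgebra.one_def,
    mul_one, add_sub_cancel]

lemma specialize_subst (k k' : ℕ) (f : LaurentXY) :
    specialize (D.tail k k') (D.subst k f) = D.subst k' f := by
  suffices h : (specialize (D.tail k k')).comp (D.subst k) = D.subst k' from
    RingHom.congr_fun h f
  refine Polynomial.ringHom_ext (fun a => ?_) ?_
  · simp only [RingHom.comp_apply, subst_C, laurentToPuiseux_eq, specialize_constXi]
  · simp only [RingHom.comp_apply, subst_X, specialize_series]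

lemma hasTop_subst_of_lt {k k' : ℕ} (hk1 : 1 ≤ k) (h : k < k') (hk' : k' ≤ D.l + 1)
    {f : LaurentXY} {v : ℚ} {c : ℂ[X]} (hf : HasTop (D.subst k f) v c) :
    HasTop (D.subst k' f) v (C (c.eval (D.φ (D.expo k)))) := by
  rw [← D.specialize_subst k k' f]
  exact (D.hasTop_tail hk1 h hk').specialize hf

lemma derivXi_series (k : ℕ) :
    derivXi (D.series k) = AddMonoidAlgebra.single (D.expo k) 1 := by
  rw [series_eq, map_add, derivXi_constXi, derivXi_single, derivative_X, zero_add]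

lemma derivXi_subst (k : ℕ) (f : LaurentXY) :
    derivXi (D.subst k f) =
      D.subst k (derivative f) * AddMonoidAlgebra.single (D.expo k) 1 := by
  induction f using Polynomial.induction_on with
  | C a => rw [subst_C, laurentToPuiseux_eq, derivXi_constXi, derivative_C, map_zero, zero_mul]
  | add p q hp hq => rw [map_add, map_add, hp, hq, derivative_add, map_add, add_mul]
  | monomial n a ih =>
    rw [pow_succ, ← mul_assoc, map_mul, derivXi_mul, ih, derivative_mul (f := C a * X ^ n),
      subst_X, derivXi_series, map_add, map_mul _ (derivative (C a * X ^ n)) X, subst_X,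
      derivative_X, mul_one]
    ring

lemma natDegree_eq_one_of_hasTop_derivative {k : ℕ} {f : LaurentXY} {v v' : ℚ} {c : ℂ[X]}
    {b : ℂ} (h : HasTop (D.subst k f) v c) (hc : c.natDegree ≠ 0)
    (h' : HasTop (D.subst k (derivative f)) v' (C b)) (hb : b ≠ 0) : c.natDegree = 1 := by
  have hmul := h'.mul (HasTop.single (D.expo k) 1)
  rw [← derivXi_subst, mul_one] at hmul
  have hconst : derivative c = C b :=
    (h.derivXi.unique hmul (fun hzero => hc (derivative_eq_zero.1 hzero)) (C_ne_zero.2 hb)).2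
  have hdeg := congrArg natDegree hconst
  rw [natDegree_derivative, natDegree_C] at hdeg
  lia

end GenericPuiseux

lemma isIntegralElem_ofCoeff {N : ℕ} (hN : N ≠ 0) {φ : ℚ →₀ ℂ} (hφ : ExponentsIn N φ) :
    laurentIncl.IsIntegralElem (AddMonoidAlgebra.ofCoeff φ) := by
  let := laurentIncl.toAlgebra
  rw [← AddMonoidAlgebra.sum_coeff_single (AddMonoidAlgebra.ofCoeff φ)]
  refine IsIntegral.sum (R := LaurentPolynomial ℂ) (A := AddMonoidAlgebra ℂ ℚ) _ fun e he => ?_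
  obtain ⟨a, rfl⟩ := hφ e he
  refine IsIntegral.of_pow (R := LaurentPolynomial ℂ) (n := N) hN.bot_lt ?_
  rw [AddMonoidAlgebra.single_pow, nsmul_eq_mul, mul_div_cancel₀ _ (Nat.cast_ne_zero.2 hN),
    ← laurentIncl_single]
  exact laurentIncl.isIntegralElem_map

namespace GenericPuiseux

variable (D : GenericPuiseux)

lemma atZero_subst_last (h : LaurentXY) :
    atZero (D.subst (D.l + 1) h) = h.eval₂ laurentIncl (AddMonoidAlgebra.ofCoeff D.φ) := by
  suffices heq : atZero.comp (D.subst (D.l + 1)) =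
      eval₂RingHom laurentIncl (AddMonoidAlgebra.ofCoeff D.φ) from RingHom.congr_fun heq h
  refine Polynomial.ringHom_ext (fun a => ?_) ?_
  · simp only [RingHom.comp_apply, subst_C, laurentToPuiseux_eq, atZero_constXi,
      coe_eval₂RingHom, eval₂_C]
  · rw [RingHom.comp_apply, subst_X, series_eq, map_add, atZero_constXi, above_last, atZero,
      AddMonoidAlgebra.mapRingHom_single, constantCoeff_apply, coeff_X_zero,
      AddMonoidAlgebra.single_zero, add_zero, coe_eval₂RingHom, eval₂_X]

lemma exists_monic_atZero_subst_eq_zero :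
    ∃ h : LaurentXY, h.Monic ∧ atZero (D.subst (D.l + 1) h) = 0 := by
  obtain ⟨hN, hexp⟩ := D.polydromy.1
  obtain ⟨h, hmonic, hroot⟩ := isIntegralElem_ofCoeff hN.ne' hexp
  exact ⟨h, hmonic, (D.atZero_subst_last h).trans hroot⟩

end GenericPuiseux

/-! ### Mixed radix expansions -/

/-- The place values `a 1 ⋯ a (j - 1)` of the mixed radix system with digits below `a 1, a 2, …`. -/
def radix (a : ℕ → ℕ) (j : ℕ) : ℕ := ∏ i ∈ Finset.Ico 1 j, a i

lemma radix_one (a : ℕ → ℕ) : radix a 1 = 1 := rfl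

lemma radix_succ (a : ℕ → ℕ) {j : ℕ} (hj : 1 ≤ j) : radix a (j + 1) = radix a j * a j :=
  Finset.prod_Ico_succ_top hj _

lemma sum_mul_radix_lt {a b : ℕ → ℕ} {j : ℕ} (h : ∀ i, 1 ≤ i → i < j → b i < a i) :
    ∑ i ∈ Finset.Ico 1 j, b i * radix a i < radix a j := by
  induction j with
  | zero => simp [radix]
  | succ j ih =>
    rcases Nat.eq_zero_or_pos j with rfl | hj
    · simp [radix]
    · rw [Finset.sum_Ico_succ_top hj, radix_succ a hj]
      have hlower := ih fun i hi hij => h i hi (by lia)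
      have hdigit := h j hj (by lia)
      nlinarith

lemma sum_mul_radix_injective {a b b' : ℕ → ℕ} {j : ℕ} (h : ∀ i, 1 ≤ i → i < j → b i < a i)
    (h' : ∀ i, 1 ≤ i → i < j → b' i < a i)
    (heq : ∑ i ∈ Finset.Ico 1 j, b i * radix a i = ∑ i ∈ Finset.Ico 1 j, b' i * radix a i) :
    ∀ i, 1 ≤ i → i < j → b i = b' i := by
  induction j with
  | zero => exact fun i _ hi => absurd hi (Nat.not_lt_zero i)
  | succ j ih =>
    rcases Nat.eq_zero_or_pos j with rfl | hj
    · exact fun i hi hi1 => by lia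
    have hlower := sum_mul_radix_lt (j := j) fun i hi hij => h i hi (by lia)
    have hlower' := sum_mul_radix_lt (j := j) fun i hi hij => h' i hi (by lia)
    rw [Finset.sum_Ico_succ_top hj, Finset.sum_Ico_succ_top hj] at heq
    have hlead : b j = b' j := by
      have hdiv := congrArg (· / radix a j) heq
      have hpos := (Nat.zero_le _).trans_lt hlower
      simpa only [Nat.add_mul_div_right _ _ hpos, Nat.div_eq_of_lt hlower,
        Nat.div_eq_of_lt hlower', zero_add] using hdiv
    rw [hlead] at heq
    intro i hi hij
    rcases (Nat.le_of_lt_succ hij).lt_or_eq with hlt | rfl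
    · exact ih (fun i hi hij => h i hi (by lia)) (fun i hi hij => h' i hi (by lia))
        (Nat.add_right_cancel heq) i hi hlt
    · exact hlead

/-! ### Constant top coefficients -/

lemma HasTop.laurentToPuiseux {a : LaurentPolynomial ℂ} {d : ℤ} {b : ℂ} (h : HasTop a d b) :
    HasTop (laurentToPuiseux a) d (C b) := by
  have hinj : Function.Injective (Int.castAddHom ℚ) := Int.cast_injective
  have hcoeff : ∀ n : ℤ, (laurentIncl a).coeff n = a.coeff n :=
    Finsupp.mapDomain_apply hinj a.coeff
  rw [laurentToPuiseux_eq]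
  refine ⟨fun e he => ?_, by rw [coeff_constXi, hcoeff, h.2]⟩
  rw [coeff_constXi, C_eq_zero]
  by_cases hint : e ∈ Set.range (Int.castAddHom ℚ)
  · obtain ⟨n, rfl⟩ := hint
    exact (hcoeff n).trans (h.1 n (Int.cast_lt.1 he))
  · exact Finsupp.mapDomain_of_notMem_range _ _ hint

namespace GenericPuiseux

variable (D : GenericPuiseux)

/-- After substitution of the `k`-th generic series, the top term of `f` has exponent `v`, and its
coefficient is nonzero and does not involve `ξ`. -/
def ConstTop (k : ℕ) (f : LaurentXY) (v : ℚ) : Prop :=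
  ∃ a : ℂ, a ≠ 0 ∧ HasTop (D.subst k f) v (C a)

variable {D} {k : ℕ} {f f' : LaurentXY} {v v' : ℚ}

namespace ConstTop

lemma mul (h : D.ConstTop k f v) (h' : D.ConstTop k f' v') : D.ConstTop k (f * f') (v + v') := by
  obtain ⟨a, ha, h⟩ := h
  obtain ⟨a', ha', h'⟩ := h'
  exact ⟨a * a', mul_ne_zero ha ha', by simpa only [map_mul] using h.mul h'⟩

lemma pow (h : D.ConstTop k f v) (n : ℕ) : D.ConstTop k (f ^ n) (n * v) := by
  obtain ⟨a, ha, h⟩ := h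
  exact ⟨a ^ n, pow_ne_zero n ha, by simpa only [map_pow, nsmul_eq_mul] using h.pow n⟩

lemma prod {ι : Type*} (s : Finset ι) {f : ι → LaurentXY} {v : ι → ℚ}
    (h : ∀ i ∈ s, D.ConstTop k (f i) (v i)) : D.ConstTop k (∏ i ∈ s, f i) (∑ i ∈ s, v i) := by
  choose! a ha htop using h
  exact ⟨∏ i ∈ s, a i, Finset.prod_ne_zero_iff.2 ha, by
    simpa only [map_prod] using HasTop.prod s htop⟩

lemma smul (h : D.ConstTop k f v) {b : ℂ} (hb : b ≠ 0) : D.ConstTop k (b • f) v := by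
  obtain ⟨a, ha, h⟩ := h
  exact ⟨b * a, mul_ne_zero hb ha, by simpa only [C_mul] using D.hasTop_smul b h⟩

lemma add_of_lt (h : D.ConstTop k f v) (h' : D.ConstTop k f' v') (hv : v' < v) :
    D.ConstTop k (f + f') v := by
  obtain ⟨a, ha, h⟩ := h
  obtain ⟨a', -, h'⟩ := h'
  exact ⟨a, ha, by simpa only [map_add, add_zero] using h.add (h'.of_lt hv)⟩

lemma exists_hasTop_of_le (h : D.ConstTop k f v) (hv : v ≤ v') :
    ∃ b : ℂ, HasTop (D.subst k f) v' (C b) := by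
  obtain ⟨a, -, h⟩ := h
  rcases hv.eq_or_lt with rfl | hlt
  · exact ⟨a, h⟩
  · exact ⟨0, by simpa only [C_0] using h.of_lt hlt⟩

lemma unique (h : D.ConstTop k f v) {c : ℂ[X]} (h' : HasTop (D.subst k f) v' c) (hc : c ≠ 0) :
    v = v' := by
  obtain ⟨a, ha, h⟩ := h
  exact (h.unique h' (C_ne_zero.2 ha) hc).1

lemma of_le (h : D.ConstTop k f v) {k' : ℕ} (hk : 1 ≤ k) (hkk' : k ≤ k') (hk' : k' ≤ D.l + 1) :
    D.ConstTop k' f v := by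
  rcases hkk'.lt_or_eq with hlt | rfl
  · obtain ⟨a, ha, h⟩ := h
    exact ⟨a, ha, by simpa only [eval_C] using D.hasTop_subst_of_lt hk hlt hk' h⟩
  · exact h

lemma mem_fracGroup (h : D.ConstTop (k + 1) f v) (hk : k ≤ D.l) : v ∈ fracGroup (D.P k) := by
  obtain ⟨a, ha, h⟩ := h
  have hmem := D.subst_mem_gradedSubring hk f v 0 (by rwa [h.2, coeff_C_zero])
  rwa [Nat.cast_zero, zero_mul, sub_zero] at hmem

end ConstTop

lemma constTop_T (k : ℕ) (a : ℤ) : D.ConstTop k (C (LaurentPolynomial.T a)) a :=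
  ⟨1, one_ne_zero, D.hasTop_subst_T k a⟩

lemma constTop_C {a : LaurentPolynomial ℂ} {d : ℤ} {b : ℂ} (h : HasTop a d b) (hb : b ≠ 0) :
    D.ConstTop k (C a) d :=
  ⟨b, hb, by simpa only [subst_C] using h.laurentToPuiseux⟩

end GenericPuiseux

/-! ### Top terms of the key forms -/

namespace KeyForms

variable {D : GenericPuiseux} (K : KeyForms D.fullSemidegree)

/-- The degree in `x` of the key form `g j` after substitution of the generic series. -/
def u (j : ℕ) : ℚ := K.ω j / D.P (D.l + 1)

/-- The monomial in the key forms that is subtracted at step `j`. -/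
def stepTerm (j : ℕ) : LaurentXY :=
  K.θ j • (C (LaurentPolynomial.T (K.β₀ j)) * ∏ i ∈ Finset.Ico 1 j, K.g i ^ K.β j i)

lemma g_succ_eq {j : ℕ} (hj : 1 ≤ j) (hjn : j ≤ K.n) :
    K.g (j + 1) = K.g j ^ K.α j - K.stepTerm j := K.g_succ j hj hjn

lemma exists_hasTop {j : ℕ} (hj : j ≤ K.n + 1) :
    ∃ c, c ≠ 0 ∧ HasTop (D.subst (D.l + 1) (K.g j)) (K.u j) c :=
  D.hasTop_of_semidegree_eq le_rfl (K.ω_eq j hj)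

lemma constTop_zero (k : ℕ) : D.ConstTop k (K.g 0) 1 := by
  rw [K.g_zero]
  exact_mod_cast GenericPuiseux.constTop_T (D := D) k 1

lemma u_zero : K.u 0 = 1 := by
  obtain ⟨c, hc, h⟩ := K.exists_hasTop (Nat.zero_le _)
  exact ((K.constTop_zero (D.l + 1)).unique h hc).symm

lemma ω_eq_mul_u (j : ℕ) : K.ω j = D.P (D.l + 1) * K.u j := by
  rw [u, mul_div_cancel₀ _ (D.P_pos_rat le_rfl).ne']

lemma u_rel {j : ℕ} (hj : 1 ≤ j) (hjn : j ≤ K.n) :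
    (K.α j : ℚ) * K.u j = K.β₀ j + ∑ i ∈ Finset.Ico 1 j, (K.β j i : ℚ) * K.u i := by
  apply mul_left_cancel₀ (D.P_pos_rat (le_refl (D.l + 1))).ne'
  calc (D.P (D.l + 1) : ℚ) * (K.α j * K.u j) = K.α j * K.ω j := by rw [ω_eq_mul_u]; ring
    _ = K.β₀ j * K.ω 0 + ∑ i ∈ Finset.Ico 1 j, (K.β j i : ℚ) * K.ω i := K.ω_rel j hj hjn
    _ = _ := by
      simp only [ω_eq_mul_u, u_zero, mul_left_comm _ (D.P (D.l + 1) : ℚ), ← Finset.mul_sum]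
      ring

lemma u_lt {j : ℕ} (hj : 1 ≤ j) (hjn : j ≤ K.n) : K.u (j + 1) < K.α j * K.u j := by
  have h := K.ω_lt j hj hjn
  rw [ω_eq_mul_u, ω_eq_mul_u, mul_left_comm] at h
  exact lt_of_mul_lt_mul_left h (D.P_pos_rat le_rfl).le

/-- The group generated by the degrees of `g 0, …, g (j - 1)`. -/
def valueGroup (j : ℕ) : AddSubgroup ℚ := AddSubgroup.closure (K.u '' Set.Iio j)

lemma u_mem_valueGroup {i j : ℕ} (h : i < j) : K.u i ∈ K.valueGroup j :=
  AddSubgroup.subset_closure ⟨i, h, rfl⟩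

lemma intCast_mem_valueGroup_one (a : ℤ) : (a : ℚ) ∈ K.valueGroup 1 := by
  simpa [u_zero] using zsmul_mem (K.u_mem_valueGroup zero_lt_one) a

lemma valueGroup_mono : Monotone K.valueGroup := fun _ _ h =>
  AddSubgroup.closure_mono (Set.image_mono (Set.Iio_subset_Iio h))

lemma mul_ω_mem_closure_iff (a : ℚ) (i j : ℕ) :
    a * K.ω i ∈ AddSubgroup.closure (K.ω '' Set.Iio j) ↔ a * K.u i ∈ K.valueGroup j := by
  have hmap : AddSubgroup.closure (K.ω '' Set.Iio j) =
      (K.valueGroup j).map (AddMonoidHom.mulLeft (D.P (D.l + 1) : ℚ)) := by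
    rw [valueGroup, AddMonoidHom.map_closure, Set.image_image]
    exact congrArg _ (Set.image_congr fun i _ => K.ω_eq_mul_u i)
  have hinj : Function.Injective (AddMonoidHom.mulLeft (D.P (D.l + 1) : ℚ)) :=
    mul_right_injective₀ (D.P_pos_rat le_rfl).ne'
  rw [hmap, ω_eq_mul_u, mul_left_comm]
  exact AddSubgroup.mem_map_iff_mem hinj

lemma α_isLeast {j : ℕ} (hj : 1 ≤ j) (hjn : j ≤ K.n) :
    IsLeast {a : ℕ | 0 < a ∧ (a : ℚ) * K.u j ∈ K.valueGroup j} (K.α j) := by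
  have h := K.α_min j hj hjn
  simp only [mul_ω_mem_closure_iff] at h
  exact h

lemma α_pos {j : ℕ} (hj : 1 ≤ j) (hjn : j ≤ K.n) : 0 < K.α j := (K.α_isLeast hj hjn).1.1

lemma constTop_stepTerm {k j : ℕ} (hj : 1 ≤ j) (hjn : j ≤ K.n)
    (h : ∀ i, i < j → D.ConstTop k (K.g i) (K.u i)) :
    D.ConstTop k (K.stepTerm j) (K.α j * K.u j) := by
  rw [K.u_rel hj hjn]
  refine ((GenericPuiseux.constTop_T k _).mul (GenericPuiseux.ConstTop.prod _ fun i hi => ?_)).smul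
    (K.θ_ne j hj hjn)
  exact (h i (Finset.mem_Ico.1 hi).2).pow _

/-- The top terms of `g j ^ α j` and of the monomial subtracted from it cancel, and the latter is
constant by induction. -/
lemma constTop_of_le {j : ℕ} (hjn : j ≤ K.n) : D.ConstTop (D.l + 1) (K.g j) (K.u j) := by
  induction j using Nat.strong_induction_on with
  | _ j ih =>
    rcases Nat.eq_zero_or_pos j with rfl | hj
    · rw [u_zero]
      exact K.constTop_zero _
    obtain ⟨c, hc, htop⟩ := K.exists_hasTop (j := j) (by lia)
    obtain ⟨_, -, hsucc⟩ := K.exists_hasTop (j := j + 1) (by lia)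
    obtain ⟨b, -, hstep⟩ := K.constTop_stepTerm hj hjn fun i hi => ih i hi (by lia)
    have hsub := (htop.pow (K.α j)).sub (nsmul_eq_mul (K.α j) (K.u j) ▸ hstep)
    rw [← map_pow, ← map_sub, ← K.g_succ_eq hj hjn, nsmul_eq_mul] at hsub
    have hcancel : c ^ K.α j = C b := by
      rw [← sub_eq_zero, ← hsub.2, (hsucc.of_lt (K.u_lt hj hjn)).2]
    have hdeg := congrArg natDegree hcancel
    rw [natDegree_pow, natDegree_C] at hdeg
    obtain ⟨a, rfl⟩ := natDegree_eq_zero.1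
      ((Nat.mul_eq_zero.1 hdeg).resolve_left (K.α_pos hj hjn).ne')
    exact ⟨a, C_ne_zero.1 hc, htop⟩

end KeyForms

section WeightedDegB

variable {N : ℕ} {w : ℕ → ℚ} {G : MvPolynomial (Fin N) (LaurentPolynomial ℂ)}

lemma le_weightedDegB {m : Fin N →₀ ℕ} {a : ℤ} (ha : (MvPolynomial.coeff m G).coeff a ≠ 0) :
    (((a : ℚ) * w 0 + ∑ i, (m i : ℚ) * w (i.val + 1) : ℚ) : WithBot ℚ) ≤ weightedDegB w G := by
  have hm : m ∈ G.support := by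
    rw [MvPolynomial.mem_support_iff]
    rintro hzero
    exact ha (by rw [hzero]; rfl)
  refine le_trans ?_ (Finset.le_sup hm)
  exact Finset.le_sup (f := fun a : ℤ =>
    (((a : ℚ) * w 0 + ∑ i, (m i : ℚ) * w (i.val + 1) : ℚ) : WithBot ℚ))
    (Finsupp.mem_support_iff.2 ha)

lemma weightedDegB_ne_bot (hG : G ≠ 0) : weightedDegB w G ≠ ⊥ := by
  obtain ⟨m, hm⟩ := MvPolynomial.ne_zero_iff.1 hG
  obtain ⟨a, ha⟩ := Finsupp.ne_iff.1 (AddMonoidAlgebra.coeff_eq_zero.not.2 hm)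
  exact ((WithBot.bot_lt_coe _).trans_le (le_weightedDegB ha)).ne'

end WeightedDegB

namespace KeyForms

variable {D : GenericPuiseux} (K : KeyForms D.fullSemidegree)

lemma exists_hasTop_subst_monomial
    (hall : ∀ j ≤ K.n + 1, D.ConstTop (D.l + 1) (K.g j) (K.u j)) {w : ℚ}
    {m : Fin (K.n + 1) →₀ ℕ} {a : LaurentPolynomial ℂ}
    (hw : ∀ e, a.coeff e ≠ 0 → (e : ℚ) * K.ω 0 + ∑ i, (m i : ℚ) * K.ω (i.val + 1) ≤ w) :
    ∃ b : ℂ, HasTop (D.subst (D.l + 1) (C a * ∏ i ∈ m.support, K.g (i.val + 1) ^ m i))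
      (w / D.P (D.l + 1)) (C b) := by
  by_cases ha : a = 0
  · refine ⟨0, ?_⟩
    rw [ha, C_0, zero_mul, map_zero, C_0]
    exact ⟨fun _ _ => rfl, rfl⟩
  obtain ⟨d, b, hb, htop⟩ := HasTop.exists_ne_zero ha
  refine ((GenericPuiseux.constTop_C htop hb).mul
    (GenericPuiseux.ConstTop.prod _ fun i _ => (hall _ i.2).pow _)).exists_hasTop_of_le ?_
  have hd := hw d (by rwa [htop.2])
  simp only [ω_eq_mul_u, u_zero] at hd
  rw [le_div_iff₀ (D.P_pos_rat le_rfl)]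
  refine le_trans (le_of_eq ?_) hd
  rw [Finset.sum_subset (Finset.subset_univ m.support) fun i _ hi => by
    rw [Finsupp.notMem_support_iff.1 hi, Nat.cast_zero, zero_mul], add_mul, Finset.sum_mul, mul_one]
  exact congrArg _ (Finset.sum_congr rfl fun i _ => by ring)

lemma exists_hasTop_subst_aeval
    (hall : ∀ j ≤ K.n + 1, D.ConstTop (D.l + 1) (K.g j) (K.u j)) {w : ℚ}
    {G : MvPolynomial (Fin (K.n + 1)) (LaurentPolynomial ℂ)}
    (hG : weightedDegB K.ω G ≤ (w : WithBot ℚ)) :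
    ∃ b : ℂ, HasTop (D.subst (D.l + 1) (MvPolynomial.aeval
      (fun i : Fin (K.n + 1) => K.g (i.val + 1)) G)) (w / D.P (D.l + 1)) (C b) := by
  have hterm := fun m : Fin (K.n + 1) →₀ ℕ => K.exists_hasTop_subst_monomial hall
    (m := m) (a := MvPolynomial.coeff m G)
    fun e he => WithBot.coe_le_coe.1 ((le_weightedDegB he).trans hG)
  choose b hb using hterm
  refine ⟨∑ m ∈ G.support, b m, ?_⟩
  rw [MvPolynomial.aeval_def, MvPolynomial.eval₂_eq, map_sum, map_sum]
  exact HasTop.sum _ fun m _ => hb m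

/-- Otherwise no element of `ℂ[x, x⁻¹, y]` would have top coefficient divisible by `ξ`. -/
lemma not_constTop_last : ¬ D.ConstTop (D.l + 1) (K.g (K.n + 1)) (K.u (K.n + 1)) := by
  intro hlast
  have hall : ∀ j ≤ K.n + 1, D.ConstTop (D.l + 1) (K.g j) (K.u j) := fun j hj => by
    rcases Nat.le_succ_iff.1 hj with h | rfl
    · exact K.constTop_of_le h
    · exact hlast
  obtain ⟨h, hmonic, hvanish⟩ := D.exists_monic_atZero_subst_eq_zero
  obtain ⟨G, rfl, hδ⟩ := (K.generating h hmonic.ne_zero).1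
  have hG : G ≠ 0 := by
    rintro rfl
    exact hmonic.ne_zero (map_zero _)
  obtain ⟨w, hw⟩ := WithBot.ne_bot_iff_exists.1 (weightedDegB_ne_bot (w := K.ω) hG)
  obtain ⟨c, hc, htop⟩ := D.hasTop_of_semidegree_eq le_rfl (hδ.symm.trans hw.symm)
  obtain ⟨b, hb⟩ := K.exists_hasTop_subst_aeval hall hw.ge
  have hcoeff := coeff_atZero _ (w / D.P (D.l + 1)) ▸
    congrArg (fun H => AddMonoidAlgebra.coeff H (w / D.P (D.l + 1))) hvanish
  rw [hb.2, coeff_C_zero] at hcoeff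
  apply hc
  rw [← htop.2, hb.2, hcoeff]
  exact C_0

/-! ### The degrees in `y` of the key forms -/

lemma radix_α_pos {j : ℕ} (hj : j ≤ K.n + 1) : 0 < radix K.α j :=
  Finset.prod_pos fun i hi => K.α_pos (Finset.mem_Ico.1 hi).1 (by
    have := (Finset.mem_Ico.1 hi).2
    lia)

lemma g_monic_natDegree {j : ℕ} (hj : 1 ≤ j) (hjn : j ≤ K.n + 1) :
    (K.g j).Monic ∧ (K.g j).natDegree = radix K.α j := by
  induction j using Nat.strong_induction_on with
  | _ j ih =>
    rcases hj.eq_or_lt with rfl | hlt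
    · rw [K.g_one]
      exact ⟨monic_X, natDegree_X⟩
    obtain ⟨j, rfl⟩ : ∃ i, j = i + 1 := Nat.exists_eq_add_of_le' hlt.le
    obtain ⟨hmon, hdeg⟩ := ih j (by lia) (by lia) (by lia)
    have hdegpow : (K.g j ^ K.α j).natDegree = radix K.α (j + 1) := by
      rw [hmon.natDegree_pow, hdeg, radix_succ _ (by lia), mul_comm]
    have hstep : (K.stepTerm j).natDegree < radix K.α j := by
      refine lt_of_le_of_lt ?_ (sum_mul_radix_lt (a := K.α) (b := K.β j)
        fun i hi hij => K.β_lt j i hi hij (by lia))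
      refine (natDegree_smul_le _ _).trans ((natDegree_C_mul_le _ _).trans ?_)
      refine (natDegree_prod_le _ _).trans (Finset.sum_le_sum fun i hi => ?_)
      rw [Finset.mem_Ico] at hi
      rw [← (ih i (by lia) hi.1 (by lia)).2]
      exact natDegree_pow_le
    have hlt : (K.stepTerm j).degree < (K.g j ^ K.α j).degree := by
      refine degree_lt_degree (hstep.trans_le ?_)
      rw [hdegpow, radix_succ _ (by lia)]
      exact Nat.le_mul_of_pos_right _ (K.α_pos (by lia) (by lia))
    rw [K.g_succ_eq (by lia) (by lia)]
    exact ⟨(hmon.pow _).sub_of_left hlt, by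
      rw [natDegree_eq_of_degree_eq (degree_sub_eq_left_of_degree_lt hlt), hdegpow]⟩

section NatDegreeLt

variable {K} {k J : ℕ} {h : LaurentXY}

lemma mul_u_notMem_valueGroup (hJ : 1 ≤ J) (hJn : J ≤ K.n) {i : ℕ} (hi : 0 < i)
    (hiα : i < K.α J) : (i : ℚ) * K.u J ∉ K.valueGroup J := fun hmem =>
  ((K.α_isLeast hJ hJn).2 ⟨hi, hmem⟩).not_gt hiα

/-- Both summands of `h = r + g J * q` have constant top terms, of different exponents. -/
lemma exists_constTop_add_mul (hJ : 1 ≤ J) (hJn : J ≤ K.n)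
    (hconst : D.ConstTop k (K.g J) (K.u J)) {r q : LaurentXY}
    (hr : r ≠ 0 → ∃ v ∈ K.valueGroup J, D.ConstTop k r v) {m : ℕ} (hm : m < K.α J)
    (hq : ∃ i < m, ∃ v ∈ K.valueGroup J, D.ConstTop k q (v + i * K.u J)) :
    ∃ i < m + 1, ∃ v ∈ K.valueGroup J, D.ConstTop k (r + K.g J * q) (v + i * K.u J) := by
  obtain ⟨i, hi, v, hv, hq⟩ := hq
  have hgq : D.ConstTop k (K.g J * q) (v + (i + 1 : ℕ) * K.u J) := by
    convert hconst.mul hq using 1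
    push_cast
    ring
  by_cases hr0 : r = 0
  · exact ⟨i + 1, by lia, v, hv, by rwa [hr0, zero_add]⟩
  obtain ⟨v', hv', hr⟩ := hr hr0
  rcases lt_trichotomy v' (v + (i + 1 : ℕ) * K.u J) with hlt | heq | hlt
  · exact ⟨i + 1, by lia, v, hv, add_comm r _ ▸ hgq.add_of_lt hr hlt⟩
  · refine absurd ?_ (mul_u_notMem_valueGroup hJ hJn (Nat.succ_pos i) (by lia))
    have hsub := (K.valueGroup J).sub_mem hv' hv
    rwa [heq, add_sub_cancel_left] at hsub
  · exact ⟨0, by lia, v', hv', by simpa using hr.add_of_lt hgq hlt⟩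

/-- Repeated division by `g J`. -/
lemma exists_constTop_of_natDegree_lt_mul (hJ : 1 ≤ J) (hJn : J ≤ K.n)
    (hconst : D.ConstTop k (K.g J) (K.u J))
    (hlow : ∀ h : LaurentXY, h ≠ 0 → h.natDegree < radix K.α J →
      ∃ v ∈ K.valueGroup J, D.ConstTop k h v)
    {m : ℕ} (hm : m ≤ K.α J) (hne : h ≠ 0) (hdeg : h.natDegree < m * radix K.α J) :
    ∃ i < m, ∃ v ∈ K.valueGroup J, D.ConstTop k h (v + i * K.u J) := by
  obtain ⟨hmon, hg⟩ := K.g_monic_natDegree hJ (by lia)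
  induction m generalizing h with
  | zero => exact absurd hdeg (by simp)
  | succ m ih =>
    rcases lt_or_ge h.natDegree (radix K.α J) with hlt | hge
    · obtain ⟨v, hv, hc⟩ := hlow h hne hlt
      exact ⟨0, by lia, v, hv, by simpa using hc⟩
    rw [← modByMonic_add_div h (K.g J)]
    refine exists_constTop_add_mul hJ hJn hconst (fun hr0 => hlow _ hr0 ?_) (by lia)
      (ih (by lia) ?_ ?_)
    · rw [← hg]
      refine natDegree_modByMonic_lt _ hmon fun hone => ?_
      have hpos := K.radix_α_pos (j := J) (by lia)
      rw [← hg, hone, natDegree_one] at hpos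
      exact hpos.false
    · rw [Ne, divByMonic_eq_zero_iff hmon, not_lt, degree_eq_natDegree hmon.ne_zero,
        degree_eq_natDegree hne, hg]
      exact_mod_cast hge
    · rw [natDegree_divByMonic _ hmon, hg]
      rw [add_mul, one_mul] at hdeg
      lia

lemma exists_constTop_of_natDegree_lt (hJ : 1 ≤ J) (hJn : J ≤ K.n + 1)
    (hconst : ∀ j, j < J → D.ConstTop k (K.g j) (K.u j)) (hne : h ≠ 0)
    (hdeg : h.natDegree < radix K.α J) : ∃ v ∈ K.valueGroup J, D.ConstTop k h v := by
  induction J, hJ using Nat.le_induction generalizing h with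
  | base =>
    rw [radix_one, Nat.lt_one_iff] at hdeg
    obtain ⟨a, rfl⟩ := natDegree_eq_zero.1 hdeg
    obtain ⟨d, b, hb, htop⟩ := HasTop.exists_ne_zero (C_ne_zero.1 hne)
    exact ⟨d, K.intCast_mem_valueGroup_one d, GenericPuiseux.constTop_C htop hb⟩
  | succ J hJ ih =>
    rw [radix_succ _ hJ, mul_comm] at hdeg
    obtain ⟨i, -, v, hv, hc⟩ := exists_constTop_of_natDegree_lt_mul hJ (by lia)
      (hconst J J.lt_succ_self) (fun h => ih (by lia) fun j hj => hconst j (by lia)) le_rfl hne hdeg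
    refine ⟨_, add_mem (K.valueGroup_mono (Nat.le_succ J) hv) ?_, hc⟩
    rw [← nsmul_eq_mul]
    exact nsmul_mem (K.u_mem_valueGroup (Nat.lt_succ_self J)) i

end NatDegreeLt

end KeyForms

/-! ### The essential key forms -/

namespace KeyForms

variable {D : GenericPuiseux} (K : KeyForms D.fullSemidegree)

/-- The position of the first key form whose top coefficient for `δ_k` involves `ξ`, and `0` for
`k = 0`. By `essIdx_eq_idx` this is the position of the `k`-th essential key form. -/
def idx : ℕ → ℕ
  | 0 => 0
  | k + 1 => sInf {j | ¬ D.ConstTop (k + 1) (K.g j) (K.u j)}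

lemma idx_zero : K.idx 0 = 0 := rfl

lemma not_constTop_succ_n {k : ℕ} (hk : k ≤ D.l) :
    ¬ D.ConstTop (k + 1) (K.g (K.n + 1)) (K.u (K.n + 1)) := fun h =>
  K.not_constTop_last (h.of_le (by lia) (by lia) le_rfl)

lemma idx_le {k : ℕ} (hk : k ≤ D.l + 1) : K.idx k ≤ K.n + 1 := by
  cases k with
  | zero => exact Nat.zero_le _
  | succ k => exact Nat.sInf_le (K.not_constTop_succ_n (by lia))

lemma not_constTop_idx {k : ℕ} (hk : k ≤ D.l) :
    ¬ D.ConstTop (k + 1) (K.g (K.idx (k + 1))) (K.u (K.idx (k + 1))) :=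
  Nat.sInf_mem (s := {j | ¬ D.ConstTop (k + 1) (K.g j) (K.u j)}) ⟨_, K.not_constTop_succ_n hk⟩

lemma constTop_of_lt_idx {k j : ℕ} (hj : j < K.idx k) : D.ConstTop k (K.g j) (K.u j) := by
  cases k with
  | zero => exact absurd hj j.not_lt_zero
  | succ k => exact not_not.1 (Nat.notMem_of_lt_sInf hj)

lemma one_le_idx {k : ℕ} (hk1 : 1 ≤ k) (hk : k ≤ D.l + 1) : 1 ≤ K.idx k := by
  obtain ⟨k, rfl⟩ := Nat.exists_eq_add_of_le' hk1
  by_contra! hzero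
  apply K.not_constTop_idx (show k ≤ D.l by lia)
  rw [Nat.lt_one_iff.1 hzero, K.u_zero]
  exact K.constTop_zero _

lemma idx_last : K.idx (D.l + 1) = K.n + 1 := by
  refine le_antisymm (K.idx_le le_rfl) ?_
  by_contra! h
  exact K.not_constTop_idx le_rfl (K.constTop_of_le (by lia))

lemma subst_g_ne_zero (k : ℕ) {j : ℕ} (hj : j ≤ K.n + 1) : D.subst k (K.g j) ≠ 0 := by
  intro hzero
  obtain ⟨c, hc, htop⟩ := K.exists_hasTop hj
  rw [← D.specialize_subst k (D.l + 1), hzero, map_zero] at htop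
  exact hc htop.2.symm

lemma natDegree_ne_zero_of_hasTop_idx {k : ℕ} (hk : k ≤ D.l) {v : ℚ} {c : ℂ[X]} (hc : c ≠ 0)
    (htop : HasTop (D.subst (k + 1) (K.g (K.idx (k + 1)))) v c) : c.natDegree ≠ 0 := by
  intro hdeg
  obtain ⟨a, rfl⟩ := natDegree_eq_zero.1 hdeg
  have hconst : D.ConstTop (k + 1) (K.g (K.idx (k + 1))) v := ⟨a, C_ne_zero.1 hc, htop⟩
  obtain ⟨c', hc', htop'⟩ := K.exists_hasTop (K.idx_le (show k + 1 ≤ D.l + 1 by lia))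
  obtain rfl := (hconst.of_le (by lia) (by lia) le_rfl).unique htop' hc'
  exact K.not_constTop_idx hk hconst

/-- The derivative of `g (idx k)` has lower degree, hence a `ξ`-free top coefficient. -/
lemma exists_hasTop_idx {k : ℕ} (hk : k ≤ D.l) :
    ∃ v c, HasTop (D.subst (k + 1) (K.g (K.idx (k + 1)))) v c ∧ c.natDegree = 1 := by
  have hpos := K.one_le_idx (show 1 ≤ k + 1 by lia) (by lia)
  have hle := K.idx_le (show k + 1 ≤ D.l + 1 by lia)
  obtain ⟨v, c, hc, htop⟩ := HasTop.exists_ne_zero (K.subst_g_ne_zero (k + 1) hle)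
  have hdeg := (K.g_monic_natDegree hpos hle).2
  have hdeg0 : (K.g (K.idx (k + 1))).natDegree ≠ 0 := hdeg ▸ (K.radix_α_pos hle).ne'
  have : IsAddTorsionFree (LaurentPolynomial ℂ) := .of_module_rat _
  obtain ⟨v', -, b, hb, htop'⟩ := K.exists_constTop_of_natDegree_lt (k := k + 1) hpos hle
    (fun j hj => K.constTop_of_lt_idx hj) (derivative_eq_zero.not.2 hdeg0)
    (hdeg ▸ natDegree_derivative_lt hdeg0)
  exact ⟨v, c, htop, D.natDegree_eq_one_of_hasTop_derivative htop
    (K.natDegree_ne_zero_of_hasTop_idx hk hc htop) htop' hb⟩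

/-- The constant coefficient vanishes because `expo (k + 1)` does not lie in `fracGroup (P k)`. -/
lemma exists_hasTop_idx_smul_X {k : ℕ} (hk : k < D.l) :
    ∃ a : ℂ, a ≠ 0 ∧ ∃ v, v - D.expo (k + 1) ∈ fracGroup (D.P k) ∧
      HasTop (D.subst (k + 1) (K.g (K.idx (k + 1)))) v (C a * X) := by
  obtain ⟨v, c, htop, hdeg⟩ := K.exists_hasTop_idx hk.le
  have hgraded := D.subst_mem_gradedSubring hk.le (K.g (K.idx (k + 1))) v
  rw [htop.2] at hgraded
  have hlin : c.coeff 1 ≠ 0 := by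
    rw [← hdeg]
    exact leadingCoeff_ne_zero.2 (ne_zero_of_natDegree_gt (hdeg ▸ one_pos))
  have hv : v - D.expo (k + 1) ∈ fracGroup (D.P k) := by simpa using hgraded 1 hlin
  have hconst : c.coeff 0 = 0 := by
    by_contra hne
    have hv' : v ∈ fracGroup (D.P k) := by simpa using hgraded 0 hne
    exact D.expo_notMem_fracGroup hk (by simpa using sub_mem hv' hv)
  refine ⟨c.coeff 1, hlin, v, hv, ?_⟩
  rwa [eq_X_add_C_of_natDegree_le_one hdeg.le, hconst, C_0, add_zero] at htop

lemma u_idx_sub_expo_mem_and_constTop {k : ℕ} (hk : k < D.l) :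
    K.u (K.idx (k + 1)) - D.expo (k + 1) ∈ fracGroup (D.P k) ∧
      D.ConstTop (k + 2) (K.g (K.idx (k + 1))) (K.u (K.idx (k + 1))) := by
  obtain ⟨a, ha, v, hv, htop⟩ := K.exists_hasTop_idx_smul_X hk
  have heval : (C a * X).eval (D.φ (D.expo (k + 1))) ≠ 0 := by
    rw [eval_mul_X, eval_C]
    exact mul_ne_zero ha (D.φ_expo_ne_zero (by lia) hk)
  have hconst : D.ConstTop (k + 2) (K.g (K.idx (k + 1))) v :=
    ⟨_, heval, D.hasTop_subst_of_lt (by lia) (by lia) (by lia) htop⟩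
  obtain ⟨c, hc, htop'⟩ := K.exists_hasTop (K.idx_le (show k + 1 ≤ D.l + 1 by lia))
  obtain rfl := (hconst.of_le (by lia) (by lia) le_rfl).unique htop' hc
  exact ⟨hv, hconst⟩

lemma idx_lt_idx_succ {k : ℕ} (hk : k ≤ D.l) : K.idx k < K.idx (k + 1) := by
  cases k with
  | zero => exact K.one_le_idx le_rfl (by lia)
  | succ k =>
    by_contra! hle
    apply K.not_constTop_idx hk
    rcases hle.lt_or_eq with hlt | heq
    · exact (K.constTop_of_lt_idx hlt).of_le (by lia) (by lia) (by lia)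
    · rw [heq]
      exact (K.u_idx_sub_expo_mem_and_constTop hk).2

lemma idx_lt_idx {k k' : ℕ} (h : k < k') (hk' : k' ≤ D.l + 1) : K.idx k < K.idx k' := by
  induction k', h using Nat.le_induction with
  | base => exact K.idx_lt_idx_succ (by lia)
  | succ m _ ih => exact (ih (by lia)).trans (K.idx_lt_idx_succ (by lia))

lemma idx_le_n {k : ℕ} (hk : k ≤ D.l) : K.idx k ≤ K.n :=
  Nat.lt_succ_iff.1 ((K.idx_lt_idx_succ hk).trans_le (K.idx_le (by lia)))

/-! ### The value groups -/

lemma fracGroup_le_valueGroup {k j : ℕ} (hk : k ≤ D.l) (hj : K.idx k < j) :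
    fracGroup (D.P k) ≤ K.valueGroup j := by
  induction k generalizing j with
  | zero =>
    rw [fracGroup, AddSubgroup.zmultiples_le, D.P_zero, Nat.cast_one, div_one, ← K.u_zero]
    exact K.u_mem_valueGroup (Nat.zero_lt_of_lt hj)
  | succ k ih =>
    have hprev := ih (by lia) ((K.idx_lt_idx_succ (k := k) (by lia)).trans hj)
    have hexpo : D.expo (k + 1) ∈ K.valueGroup j := by
      simpa using sub_mem (K.u_mem_valueGroup hj)
        (hprev (K.u_idx_sub_expo_mem_and_constTop hk).1)
    obtain ⟨s, t, hbezout⟩ := D.coprime (k + 1) (by lia) (by lia)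
    have hP := (D.P_pos_rat (k := k) (by lia)).ne'
    have hp : (D.p (k + 1) : ℚ) ≠ 0 := by exact_mod_cast (D.p_pos (by lia) (by lia)).ne'
    have hbezoutℚ : (s : ℚ) * D.q (k + 1) + t * D.p (k + 1) = 1 := by exact_mod_cast hbezout
    have hunit : 1 / (D.P (k + 1) : ℚ) = s • D.expo (k + 1) + (t : ℚ) / D.P k := by
      rw [zsmul_eq_mul, GenericPuiseux.expo, D.P_succ, Nat.cast_mul]
      field_simp
      linarith
    rw [fracGroup, AddSubgroup.zmultiples_le, hunit]
    exact add_mem (zsmul_mem hexpo s) (hprev (mem_fracGroup.2 ⟨t, rfl⟩))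

lemma u_mem_fracGroup {k j : ℕ} (hk : k ≤ D.l) (hj : j < K.idx (k + 1)) :
    K.u j ∈ fracGroup (D.P k) :=
  (K.constTop_of_lt_idx hj).mem_fracGroup hk

lemma valueGroup_idx {k : ℕ} (hk : k ≤ D.l) :
    K.valueGroup (K.idx (k + 1)) = fracGroup (D.P k) := by
  refine le_antisymm ?_ (K.fracGroup_le_valueGroup hk (K.idx_lt_idx_succ hk))
  rw [valueGroup, AddSubgroup.closure_le]
  rintro _ ⟨j, hj, rfl⟩
  exact K.u_mem_fracGroup hk hj

lemma mul_u_idx_mem_fracGroup_iff {k : ℕ} (hk : k < D.l) (a : ℤ) :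
    a * K.u (K.idx (k + 1)) ∈ fracGroup (D.P k) ↔ (D.p (k + 1) : ℤ) ∣ a := by
  rw [← D.mul_expo_mem_fracGroup_iff hk.le]
  have h := zsmul_mem (K.u_idx_sub_expo_mem_and_constTop hk).1 a
  rw [zsmul_eq_mul, mul_sub] at h
  rw [← AddSubgroup.add_mem_cancel_left _ h (y := a * D.expo (k + 1)), sub_add_cancel]

lemma α_idx {k : ℕ} (hk1 : 1 ≤ k) (hk : k ≤ D.l) : K.α (K.idx k) = D.p k := by
  obtain ⟨k, rfl⟩ := Nat.exists_eq_add_of_le' hk1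
  refine (K.α_isLeast (K.one_le_idx hk1 (by lia)) (K.idx_le_n hk)).unique ?_
  have hmem (a : ℕ) : (a : ℚ) * K.u (K.idx (k + 1)) ∈ K.valueGroup (K.idx (k + 1)) ↔
      D.p (k + 1) ∣ a := by
    rw [K.valueGroup_idx (by lia)]
    exact_mod_cast K.mul_u_idx_mem_fracGroup_iff hk a
  exact ⟨⟨D.p_pos hk1 (by lia), (hmem _).2 dvd_rfl⟩,
    fun a ha => Nat.le_of_dvd ha.1 ((hmem a).1 ha.2)⟩

lemma α_eq_one {k j : ℕ} (hk : k ≤ D.l) (hlt : K.idx k < j) (hlt' : j < K.idx (k + 1)) :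
    K.α j = 1 := by
  have hn := K.idx_le (show k + 1 ≤ D.l + 1 by lia)
  refine (K.α_isLeast (by lia) (by lia)).unique ⟨⟨one_pos, ?_⟩, fun a ha => ha.1⟩
  rw [Nat.cast_one, one_mul]
  exact K.fracGroup_le_valueGroup hk hlt (K.u_mem_fracGroup hk hlt')

/-- The predicate that `essIdx` enumerates: `g j` is an essential key form. -/
def IsEssIdx (j : ℕ) : Prop := j = 0 ∨ (1 ≤ j ∧ j ≤ K.n ∧ 1 < K.α j) ∨ j = K.n + 1

lemma isEssIdx_idx {k : ℕ} (hk : k ≤ D.l + 1) : K.IsEssIdx (K.idx k) := by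
  rcases Nat.eq_zero_or_pos k with rfl | hk1
  · exact Or.inl rfl
  rcases hk.lt_or_eq with hlt | rfl
  · refine Or.inr (Or.inl ⟨K.one_le_idx hk1 hk, K.idx_le_n (by lia), ?_⟩)
    rw [K.α_idx hk1 (by lia)]
    exact D.two_le k hk1 (by lia)
  · exact Or.inr (Or.inr K.idx_last)

lemma not_isEssIdx {k j : ℕ} (hk : k ≤ D.l) (hlt : K.idx k < j) (hlt' : j < K.idx (k + 1)) :
    ¬ K.IsEssIdx j := by
  have hn := K.idx_le (show k + 1 ≤ D.l + 1 by lia)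
  have hα := K.α_eq_one hk hlt hlt'
  rintro (h | h | h) <;> lia

lemma essIdx_eq_idx {k : ℕ} (hk : k ≤ D.l + 1) : K.essIdx k = K.idx k := by
  classical
  have hcount : Nat.count K.IsEssIdx (K.idx k) = k := by
    induction k with
    | zero => exact Nat.count_zero _
    | succ k ih =>
      obtain ⟨d, hd⟩ := Nat.exists_eq_add_of_lt (K.idx_lt_idx_succ (k := k) (by lia))
      have hbetween : Nat.count (fun i => K.IsEssIdx (K.idx k + 1 + i)) d = 0 :=
        Nat.count_iff_forall_not.2 fun i hi =>
          K.not_isEssIdx (k := k) (by lia) (by lia) (by lia)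
      rw [hd, add_right_comm, Nat.count_add, Nat.count_succ, ih (by lia),
        if_pos (K.isEssIdx_idx (by lia)), hbetween]
  have hnth := Nat.nth_count (K.isEssIdx_idx hk)
  rwa [hcount] at hnth

lemma ess_eq {k : ℕ} (hk : k ≤ D.l + 1) : K.ess k = K.g (K.idx k) := by
  rw [ess, K.essIdx_eq_idx hk]

/-! ### The recursion between consecutive essential key forms -/

lemma mem_steps {j i : ℕ} (hj : j ≤ D.l) : i ∈ K.steps j ↔ K.idx j ≤ i ∧ i < K.idx (j + 1) := by
  rw [steps, Finset.mem_Ico, K.essIdx_eq_idx (by lia), K.essIdx_eq_idx (by lia)]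

lemma g_eq_pow_sub_sum {j i : ℕ} (hj1 : 1 ≤ j) (hj : j ≤ D.l) (hlt : K.idx j < i)
    (hle : i ≤ K.idx (j + 1)) :
    K.g i = K.g (K.idx j) ^ D.p j - ∑ m ∈ Finset.Ico (K.idx j) i, K.stepTerm m := by
  have hn := K.idx_le (show j + 1 ≤ D.l + 1 by lia)
  have hpos := K.one_le_idx hj1 (by lia)
  induction i, hlt using Nat.le_induction with
  | base => rw [K.g_succ_eq hpos (K.idx_le_n hj), K.α_idx hj1 hj, Nat.Ico_succ_singleton,
      Finset.sum_singleton]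
  | succ i hlt ih =>
    rw [K.g_succ_eq (by lia) (by lia), K.α_eq_one hj hlt (by lia), pow_one, ih (by lia),
      Finset.sum_Ico_succ_top (by lia), sub_sub]

lemma ess_succ {j : ℕ} (hj1 : 1 ≤ j) (hj : j ≤ D.l) :
    K.ess (j + 1) = K.ess j ^ D.p j - ∑ i ∈ K.steps j, K.stepTerm i := by
  rw [K.ess_eq (by lia), K.ess_eq (by lia), steps, K.essIdx_eq_idx (by lia),
    K.essIdx_eq_idx (by lia)]
  exact K.g_eq_pow_sub_sum hj1 hj (K.idx_lt_idx_succ hj) le_rfl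

lemma α_mul_u_strictAnti {j i i' : ℕ} (hj1 : 1 ≤ j) (hj : j ≤ D.l) (hi : K.idx j ≤ i)
    (hii' : i < i') (hi' : i' < K.idx (j + 1)) : K.α i' * K.u i' < K.α i * K.u i := by
  have hn := K.idx_le (show j + 1 ≤ D.l + 1 by lia)
  have hpos := K.one_le_idx hj1 (by lia)
  have hstep (m : ℕ) (hm : i ≤ m) (hm' : m + 1 < K.idx (j + 1)) :
      K.α (m + 1) * K.u (m + 1) < K.α m * K.u m := by
    rw [K.α_eq_one hj (by lia) hm', Nat.cast_one, one_mul]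
    exact K.u_lt (by lia) (by lia)
  induction i', hii' using Nat.le_induction with
  | base => exact hstep i le_rfl hi'
  | succ i' hlt ih => exact (hstep i' (by lia) hi').trans (ih (by lia))

lemma α_mul_u_le {j i : ℕ} (hj1 : 1 ≤ j) (hj : j ≤ D.l) (hi : K.idx j ≤ i)
    (hi' : i < K.idx (j + 1)) : K.α i * K.u i ≤ D.p j * K.u (K.idx j) := by
  rw [← K.α_idx hj1 hj]
  rcases hi.lt_or_eq with hlt | rfl
  · exact (K.α_mul_u_strictAnti hj1 hj le_rfl hlt hi').le
  · exact le_rfl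

lemma prod_Ico_idx {M : Type*} [CommMonoid M] {f : ℕ → M} {j : ℕ} (hj : j ≤ D.l)
    (hf : ∀ t ≤ j, ∀ m, K.idx t < m → m < K.idx (t + 1) → f m = 1) :
    ∏ m ∈ Finset.Ico 1 (K.idx (j + 1)), f m = ∏ t ∈ Finset.Ico 1 (j + 1), f (K.idx t) := by
  induction j with
  | zero =>
    rw [Finset.Ico_self, Finset.prod_empty]
    refine Finset.prod_eq_one fun m hm => ?_
    rw [Finset.mem_Ico] at hm
    exact hf 0 le_rfl m hm.1 hm.2
  | succ j ih =>
    have hlt := K.idx_lt_idx_succ hj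
    rw [← Finset.prod_Ico_consecutive f (K.one_le_idx (show 1 ≤ j + 1 by lia) (by lia)) hlt.le,
      ih (by lia) fun t ht => hf t (by lia), Finset.prod_eq_prod_Ico_succ_bot hlt,
      Finset.prod_Ico_succ_top (show 1 ≤ j + 1 by lia)]
    have hrest : ∏ m ∈ Finset.Ico (K.idx (j + 1) + 1) (K.idx (j + 2)), f m = 1 :=
      Finset.prod_eq_one fun m hm => by
        rw [Finset.mem_Ico] at hm
        exact hf (j + 1) le_rfl m hm.1 hm.2
    rw [hrest, mul_one]

/-- The exponent of the `t`-th essential key form in the term subtracted at step `i`. -/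
def digit (i t : ℕ) : ℕ := if K.idx t < i then K.β i (K.idx t) else 0

lemma digit_lt {j i t : ℕ} (hj : j ≤ D.l) (hi : i < K.idx (j + 1)) (ht1 : 1 ≤ t) (ht : t ≤ j) :
    K.digit i t < D.p t := by
  have hn := K.idx_le (show j + 1 ≤ D.l + 1 by lia)
  rw [digit]
  split_ifs with h
  · rw [← K.α_idx ht1 (by lia)]
    exact K.β_lt i _ (K.one_le_idx ht1 (by lia)) h (by lia)
  · exact D.p_pos ht1 (by lia)

/-- The part of the monomial subtracted at step `i` that does not involve `x`, for a step `i` on the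
way from the `j`-th to the `(j + 1)`-st essential key form. -/
def essMonomial (j i : ℕ) : LaurentXY := ∏ t ∈ Finset.Ico 1 (j + 1), K.ess t ^ K.digit i t

lemma stepTerm_eq {j i : ℕ} (hj : j ≤ D.l) (hi : i < K.idx (j + 1)) :
    K.stepTerm i = K.θ i • (C (LaurentPolynomial.T (K.β₀ i)) * K.essMonomial j i) := by
  have hn := K.idx_le (show j + 1 ≤ D.l + 1 by lia)
  have hprod : ∏ m ∈ Finset.Ico 1 i, K.g m ^ K.β i m = K.essMonomial j i := by
    calc ∏ m ∈ Finset.Ico 1 i, K.g m ^ K.β i m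
        = ∏ m ∈ Finset.Ico 1 i, K.g m ^ (if m < i then K.β i m else 0) :=
          Finset.prod_congr rfl fun m hm => by rw [if_pos (Finset.mem_Ico.1 hm).2]
      _ = ∏ m ∈ Finset.Ico 1 (K.idx (j + 1)), K.g m ^ (if m < i then K.β i m else 0) :=
          Finset.prod_subset (Finset.Ico_subset_Ico_right hi.le) fun m hm hm' => by
            rw [if_neg fun hmi => hm' (Finset.mem_Ico.2 ⟨(Finset.mem_Ico.1 hm).1, hmi⟩), pow_zero]
      _ = ∏ t ∈ Finset.Ico 1 (j + 1), K.g (K.idx t) ^ K.digit i t := by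
          refine K.prod_Ico_idx hj fun t ht m hlt hlt' => ?_
          split_ifs with hmi
          · have hβ := K.β_lt i m (by lia) hmi (by lia)
            rw [K.α_eq_one (ht.trans hj) hlt hlt', Nat.lt_one_iff] at hβ
            rw [hβ, pow_zero]
          · exact pow_zero _
      _ = _ := Finset.prod_congr rfl fun t ht => by
          rw [K.ess_eq ((Finset.mem_Ico.1 ht).2.le.trans (by lia))]
  rw [stepTerm, hprod]

lemma ess_monic {j : ℕ} (hj1 : 1 ≤ j) (hj : j ≤ D.l + 1) : (K.ess j).Monic := by
  rw [K.ess_eq hj]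
  exact (K.g_monic_natDegree (K.one_le_idx hj1 hj) (K.idx_le hj)).1

lemma natDegree_ess {j : ℕ} (hj1 : 1 ≤ j) (hj : j ≤ D.l + 1) :
    (K.ess j).natDegree = radix D.p j := by
  rw [K.ess_eq hj, (K.g_monic_natDegree (K.one_le_idx hj1 hj) (K.idx_le hj)).2]
  obtain ⟨j, rfl⟩ := Nat.exists_eq_add_of_le' hj1
  calc radix K.α (K.idx (j + 1)) = ∏ t ∈ Finset.Ico 1 (j + 1), K.α (K.idx t) :=
        K.prod_Ico_idx (by lia) fun t ht _ hlt hlt' => K.α_eq_one (by lia) hlt hlt'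
    _ = radix D.p (j + 1) := Finset.prod_congr rfl fun t ht => by
        rw [Finset.mem_Ico] at ht
        exact K.α_idx ht.1 (by lia)

end KeyForms

/-! ### The weights of the essential key forms -/

namespace GenericPuiseux

variable (D : GenericPuiseux)

lemma mem_fracGroup_of_hasTop {k : ℕ} (hk : k ≤ D.l) {f : LaurentXY} {v : ℚ} {c : ℂ[X]}
    (h : HasTop (D.subst (k + 1) f) v c) (hc : c ≠ 0) : v ∈ fracGroup (D.P (k + 1)) := by
  have hmem := D.subst_mem_gradedSubring hk f v c.natDegree
    (by rwa [h.2, coeff_natDegree, leadingCoeff_ne_zero])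
  have hsum := add_mem (D.fracGroup_P_le k.le_succ (by lia) hmem)
    (nsmul_mem (D.expo_mem_fracGroup (k := k + 1)) c.natDegree)
  rwa [nsmul_eq_mul, sub_add_cancel] at hsum

lemma exists_intCast_of_semidegree_eq {k : ℕ} (hk1 : 1 ≤ k) (hk : k ≤ D.l + 1) {f : LaurentXY}
    {w : ℚ} (h : D.semidegree k f = (w : WithBot ℚ)) : ∃ a : ℤ, w = a := by
  obtain ⟨c, hc, htop⟩ := D.hasTop_of_semidegree_eq hk h
  obtain ⟨k, rfl⟩ := Nat.exists_eq_add_of_le' hk1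
  obtain ⟨a, ha⟩ := mem_fracGroup.1 (D.mem_fracGroup_of_hasTop (by lia) htop hc)
  exact ⟨a, (div_left_inj' (D.P_pos_rat hk).ne').1 ha⟩

end GenericPuiseux

namespace KeyForms

variable {D : GenericPuiseux} (K : KeyForms D.fullSemidegree)

lemma ess_zero : K.ess 0 = C (LaurentPolynomial.T 1) := by
  rw [K.ess_eq (Nat.zero_le _), idx_zero, K.g_zero]

lemma constTop_ess {k t : ℕ} (hk : k ≤ D.l + 1) (ht : t < k) :
    D.ConstTop k (K.ess t) (K.u (K.idx t)) := by
  rw [K.ess_eq (by lia)]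
  exact K.constTop_of_lt_idx (K.idx_lt_idx ht hk)

/-- The top terms of `g i ^ α i` and of the monomial subtracted from it cancel: for
`i + 1 < idx k` the value drops by definition, and for `i + 1 = idx k` the top coefficient would
otherwise be constant. -/
lemma hasTop_g_succ {k i : ℕ} (hk : k ≤ D.l) (hi1 : 1 ≤ i) (hi : i < K.idx (k + 1)) :
    HasTop (D.subst (k + 1) (K.g (i + 1))) (K.α i * K.u i) 0 := by
  have hn := K.idx_le (show k + 1 ≤ D.l + 1 by lia)
  rcases (show i + 1 ≤ K.idx (k + 1) from hi).lt_or_eq with hlt | heq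
  · obtain ⟨a, -, htop⟩ := K.constTop_of_lt_idx hlt
    exact htop.of_lt (K.u_lt hi1 (by lia))
  · obtain ⟨v, c, htop, hdeg⟩ := K.exists_hasTop_idx hk
    rw [← heq] at htop
    have hc : c ≠ 0 := ne_zero_of_natDegree_gt (hdeg ▸ Nat.zero_lt_one)
    obtain ⟨a, -, hpow⟩ := (K.constTop_of_lt_idx hi).pow (K.α i)
    obtain ⟨b, -, hterm⟩ := K.constTop_stepTerm hi1 (by lia)
      fun m hm => K.constTop_of_lt_idx (hm.trans hi)
    have hsub := hpow.sub hterm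
    rw [← map_sub, ← K.g_succ_eq hi1 (by lia), ← C_sub] at hsub
    refine htop.of_lt ((htop.le_of_ne_zero hsub hc).lt_of_ne ?_)
    rintro rfl
    rw [htop.2.symm.trans hsub.2, natDegree_C] at hdeg
    exact zero_ne_one hdeg

/-- The essential key forms `f_0, …, f_k` have positive degree for `δ_k`. -/
structure HasPosWeights (K : KeyForms D.fullSemidegree) (k : ℕ) : Prop where
  one_le : 1 ≤ k
  le : k ≤ D.l + 1
  pos : ∀ t ≤ k, 0 < D.semidegree k (K.ess t)

/-- The coefficient (in `ℂ[ξ]`) of the top term of `f_t` for `δ_k`. -/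
def topCoeff (k t : ℕ) : ℂ[X] := (D.subst k (K.ess t)).coeff (weight D K k t / D.P k)

namespace HasPosWeights

variable {K} {k : ℕ}

lemma semidegree_ess (h : K.HasPosWeights k) {t : ℕ} (ht : t ≤ k) :
    D.semidegree k (K.ess t) = ((weight D K k t : ℚ) : WithBot ℚ) := by
  have hpos := h.pos t ht
  obtain ⟨w, hw⟩ := WithBot.ne_bot_iff_exists.1 (bot_le.trans_lt hpos).ne'
  obtain ⟨a, rfl⟩ := D.exists_intCast_of_semidegree_eq h.one_le h.le hw.symm
  have ha : 0 ≤ a := by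
    rw [← hw] at hpos
    exact_mod_cast hpos.le
  lift a to ℕ using ha
  rw [weight, ← hw, WithBot.unbotD_coe, Int.cast_natCast, Nat.floor_natCast]

lemma weight_pos (h : K.HasPosWeights k) {t : ℕ} (ht : t ≤ k) : 0 < weight D K k t := by
  have hpos := h.pos t ht
  rw [h.semidegree_ess ht] at hpos
  exact_mod_cast hpos

lemma topCoeff_ne_zero_and_hasTop_ess (h : K.HasPosWeights k) {t : ℕ} (ht : t ≤ k) :
    K.topCoeff k t ≠ 0 ∧
      HasTop (D.subst k (K.ess t)) (weight D K k t / D.P k) (K.topCoeff k t) := by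
  obtain ⟨c, hc, htop⟩ := D.hasTop_of_semidegree_eq h.le (h.semidegree_ess ht)
  rw [topCoeff, htop.2]
  exact ⟨hc, htop⟩

lemma topCoeff_ne_zero (h : K.HasPosWeights k) {t : ℕ} (ht : t ≤ k) : K.topCoeff k t ≠ 0 :=
  (h.topCoeff_ne_zero_and_hasTop_ess ht).1

lemma hasTop_ess (h : K.HasPosWeights k) {t : ℕ} (ht : t ≤ k) :
    HasTop (D.subst k (K.ess t)) (weight D K k t / D.P k) (K.topCoeff k t) :=
  (h.topCoeff_ne_zero_and_hasTop_ess ht).2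

lemma weight_div_P (h : K.HasPosWeights k) {t : ℕ} (ht : t < k) :
    (weight D K k t : ℚ) / D.P k = K.u (K.idx t) :=
  ((K.constTop_ess h.le ht).unique (h.hasTop_ess ht.le) (h.topCoeff_ne_zero ht.le)).symm

lemma natDegree_topCoeff_of_lt (h : K.HasPosWeights k) {t : ℕ} (ht : t < k) :
    (K.topCoeff k t).natDegree = 0 := by
  obtain ⟨a, ha, htop⟩ := K.constTop_ess h.le ht
  rw [← (htop.unique (h.hasTop_ess ht.le) (C_ne_zero.2 ha) (h.topCoeff_ne_zero ht.le)).2,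
    natDegree_C]

lemma natDegree_topCoeff_self (h : K.HasPosWeights k) : (K.topCoeff k k).natDegree = 1 := by
  obtain ⟨m, rfl⟩ := Nat.exists_eq_add_of_le' h.one_le
  obtain ⟨v, c, htop, hdeg⟩ := K.exists_hasTop_idx (k := m) (by have := h.le; lia)
  have hc : c ≠ 0 := ne_zero_of_natDegree_gt (hdeg ▸ Nat.zero_lt_one)
  rw [← K.ess_eq h.le] at htop
  rw [← (htop.unique (h.hasTop_ess le_rfl) hc (h.topCoeff_ne_zero le_rfl)).2, hdeg]

end HasPosWeights

end KeyForms

/-! ### Nonnegativity of the exponents of `x` -/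

lemma coeff_incl (f : PolyXY) (N : ℕ) : (incl f).coeff N = toLaurent (f.coeff N) :=
  coeff_map _ _

lemma incl_C (p : ℂ[X]) : incl (C p) = C (toLaurent p) :=
  map_C _

lemma incl_injective : Function.Injective incl :=
  map_injective _ toLaurent_injective

lemma coeff_coeff_eq_zero_of_mem_range {f : LaurentXY} (hf : f ∈ incl.range) (N : ℕ) {a : ℤ}
    (ha : a < 0) : (f.coeff N).coeff a = 0 := by
  obtain ⟨p, rfl⟩ := hf
  rw [AlgHom.toRingHom_eq_coe, RingHom.coe_coe, coeff_incl, ← Finsupp.notMem_support_iff,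
    LaurentPolynomial.support_coeff_toLaurent, Finset.mem_map]
  rintro ⟨b, -, rfl⟩
  exact (Int.natCast_nonneg b).not_gt ha

lemma C_T_mem_range {a : ℤ} (ha : 0 ≤ a) : C (LaurentPolynomial.T a) ∈ incl.range :=
  ⟨C (X ^ a.toNat), by
    rw [AlgHom.toRingHom_eq_coe, RingHom.coe_coe, incl_C, toLaurent_X_pow, Int.toNat_of_nonneg ha]⟩

/-- Among the summands with negative exponent of `x` pick one of maximal degree in `y`; nothing can
cancel its leading coefficient. -/
lemma nonneg_of_sum_mem_range {ι : Type*} {s : Finset ι} {θ : ι → ℂ} {b : ι → ℤ}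
    {M : ι → LaurentXY} (hθ : ∀ i ∈ s, θ i ≠ 0) (hM : ∀ i ∈ s, M i ∈ incl.range)
    (hmonic : ∀ i ∈ s, (M i).Monic)
    (hb : ∀ i ∈ s, ∀ i' ∈ s, i ≠ i' → (M i).natDegree = (M i').natDegree → b i ≠ b i')
    (hsum : ∑ i ∈ s, θ i • (C (LaurentPolynomial.T (b i)) * M i) ∈ incl.range) :
    ∀ i ∈ s, 0 ≤ b i := by
  classical
  set term : ι → LaurentXY := fun i => θ i • (C (LaurentPolynomial.T (b i)) * M i) with hterm
  by_contra! hneg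
  obtain ⟨i₁, hi₁, hi₁neg⟩ := hneg
  obtain ⟨i₀, hi₀, hmax⟩ := (s.filter fun i => b i < 0).exists_max_image
    (fun i => (M i).natDegree) ⟨i₁, Finset.mem_filter.2 ⟨hi₁, hi₁neg⟩⟩
  have hnegsum : ∑ i ∈ s with b i < 0, term i ∈ incl.range := by
    rw [eq_sub_of_add_eq (Finset.sum_filter_add_sum_filter_not s (fun i => b i < 0) term)]
    refine sub_mem hsum (sum_mem fun i hi => Subalgebra.smul_mem _ (mul_mem ?_ ?_) _)
    · exact C_T_mem_range (not_lt.1 (Finset.mem_filter.1 hi).2)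
    · exact hM i (Finset.mem_filter.1 hi).1
  have hcoeff (i : ι) (hi : i ∈ s.filter fun i => b i < 0) :
      ((term i).coeff (M i₀).natDegree).coeff (b i₀) = if i = i₀ then θ i₀ else 0 := by
    rw [hterm, coeff_smul, coeff_C_mul, AddMonoidAlgebra.coeff_smul_apply]
    rcases (hmax i hi).lt_or_eq with hlt | heq
    · rw [coeff_eq_zero_of_natDegree_lt hlt, mul_zero, if_neg (by rintro rfl; exact hlt.ne rfl)]
      exact smul_zero _
    · rw [← heq, (hmonic i (Finset.mem_filter.1 hi).1).coeff_natDegree, mul_one,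
        LaurentPolynomial.T_apply]
      by_cases hii : i = i₀
      · rw [if_pos (congrArg b hii), if_pos hii, hii, smul_eq_mul, mul_one]
      · rw [if_neg (hb i (Finset.mem_filter.1 hi).1 i₀ (Finset.mem_filter.1 hi₀).1 hii heq),
          if_neg hii, smul_zero]
  have hzero := coeff_coeff_eq_zero_of_mem_range hnegsum (M i₀).natDegree
    (Finset.mem_filter.1 hi₀).2
  rw [finsetSum_coeff, AddMonoidAlgebra.coeff_sum, Finsupp.finsetSum_apply,
    Finset.sum_congr rfl hcoeff, Finset.sum_ite_eq', if_pos hi₀] at hzero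
  exact hθ i₀ (Finset.mem_filter.1 hi₀).1 hzero

namespace KeyForms

variable {D : GenericPuiseux} (K : KeyForms D.fullSemidegree)

lemma ess_pow_monic {j t : ℕ} (hj : j ≤ D.l + 1) (ht : t ∈ Finset.Ico 1 (j + 1)) (m : ℕ) :
    (K.ess t ^ m).Monic := by
  rw [Finset.mem_Ico] at ht
  exact (K.ess_monic ht.1 (by lia)).pow m

lemma essMonomial_monic {j : ℕ} (hj : j ≤ D.l + 1) (i : ℕ) : (K.essMonomial j i).Monic :=
  monic_prod_of_monic _ _ fun _ ht => K.ess_pow_monic hj ht _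

lemma natDegree_essMonomial {j : ℕ} (hj : j ≤ D.l + 1) (i : ℕ) :
    (K.essMonomial j i).natDegree = ∑ t ∈ Finset.Ico 1 (j + 1), K.digit i t * radix D.p t := by
  rw [essMonomial, natDegree_prod_of_monic _ _ fun _ ht => K.ess_pow_monic hj ht _]
  refine Finset.sum_congr rfl fun t ht => ?_
  rw [Finset.mem_Ico] at ht
  rw [(K.ess_monic ht.1 (by lia)).natDegree_pow, K.natDegree_ess ht.1 (by lia)]

lemma essMonomial_eq_of_natDegree_eq {j i i' : ℕ} (hj : j ≤ D.l) (hi : i < K.idx (j + 1))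
    (hi' : i' < K.idx (j + 1))
    (heq : (K.essMonomial j i).natDegree = (K.essMonomial j i').natDegree) :
    K.essMonomial j i = K.essMonomial j i' := by
  rw [K.natDegree_essMonomial (by lia), K.natDegree_essMonomial (by lia)] at heq
  have hdigit := sum_mul_radix_injective (fun t ht1 ht => K.digit_lt hj hi ht1 (by lia))
    (fun t ht1 ht => K.digit_lt hj hi' ht1 (by lia)) heq
  refine Finset.prod_congr rfl fun t ht => ?_
  rw [Finset.mem_Ico] at ht
  rw [hdigit t ht.1 ht.2]

lemma constTop_T_mul_essMonomial {j i : ℕ} (hj1 : 1 ≤ j) (hj : j ≤ D.l) (hi : i ∈ K.steps j) :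
    D.ConstTop (D.l + 1) (C (LaurentPolynomial.T (K.β₀ i)) * K.essMonomial j i)
      (K.α i * K.u i) := by
  have hn := K.idx_le (show j + 1 ≤ D.l + 1 by lia)
  have hpos := K.one_le_idx hj1 (by lia)
  rw [K.mem_steps hj] at hi
  have hθ := K.θ_ne i (by lia) (by lia)
  have hterm := (K.constTop_stepTerm (k := D.l + 1) (j := i) (by lia) (by lia)
    fun m hm => K.constTop_of_le (by lia)).smul (inv_ne_zero hθ)
  rwa [K.stepTerm_eq hj hi.2, inv_smul_smul₀ hθ] at hterm

lemma β₀_ne_of_natDegree_eq {j i i' : ℕ} (hj1 : 1 ≤ j) (hj : j ≤ D.l) (hi : i ∈ K.steps j)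
    (hi' : i' ∈ K.steps j) (hne : i ≠ i')
    (heq : (K.essMonomial j i).natDegree = (K.essMonomial j i').natDegree) :
    K.β₀ i ≠ K.β₀ i' := by
  intro hβ
  have htop := K.constTop_T_mul_essMonomial hj1 hj hi
  obtain ⟨a, ha, htop'⟩ := K.constTop_T_mul_essMonomial hj1 hj hi'
  rw [K.mem_steps hj] at hi hi'
  rw [hβ, K.essMonomial_eq_of_natDegree_eq hj hi.2 hi'.2 heq] at htop
  have hvalue := htop.unique htop' (C_ne_zero.2 ha)
  rcases hne.lt_or_gt with hlt | hlt
  · exact (K.α_mul_u_strictAnti hj1 hj hi.1 hlt hi'.2).ne' hvalue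
  · exact (K.α_mul_u_strictAnti hj1 hj hi'.1 hlt hi.2).ne hvalue

lemma β₀_nonneg {j : ℕ} (hj1 : 1 ≤ j) (hj : j ≤ D.l)
    (hpoly : ∀ t ≤ j + 1, K.ess t ∈ Set.range incl) {i : ℕ} (hi : i ∈ K.steps j) :
    0 ≤ K.β₀ i := by
  have hmem (t : ℕ) (ht : t ≤ j + 1) : K.ess t ∈ incl.range := hpoly t ht
  have hn := K.idx_le (show j + 1 ≤ D.l + 1 by lia)
  have hpos := K.one_le_idx hj1 (by lia)
  refine nonneg_of_sum_mem_range (θ := K.θ) (M := K.essMonomial j) (fun i hi => ?_)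
    (fun i _ => prod_mem fun t ht => pow_mem (hmem t (Finset.mem_Ico.1 ht).2.le) _)
    (fun i _ => K.essMonomial_monic (by lia) i)
    (fun i hi i' hi' => K.β₀_ne_of_natDegree_eq hj1 hj hi hi') ?_ i hi
  · rw [K.mem_steps hj] at hi
    exact K.θ_ne i (by lia) (by lia)
  · have hsum : ∑ i ∈ K.steps j, K.stepTerm i = K.ess j ^ D.p j - K.ess (j + 1) := by
      rw [K.ess_succ hj1 hj, sub_sub_cancel]
    rw [Finset.sum_congr rfl fun i hi => (K.stepTerm_eq hj ((K.mem_steps hj).1 hi).2).symm, hsum]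
    exact sub_mem (pow_mem (hmem j (by lia)) _) (hmem (j + 1) le_rfl)

lemma expoA_apply {k : ℕ} (hk : k ≤ D.l + 1) (i : ℕ) (t : Fin (k + 1)) :
    K.expoA k i t = if t.val = 0 then (K.β₀ i).toNat else K.digit i t := by
  rw [expoA, Finsupp.equivFunOnFinite_symm_apply_apply, K.essIdx_eq_idx (by lia), digit]

lemma digit_eq_zero {j i t : ℕ} (hi : i < K.idx (j + 1)) (ht : j < t) (htl : t ≤ D.l + 1) :
    K.digit i t = 0 := by
  rw [digit, if_neg]
  rcases (show j + 1 ≤ t from ht).lt_or_eq with hlt | rfl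
  · exact ((hi.trans (K.idx_lt_idx hlt htl)).not_gt)
  · exact hi.not_gt

lemma piA_monomial {k : ℕ} (m : Fin (k + 1) →₀ ℕ) (a : ℂ) :
    piA D K k (MvPolynomial.monomial m a) = a • ∏ t, K.ess t.val ^ m t := by
  rw [piA, MvPolynomial.aeval_monomial, Algebra.smul_def,
    Finsupp.prod_fintype _ _ fun _ => pow_zero _]

lemma piA_stepMonomial {k j i : ℕ} (hk : k ≤ D.l + 1)
    (hpoly : ∀ t ≤ k, K.ess t ∈ Set.range incl) (hj1 : 1 ≤ j) (hj : j < k) (hi : i ∈ K.steps j) :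
    piA D K k (MvPolynomial.monomial (K.expoA k i) (K.θ i)) = K.stepTerm i := by
  have hβ := K.β₀_nonneg hj1 (by lia) (fun t ht => hpoly t (by lia)) hi
  rw [K.mem_steps (by lia)] at hi
  have hx : K.ess 0 ^ K.expoA k i 0 = C (LaurentPolynomial.T (K.β₀ i)) := by
    rw [K.expoA_apply hk, if_pos (Fin.val_zero _), K.ess_zero, ← C_pow, LaurentPolynomial.T_pow,
      Int.toNat_of_nonneg hβ, mul_one]
  have hy : ∏ t : Fin k, K.ess t.succ.val ^ K.expoA k i t.succ = K.essMonomial j i := by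
    calc ∏ t : Fin k, K.ess t.succ.val ^ K.expoA k i t.succ
        = ∏ t ∈ Finset.Ico 1 (k + 1), K.ess t ^ K.digit i t := by
          rw [Finset.prod_Ico_eq_prod_range, Nat.add_sub_cancel, Finset.prod_range]
          refine Finset.prod_congr rfl fun t _ => ?_
          rw [K.expoA_apply hk, if_neg (Fin.val_ne_zero_iff.2 t.succ_ne_zero), Fin.val_succ,
            add_comm]
      _ = K.essMonomial j i := by
          refine (Finset.prod_subset (Finset.Ico_subset_Ico_right (by lia)) ?_).symm
          intro t ht hnot
          rw [Finset.mem_Ico] at ht hnot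
          rw [K.digit_eq_zero hi.2 (by lia) (by lia), pow_zero]
  rw [piA_monomial, K.stepTerm_eq (by lia) hi.2, Fin.prod_univ_succ, hy, Fin.val_zero, hx]

end KeyForms

/-! ### Leading forms -/

lemma GenericPuiseux.semidegree_lt_iff_of_hasTop (D : GenericPuiseux) {k : ℕ} (hk : k ≤ D.l + 1)
    {f : LaurentXY} {v : ℚ} {c : ℂ[X]} (h : HasTop (D.subst k f) v c) :
    D.semidegree k f < ((D.P k * v : ℚ) : WithBot ℚ) ↔ c = 0 := by
  refine ⟨fun hlt => ?_, ?_⟩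
  · by_contra hc
    exact hlt.ne (D.semidegree_eq_of_hasTop h hc)
  · rintro rfl
    by_cases h0 : D.subst k f = 0
    · have hbot : D.semidegree k f = ⊥ := by simp [semidegree, degX, h0]
      exact hbot ▸ WithBot.bot_lt_coe _
    · obtain ⟨v', c', hc', h'⟩ := HasTop.exists_ne_zero h0
      rw [D.semidegree_eq_of_hasTop h' hc', WithBot.coe_lt_coe]
      refine mul_lt_mul_of_pos_left ((h'.le_of_ne_zero h hc').lt_of_ne ?_) (D.P_pos_rat hk)
      rintro rfl
      exact hc' (h'.2.symm.trans h.2)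

section WeightedGrading

variable {σ R S : Type*} [CommSemiring R] [CommSemiring S] [Algebra R S] (w : σ → ℕ) (s : σ → S)

lemma aeval_monomial_weight (m : σ →₀ ℕ) (a : R) :
    MvPolynomial.aeval (fun v => monomial (w v) (s v)) (MvPolynomial.monomial m a) =
      monomial (Finsupp.weight w m) (MvPolynomial.aeval s (MvPolynomial.monomial m a)) := by
  have hprod : (m.prod fun v e => (monomial (w v) (s v)) ^ e) =
      monomial (Finsupp.weight w m) (m.prod fun v e => s v ^ e) := by
    simp only [Finsupp.prod, Finsupp.weight_apply, Finsupp.sum, smul_eq_mul, mul_comm _ (w _),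
      ← C_mul_X_pow_eq_monomial, mul_pow, ← pow_mul, Finset.prod_mul_distrib,
      Finset.prod_pow_eq_pow_sum, map_prod, map_pow]
  rw [MvPolynomial.aeval_monomial, MvPolynomial.aeval_monomial, hprod, ← Algebra.smul_def,
    ← Algebra.smul_def, smul_monomial]

lemma coeff_aeval_monomial (F : MvPolynomial σ R) (d : ℕ) :
    (MvPolynomial.aeval (fun v => monomial (w v) (s v)) F).coeff d =
      MvPolynomial.aeval s (MvPolynomial.weightedHomogeneousComponent w d F) := by
  classical
  rw [MvPolynomial.weightedHomogeneousComponent_apply, map_sum, Finset.sum_filter]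
  conv_lhs => rw [F.as_sum]
  rw [map_sum, finsetSum_coeff]
  refine Finset.sum_congr rfl fun m _ => ?_
  rw [aeval_monomial_weight, coeff_monomial]

lemma aeval_monomial_weightedHomogeneousComponent (F : MvPolynomial σ R) (d : ℕ) :
    MvPolynomial.aeval (fun v => monomial (w v) (s v))
        (MvPolynomial.weightedHomogeneousComponent w d F) =
      monomial d (MvPolynomial.aeval s (MvPolynomial.weightedHomogeneousComponent w d F)) := by
  classical
  rw [MvPolynomial.weightedHomogeneousComponent_apply, map_sum, map_sum, map_sum]
  refine Finset.sum_congr rfl fun m hm => ?_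
  rw [aeval_monomial_weight, (Finset.mem_filter.1 hm).2]

end WeightedGrading

namespace KeyForms

variable {D : GenericPuiseux} (K : KeyForms D.fullSemidegree)

/-- The top coefficient of `π_k` of the monomial with exponent vector `m`. -/
def monomialTopCoeff (k : ℕ) (m : Fin (k + 1) →₀ ℕ) : ℂ[X] :=
  ∏ t : Fin (k + 1), K.topCoeff k t ^ m t

/-- The leading form of `π_k(F)`, graded by the weight: `x ↦ c_0 T ^ ω_0`, `y_j ↦ c_j T ^ ω_j`
where `c_j` is the top coefficient of `f_j`. -/
def topHom (k : ℕ) : A k →ₐ[ℂ] ℂ[X][X] :=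
  MvPolynomial.aeval fun t => monomial (weightA D K k t) (K.topCoeff k t)

lemma topHom_monomial {k : ℕ} (m : Fin (k + 1) →₀ ℕ) (a : ℂ) :
    K.topHom k (MvPolynomial.monomial m a) =
      monomial (Finsupp.weight (weightA D K k) m) (C a * K.monomialTopCoeff k m) := by
  rw [topHom, aeval_monomial_weight, MvPolynomial.aeval_monomial,
    Finsupp.prod_fintype _ _ fun _ => pow_zero _]
  rfl

lemma topHom_weightedHomogeneousComponent {k : ℕ} (F : A k) (d : ℕ) :
    K.topHom k (MvPolynomial.weightedHomogeneousComponent (weightA D K k) d F) =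
      monomial d ((K.topHom k F).coeff d) := by
  rw [topHom, aeval_monomial_weightedHomogeneousComponent, coeff_aeval_monomial]

namespace HasPosWeights

variable {K} {k : ℕ}

lemma monomialTopCoeff_ne_zero (h : K.HasPosWeights k) (m : Fin (k + 1) →₀ ℕ) :
    K.monomialTopCoeff k m ≠ 0 :=
  Finset.prod_ne_zero_iff.2 fun t _ => pow_ne_zero _ (h.topCoeff_ne_zero t.is_le)

lemma natDegree_monomialTopCoeff (h : K.HasPosWeights k) (m : Fin (k + 1) →₀ ℕ) :
    (K.monomialTopCoeff k m).natDegree = m (Fin.last k) := by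
  rw [monomialTopCoeff, natDegree_prod _ _ fun t _ => pow_ne_zero _ (h.topCoeff_ne_zero t.is_le),
    Fintype.sum_eq_single (Fin.last k), natDegree_pow, Fin.val_last, h.natDegree_topCoeff_self,
    mul_one]
  intro t ht
  rw [natDegree_pow, h.natDegree_topCoeff_of_lt (Fin.val_lt_last ht), mul_zero]

lemma hasTop_piA_monomial (h : K.HasPosWeights k) (m : Fin (k + 1) →₀ ℕ) (a : ℂ) :
    HasTop (D.subst k (piA D K k (MvPolynomial.monomial m a)))
      ((Finsupp.weight (weightA D K k) m : ℕ) / D.P k) (C a * K.monomialTopCoeff k m) := by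
  have hweight : ((Finsupp.weight (weightA D K k) m : ℕ) : ℚ) / D.P k =
      ∑ t, m t • ((weight D K k t : ℚ) / D.P k) := by
    rw [Finsupp.weight_eq_sum, Nat.cast_sum, Finset.sum_div]
    refine Finset.sum_congr rfl fun t _ => ?_
    rw [smul_eq_mul, nsmul_eq_mul, Nat.cast_mul, mul_div_assoc, weightA]
  rw [K.piA_monomial, hweight]
  refine D.hasTop_smul a ?_
  simp only [map_prod, map_pow]
  exact HasTop.prod _ fun t _ => (h.hasTop_ess t.is_le).pow (m t)

lemma hasTop_piA (h : K.HasPosWeights k) {F : A k} {d : ℕ}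
    (hF : ∀ m ∈ F.support, Finsupp.weight (weightA D K k) m ≤ d) :
    HasTop (D.subst k (piA D K k F)) ((d : ℚ) / D.P k) ((K.topHom k F).coeff d) := by
  have hterm : ∀ m ∈ F.support,
      HasTop (D.subst k (piA D K k (MvPolynomial.monomial m (F.coeff m)))) ((d : ℚ) / D.P k)
        ((K.topHom k (MvPolynomial.monomial m (F.coeff m))).coeff d) := by
    intro m hm
    have htop := h.hasTop_piA_monomial m (F.coeff m)
    rw [K.topHom_monomial, coeff_monomial]
    rcases (hF m hm).lt_or_eq with hlt | heq
    · rw [if_neg hlt.ne]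
      exact htop.of_lt (div_lt_div_of_pos_right (Nat.cast_lt.2 hlt) (D.P_pos_rat h.le))
    · rwa [if_pos heq, ← heq]
  have hsum := HasTop.sum _ hterm
  rwa [← finsetSum_coeff, ← map_sum, ← map_sum, ← map_sum, ← MvPolynomial.as_sum] at hsum

end HasPosWeights

end KeyForms

/-! ### Standard monomials -/

/-- The exponent vectors of the standard monomials, those not divisible by any `y_t ^ p_t`,
`1 ≤ t < k`. -/
def IsStd (D : GenericPuiseux) (k : ℕ) (m : Fin (k + 1) →₀ ℕ) : Prop :=
  ∀ t : Fin (k + 1), 1 ≤ t.val → t.val < k → m t < D.p t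

namespace KeyForms

variable {D : GenericPuiseux} (K : KeyForms D.fullSemidegree) {k : ℕ}

lemma apply_eq_of_isStd_of_sub_mul_u_mem {m m' : Fin (k + 1) →₀ ℕ} (hk : k ≤ D.l + 1)
    (hm : IsStd D k m) (hm' : IsStd D k m') {t : Fin (k + 1)} (ht : t.val < k)
    (hmem : ((m t : ℚ) - m' t) * K.u (K.idx t) ∈ K.valueGroup (K.idx t)) : m t = m' t := by
  rcases Nat.eq_zero_or_pos t.val with h0 | h1
  · rw [h0, K.idx_zero, K.u_zero, valueGroup] at hmem
    simp only [Set.Iio_zero_eq_empty, Set.image_empty, AddSubgroup.closure_empty,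
      AddSubgroup.mem_bot, mul_one, sub_eq_zero, Nat.cast_inj] at hmem
    exact hmem
  · have hlt := hm t h1 ht
    have hlt' := hm' t h1 ht
    obtain ⟨j, hj⟩ : ∃ j, t.val = j + 1 := ⟨t.val - 1, by lia⟩
    rw [hj] at hmem hlt hlt'
    rw [K.valueGroup_idx (by lia)] at hmem
    have hdvd : (D.p (j + 1) : ℤ) ∣ (m t : ℤ) - m' t :=
      (K.mul_u_idx_mem_fracGroup_iff (by lia) _).1 (by push_cast; exact hmem)
    have := Int.eq_zero_of_abs_lt_dvd hdvd (abs_lt.2 (by lia))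
    lia

namespace HasPosWeights

variable {K}

lemma sub_mul_u_mem_valueGroup (h : K.HasPosWeights k) {m m' : Fin (k + 1) →₀ ℕ}
    (hw : Finsupp.weight (weightA D K k) m = Finsupp.weight (weightA D K k) m') {t : Fin (k + 1)}
    (ht : t.val < k) (hgt : ∀ s, t < s → m s = m' s) :
    ((m t : ℚ) - m' t) * K.u (K.idx t) ∈ K.valueGroup (K.idx t) := by
  have hsum : ∑ s : Fin (k + 1), ((m s : ℚ) - m' s) * ((weight D K k s : ℚ) / D.P k) = 0 := by
    rw [Finsupp.weight_eq_sum, Finsupp.weight_eq_sum, ← Nat.cast_inj (R := ℚ), ← sub_eq_zero] at hw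
    simp only [smul_eq_mul, Nat.cast_sum, Nat.cast_mul, ← Finset.sum_sub_distrib, ← sub_mul,
      weightA] at hw
    simp only [← mul_div_assoc, ← Finset.sum_div, hw, zero_div]
  rw [← Finset.add_sum_erase _ _ (Finset.mem_univ t), add_eq_zero_iff_eq_neg,
    h.weight_div_P ht] at hsum
  rw [hsum]
  refine neg_mem (sum_mem fun s hs => ?_)
  rcases lt_or_gt_of_ne (Finset.ne_of_mem_erase hs) with hst | hst
  · rw [h.weight_div_P (show s.val < k from lt_trans hst ht)]
    have hmem := zsmul_mem (K.u_mem_valueGroup (K.idx_lt_idx (k' := t) hst (ht.le.trans h.le)))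
      ((m s : ℤ) - m' s)
    rw [zsmul_eq_mul] at hmem
    exact_mod_cast hmem
  · rw [hgt s hst, sub_self, zero_mul]
    exact zero_mem _

lemma isStd_eq_of_weight_eq (h : K.HasPosWeights k) {m m' : Fin (k + 1) →₀ ℕ}
    (hm : IsStd D k m) (hm' : IsStd D k m')
    (hw : Finsupp.weight (weightA D K k) m = Finsupp.weight (weightA D K k) m')
    (hlast : m (Fin.last k) = m' (Fin.last k)) : m = m' := by
  by_contra hne
  obtain ⟨t, hne_t, hmax⟩ := (Finsupp.neLocus m m').exists_max_image id
    (Finsupp.nonempty_neLocus_iff.2 hne)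
  rw [Finsupp.mem_neLocus] at hne_t
  have hgt : ∀ s, t < s → m s = m' s := fun s hs => by
    by_contra hne_s
    exact (hmax s (Finsupp.mem_neLocus.2 hne_s)).not_gt hs
  have ht : t.val < k := Fin.val_lt_last fun heq => hne_t (heq ▸ hlast)
  exact hne_t (K.apply_eq_of_isStd_of_sub_mul_u_mem h.le hm hm' ht
    (h.sub_mul_u_mem_valueGroup hw ht hgt))

/-- Distinct standard monomials of the same weight have top coefficients of distinct degrees
in `ξ`, so no cancellation is possible. -/
lemma eq_zero_of_topHom_eq_zero (h : K.HasPosWeights k) {F : A k}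
    (hF : ∀ m ∈ F.support, IsStd D k m) (h0 : K.topHom k F = 0) : F = 0 := by
  by_contra hne
  obtain ⟨m₀, hm₀, hmax⟩ := F.support.exists_max_image (fun m => m (Fin.last k))
    (MvPolynomial.support_nonempty.2 hne)
  have hcoeff : ((K.topHom k F).coeff (Finsupp.weight (weightA D K k) m₀)).coeff
      (m₀ (Fin.last k)) = 0 := by
    rw [h0, coeff_zero, coeff_zero]
  rw [F.as_sum, map_sum, finsetSum_coeff, finsetSum_coeff, Finset.sum_eq_single_of_mem m₀ hm₀,
    K.topHom_monomial, coeff_monomial, if_pos rfl, coeff_C_mul, ← h.natDegree_monomialTopCoeff m₀,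
    coeff_natDegree] at hcoeff
  · exact mul_ne_zero (MvPolynomial.mem_support_iff.1 hm₀)
      (leadingCoeff_ne_zero.2 (h.monomialTopCoeff_ne_zero m₀)) hcoeff
  · intro m hm hm_ne
    rw [K.topHom_monomial, coeff_monomial]
    split_ifs with hw
    · rw [coeff_C_mul, coeff_eq_zero_of_natDegree_lt, mul_zero]
      rw [h.natDegree_monomialTopCoeff]
      exact (hmax m hm).lt_of_ne fun heq =>
        hm_ne (h.isStd_eq_of_weight_eq (hF m hm) (hF m₀ hm₀) hw heq)
    · exact coeff_zero _

end HasPosWeights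

end KeyForms

/-! ### The weights of the terms of the recursion -/

lemma yIdx_val {k j : ℕ} (hj : j ≤ k) : (yIdx k j).val = j := Nat.mod_eq_of_lt (by lia)

namespace KeyForms

variable {D : GenericPuiseux} (K : KeyForms D.fullSemidegree)

lemma idx_mem_steps {j : ℕ} (hj : j ≤ D.l) : K.idx j ∈ K.steps j :=
  (K.mem_steps hj).2 ⟨le_rfl, K.idx_lt_idx_succ hj⟩

lemma lt_idx_of_mem_steps {k j i : ℕ} (hk : k ≤ D.l + 1) (hj : j < k) (hi : i ∈ K.steps j) :
    i < K.idx k := by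
  rw [K.mem_steps (by lia)] at hi
  rcases (show j + 1 ≤ k from hj).lt_or_eq with hlt | rfl
  · exact hi.2.trans (K.idx_lt_idx hlt hk)
  · exact hi.2

lemma expoA_idx_apply {k j : ℕ} (hk : k ≤ D.l + 1) (hj1 : 1 ≤ j) (hj : j < k) {t : Fin (k + 1)}
    (ht : j ≤ t.val) : K.expoA k (K.idx j) t = 0 := by
  rw [K.expoA_apply hk, if_neg (by lia)]
  rcases ht.lt_or_eq with hlt | rfl
  · exact K.digit_eq_zero (K.idx_lt_idx_succ (by lia)) hlt (by lia)
  · rw [digit, if_neg (lt_irrefl _)]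

lemma piA_leadH {k j : ℕ} (hk : k ≤ D.l + 1) (hpoly : ∀ t ≤ k, K.ess t ∈ Set.range incl)
    (hj1 : 1 ≤ j) (hj : j < k) : piA D K k (leadH D K k j) = K.g (K.idx j + 1) := by
  rw [leadH, map_sub, K.essIdx_eq_idx (by lia),
    K.piA_stepMonomial hk hpoly hj1 hj (K.idx_mem_steps (by lia)),
    K.g_succ_eq (K.one_le_idx hj1 (by lia)) (K.idx_le_n (by lia)), K.α_idx hj1 (by lia), map_pow,
    ← K.ess_eq (by lia), piA, MvPolynomial.aeval_X, yIdx_val hj.le]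

namespace HasPosWeights

variable {K} {k : ℕ}

lemma weight_eq (h : K.HasPosWeights k) {t : ℕ} (ht : t < k) :
    (weight D K k t : ℚ) = D.P k * K.u (K.idx t) := by
  rw [← h.weight_div_P ht, mul_div_cancel₀ _ (D.P_pos_rat h.le).ne']

lemma weight_expoA (h : K.HasPosWeights k) (hpoly : ∀ t ≤ k, K.ess t ∈ Set.range incl)
    {j i : ℕ} (hj1 : 1 ≤ j) (hj : j < k) (hi : i ∈ K.steps j) :
    ((Finsupp.weight (weightA D K k) (K.expoA k i) : ℕ) : ℚ) = D.P k * (K.α i * K.u i) := by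
  have htop := h.hasTop_piA_monomial (K.expoA k i) (K.θ i)
  rw [K.piA_stepMonomial h.le hpoly hj1 hj hi] at htop
  have hik := K.lt_idx_of_mem_steps h.le hj hi
  have hin := K.idx_le h.le
  have hi1 : 1 ≤ i := (K.one_le_idx hj1 (hj.le.trans h.le)).trans
    ((K.mem_steps (Nat.lt_succ_iff.1 (hj.trans_le h.le))).1 hi).1
  have hconst : D.ConstTop k (K.stepTerm i) (K.α i * K.u i) :=
    K.constTop_stepTerm hi1 (by lia) fun _ hm => K.constTop_of_lt_idx (hm.trans hik)
  rw [hconst.unique htop (mul_ne_zero (C_ne_zero.2 (K.θ_ne i hi1 (by lia)))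
    (h.monomialTopCoeff_ne_zero _)), mul_div_cancel₀ _ (D.P_pos_rat h.le).ne']

lemma weight_expoA_le (h : K.HasPosWeights k) (hpoly : ∀ t ≤ k, K.ess t ∈ Set.range incl)
    {j i : ℕ} (hj1 : 1 ≤ j) (hj : j < k) (hi : i ∈ K.steps j) :
    Finsupp.weight (weightA D K k) (K.expoA k i) ≤ D.p j * weight D K k j := by
  have hjl := Nat.lt_succ_iff.1 (hj.trans_le h.le)
  have hi' := (K.mem_steps hjl).1 hi
  have hle := mul_le_mul_of_nonneg_left (K.α_mul_u_le hj1 hjl hi'.1 hi'.2) (D.P_pos_rat h.le).le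
  rw [← h.weight_expoA hpoly hj1 hj hi, mul_left_comm, ← h.weight_eq hj] at hle
  exact_mod_cast hle

lemma weight_expoA_idx (h : K.HasPosWeights k) (hpoly : ∀ t ≤ k, K.ess t ∈ Set.range incl)
    {j : ℕ} (hj1 : 1 ≤ j) (hj : j < k) :
    Finsupp.weight (weightA D K k) (K.expoA k (K.idx j)) = D.p j * weight D K k j := by
  have hjl := Nat.lt_succ_iff.1 (hj.trans_le h.le)
  have heq := h.weight_expoA hpoly hj1 hj (K.idx_mem_steps hjl)
  rw [K.α_idx hj1 hjl, mul_left_comm, ← h.weight_eq hj] at heq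
  exact_mod_cast heq

lemma weight_expoA_lt (h : K.HasPosWeights k) (hpoly : ∀ t ≤ k, K.ess t ∈ Set.range incl)
    {j i : ℕ} (hj1 : 1 ≤ j) (hj : j < k) (hi : i ∈ K.steps j) (hne : i ≠ K.idx j) :
    Finsupp.weight (weightA D K k) (K.expoA k i) < D.p j * weight D K k j := by
  have hjl := Nat.lt_succ_iff.1 (hj.trans_le h.le)
  have hi' := (K.mem_steps hjl).1 hi
  have hlt := mul_lt_mul_of_pos_left
    (K.α_mul_u_strictAnti hj1 hjl le_rfl (hi'.1.lt_of_ne hne.symm) hi'.2) (D.P_pos_rat h.le)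
  rw [← h.weight_expoA hpoly hj1 hj hi, ← h.weight_expoA hpoly hj1 hj (K.idx_mem_steps hjl),
    Nat.cast_lt, h.weight_expoA_idx hpoly hj1 hj] at hlt
  exact hlt

lemma weight_succ_lt (h : K.HasPosWeights k) {j : ℕ} (hj1 : 1 ≤ j) (hj : j < k) :
    weight D K k (j + 1) < D.p j * weight D K k j := by
  obtain ⟨k, rfl⟩ := Nat.exists_eq_add_of_le' h.one_le
  have hkl : k ≤ D.l := Nat.succ_le_succ_iff.1 h.le
  have hidx := K.idx_lt_idx_succ (show j ≤ D.l by lia)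
  have hj_idx := K.one_le_idx hj1 (show j ≤ D.l + 1 by lia)
  obtain ⟨i, hi⟩ := Nat.exists_eq_add_of_le' (hj_idx.trans hidx.le)
  have hik : i < K.idx (k + 1) := K.lt_idx_of_mem_steps h.le hj <|
    (K.mem_steps (by lia)).2 (by lia)
  have htop := K.hasTop_g_succ hkl (by lia) hik
  rw [← hi, ← K.ess_eq (by lia)] at htop
  have hlt := (D.semidegree_lt_iff_of_hasTop h.le htop).2 rfl
  rw [h.semidegree_ess hj, WithBot.coe_lt_coe] at hlt
  have hle := mul_le_mul_of_nonneg_left (K.α_mul_u_le (i := i) hj1 (by lia) (by lia) (by lia))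
    (D.P_pos_rat h.le).le
  rw [mul_left_comm _ (D.p j : ℚ), ← h.weight_eq hj] at hle
  exact_mod_cast hlt.trans_le hle

/-! ### The forms `H_{j+1}` -/

lemma isWeightedHomogeneous_leadH (h : K.HasPosWeights k)
    (hpoly : ∀ t ≤ k, K.ess t ∈ Set.range incl) {j : ℕ} (hj1 : 1 ≤ j) (hj : j < k) :
    MvPolynomial.IsWeightedHomogeneous (weightA D K k) (leadH D K k j)
      (D.p j * weight D K k j) := by
  refine MvPolynomial.IsWeightedHomogeneous.sub ?_ ?_
  · have hX := (MvPolynomial.isWeightedHomogeneous_X ℂ (weightA D K k) (yIdx k j)).pow (D.p j)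
    rwa [smul_eq_mul, weightA, yIdx_val hj.le] at hX
  · refine MvPolynomial.isWeightedHomogeneous_monomial _ _ _ ?_
    rw [K.essIdx_eq_idx (hj.le.trans h.le), h.weight_expoA_idx hpoly hj1 hj]

lemma semidegree_piA_leadH_lt (h : K.HasPosWeights k) (hpoly : ∀ t ≤ k, K.ess t ∈ Set.range incl)
    {j : ℕ} (hj1 : 1 ≤ j) (hj : j < k) :
    D.semidegree k (piA D K k (leadH D K k j)) <
      (((D.p j * weight D K k j : ℕ) : ℚ) : WithBot ℚ) := by
  obtain ⟨k, rfl⟩ := Nat.exists_eq_add_of_le' h.one_le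
  have hkl : k ≤ D.l := Nat.succ_le_succ_iff.1 h.le
  have htop := K.hasTop_g_succ hkl (K.one_le_idx hj1 (by lia)) (K.idx_lt_idx hj h.le)
  have hlt := (D.semidegree_lt_iff_of_hasTop h.le htop).2 rfl
  rwa [K.α_idx hj1 (by lia), mul_left_comm, ← h.weight_eq hj, ← Nat.cast_mul,
    ← K.piA_leadH h.le hpoly hj1 hj] at hlt

lemma toSyn_expoA_lt (h : K.HasPosWeights k) (hpoly : ∀ t ≤ k, K.ess t ∈ Set.range incl)
    {j i : ℕ} (hj1 : 1 ≤ j) (hj : j < k) (hi : i ∈ K.steps j) :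
    (weightOrder (weightA D K k)).toSyn (K.expoA k i) <
      (weightOrder (weightA D K k)).toSyn (Finsupp.single (yIdx k j) (D.p j)) := by
  have hw : Finsupp.weight (weightA D K k) (Finsupp.single (yIdx k j) (D.p j)) =
      D.p j * weight D K k j := by
    rw [Finsupp.weight_single, smul_eq_mul, weightA, yIdx_val hj.le]
  rw [weightOrder_lt_iff, hw]
  by_cases hne : i = K.idx j
  · subst hne
    refine .inr ⟨h.weight_expoA_idx hpoly hj1 hj, yIdx k j, fun t ht => ?_, ?_⟩
    · rw [Finsupp.single_eq_of_ne ht.ne', K.expoA_idx_apply h.le hj1 hj]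
      rw [← Fin.val_fin_lt, yIdx_val hj.le] at ht
      exact ht.le
    · rw [K.expoA_idx_apply h.le hj1 hj (yIdx_val hj.le).ge, Finsupp.single_eq_same]
      exact D.p_pos hj1 (hj.le.trans h.le)
  · exact .inl (h.weight_expoA_lt hpoly hj1 hj hi hne)

end HasPosWeights

end KeyForms

/-! ### Gröbner bases -/

section MonomialOrder

variable {σ R : Type*} [CommRing R] (mo : MonomialOrder σ)

section Binomial

variable [Nontrivial R] {a b : σ →₀ ℕ} (c : R)

lemma toSyn_degree_monomial_lt (h : mo.toSyn b < mo.toSyn a) :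
    mo.toSyn (mo.degree (MvPolynomial.monomial b c)) <
      mo.toSyn (mo.degree (MvPolynomial.monomial a (1 : R))) := by
  classical
  rw [MonomialOrder.degree_monomial (1 : R), if_neg one_ne_zero]
  exact (MonomialOrder.degree_monomial_le c).trans_lt h

lemma degree_monomial_sub_monomial (h : mo.toSyn b < mo.toSyn a) :
    mo.degree (MvPolynomial.monomial a 1 - MvPolynomial.monomial b c) = a := by
  classical
  rw [MonomialOrder.degree_sub_of_lt (toSyn_degree_monomial_lt mo c h),
    MonomialOrder.degree_monomial, if_neg one_ne_zero]

lemma leadingCoeff_monomial_sub_monomial (h : mo.toSyn b < mo.toSyn a) :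
    mo.leadingCoeff (MvPolynomial.monomial a 1 - MvPolynomial.monomial b c) = 1 := by
  rw [MonomialOrder.leadingCoeff_sub_of_lt (toSyn_degree_monomial_lt mo c h),
    MonomialOrder.leadingCoeff_monomial]

end Binomial

lemma exists_degree_le_of_eq_linearCombination {B : Set (MvPolynomial σ R)}
    (hB : ∀ b ∈ B, IsUnit (mo.leadingCoeff b)) {f : MvPolynomial σ R} (hf : f ≠ 0)
    (g : B →₀ MvPolynomial σ R)
    (hfg : f = Finsupp.linearCombination _ (fun b : B => (b : MvPolynomial σ R)) g)
    (hdeg : ∀ b : B, mo.toSyn (mo.degree ((b : MvPolynomial σ R) * g b)) ≤ mo.toSyn (mo.degree f)) :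
    ∃ b ∈ B, mo.degree b ≤ mo.degree f := by
  have hsum : mo.leadingCoeff f =
      ∑ b ∈ g.support, (g b * (b : MvPolynomial σ R)).coeff (mo.degree f) := by
    rw [← MvPolynomial.coeff_sum]
    exact congrArg (MvPolynomial.coeff (mo.degree f)) hfg
  obtain ⟨b, -, hb⟩ := Finset.exists_ne_zero_of_sum_ne_zero
    (hsum ▸ MonomialOrder.leadingCoeff_ne_zero_iff.2 hf)
  rw [mul_comm] at hb
  have hb_deg : mo.degree ((b : MvPolynomial σ R) * g b) = mo.degree f :=
    mo.toSyn.injective <|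
      (hdeg b).antisymm (MonomialOrder.le_degree (MvPolynomial.mem_support_iff.2 hb))
  have hgb : g b ≠ 0 := fun h0 => hb (by rw [h0, mul_zero, MvPolynomial.coeff_zero])
  refine ⟨b, b.2, ?_⟩
  rw [← hb_deg, MonomialOrder.degree_mul_of_isRegular_left (hB b b.2).isRegular hgb]
  exact le_self_add

lemma leadingTerm_mem_span_of_degree_le {B : Set (MvPolynomial σ R)} {b f : MvPolynomial σ R}
    (hb : b ∈ B) (hunit : IsUnit (mo.leadingCoeff b)) (hle : mo.degree b ≤ mo.degree f) :
    mo.leadingTerm f ∈ Ideal.span (mo.leadingTerm '' B) := by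
  obtain ⟨u, hu⟩ := hunit.exists_left_inv
  have hfac : mo.leadingTerm f =
      MvPolynomial.monomial (mo.degree f - mo.degree b) (mo.leadingCoeff f * u) *
        mo.leadingTerm b := by
    rw [MonomialOrder.leadingTerm, MonomialOrder.leadingTerm, MvPolynomial.monomial_mul,
      tsub_add_cancel_of_le hle, mul_assoc, hu, mul_one]
  rw [hfac]
  exact Ideal.mul_mem_left _ _ (Ideal.subset_span ⟨b, hb, rfl⟩)

end MonomialOrder

lemma isGroebnerBasis_of_reduced_eq_zero {σ : Type} (mo : MonomialOrder σ)
    {G : Set (MvPolynomial σ ℂ)} {I : Ideal (MvPolynomial σ ℂ)} (hfin : G.Finite) (hGI : G ⊆ I)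
    (hunit : ∀ b ∈ G, IsUnit (mo.leadingCoeff b))
    (hred : ∀ r ∈ I, (∀ m ∈ r.support, ∀ b ∈ G, ¬ mo.degree b ≤ m) → r = 0) :
    IsGroebnerBasis mo G I := by
  refine ⟨hfin, hGI, (Ideal.span_mono (Set.image_mono hGI)).antisymm (Ideal.span_le.2 ?_)⟩
  rintro _ ⟨f, hf, rfl⟩
  rcases eq_or_ne f 0 with rfl | hf0
  · rw [MonomialOrder.leadingTerm_zero]
    exact zero_mem _
  obtain ⟨g, r, hfr, hdeg, hr⟩ := MonomialOrder.div_set hunit f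
  have hcomb : Finsupp.linearCombination _ (fun b : G => (b : MvPolynomial σ ℂ)) g ∈ I :=
    sum_mem fun b _ => I.mul_mem_left _ (hGI b.2)
  have hr0 : r = 0 := hred r ((I.add_mem_iff_right hcomb).1 (hfr ▸ hf)) hr
  rw [hr0, add_zero] at hfr
  obtain ⟨b, hb, hle⟩ := exists_degree_le_of_eq_linearCombination mo hunit hf0 g hfr hdeg
  exact leadingTerm_mem_span_of_degree_le mo hb (hunit b hb) hle

namespace KeyForms.HasPosWeights

variable {D : GenericPuiseux} {K : KeyForms D.fullSemidegree} {k : ℕ}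

lemma idealJ_le_ker_topHom (h : K.HasPosWeights k) : idealJ D K k ≤ RingHom.ker (K.topHom k) := by
  rw [idealJ, Ideal.span_le]
  rintro _ ⟨F, hF, rfl⟩
  have htop := h.hasTop_piA fun m hm =>
    MvPolynomial.le_weightedTotalDegree (weightA D K k) (φ := F) hm
  rw [SetLike.mem_coe, RingHom.mem_ker, K.topHom_weightedHomogeneousComponent,
    (D.semidegree_lt_iff_of_hasTop h.le htop).1, monomial_zero_right]
  rwa [mul_div_cancel₀ _ (D.P_pos_rat h.le).ne']

lemma leadH_eq (h : K.HasPosWeights k) {j : ℕ} (hj : j < k) :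
    leadH D K k j = MvPolynomial.monomial (Finsupp.single (yIdx k j) (D.p j)) 1 -
      MvPolynomial.monomial (K.expoA k (K.idx j)) (K.θ (K.idx j)) := by
  rw [leadH, K.essIdx_eq_idx (hj.le.trans h.le), MvPolynomial.X_pow_eq_monomial]

lemma degree_leadH (h : K.HasPosWeights k) (hpoly : ∀ t ≤ k, K.ess t ∈ Set.range incl) {j : ℕ}
    (hj1 : 1 ≤ j) (hj : j < k) :
    (weightOrder (weightA D K k)).degree (leadH D K k j) =
      Finsupp.single (yIdx k j) (D.p j) := by
  rw [h.leadH_eq hj]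
  exact degree_monomial_sub_monomial _ _
    (h.toSyn_expoA_lt hpoly hj1 hj (K.idx_mem_steps (by have := h.le; lia)))

lemma leadingCoeff_leadH (h : K.HasPosWeights k) (hpoly : ∀ t ≤ k, K.ess t ∈ Set.range incl)
    {j : ℕ} (hj1 : 1 ≤ j) (hj : j < k) :
    (weightOrder (weightA D K k)).leadingCoeff (leadH D K k j) = 1 := by
  rw [h.leadH_eq hj]
  exact leadingCoeff_monomial_sub_monomial _ _
    (h.toSyn_expoA_lt hpoly hj1 hj (K.idx_mem_steps (by have := h.le; lia)))

lemma leadH_mem_idealJ (h : K.HasPosWeights k) (hpoly : ∀ t ≤ k, K.ess t ∈ Set.range incl)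
    {j : ℕ} (hj1 : 1 ≤ j) (hj : j < k) : leadH D K k j ∈ idealJ D K k := by
  have hne : leadH D K k j ≠ 0 := by
    rw [← MonomialOrder.leadingCoeff_ne_zero_iff, h.leadingCoeff_leadH hpoly hj1 hj]
    exact one_ne_zero
  have hhom := h.isWeightedHomogeneous_leadH hpoly hj1 hj
  have hdeg : MvPolynomial.weightedTotalDegree (weightA D K k) (leadH D K k j) =
      D.p j * weight D K k j := by
    rw [← WithBot.coe_inj, ← MvPolynomial.weightedTotalDegree_coe _ _ hne]
    exact hhom.weighted_total_degree hne
  refine Ideal.subset_span ⟨leadH D K k j, ?_, ?_⟩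
  · rw [hdeg]
    exact h.semidegree_piA_leadH_lt hpoly hj1 hj
  · rw [hdeg, hhom.weightedHomogeneousComponent_same]

theorem isGroebnerBasis_idealJ (h : K.HasPosWeights k)
    (hpoly : ∀ t ≤ k, K.ess t ∈ Set.range incl) :
    IsGroebnerBasis (weightOrder (weightA D K k))
      {H | ∃ j, 1 ≤ j ∧ j < k ∧ H = leadH D K k j} (idealJ D K k) := by
  refine isGroebnerBasis_of_reduced_eq_zero _ ?_ ?_ ?_ fun r hr hred => ?_
  · refine ((Set.finite_Iio k).image (leadH D K k)).subset ?_
    rintro _ ⟨j, -, hj, rfl⟩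
    exact ⟨j, hj, rfl⟩
  · rintro _ ⟨j, hj1, hj, rfl⟩
    exact h.leadH_mem_idealJ hpoly hj1 hj
  · rintro _ ⟨j, hj1, hj, rfl⟩
    rw [h.leadingCoeff_leadH hpoly hj1 hj]
    exact isUnit_one
  · refine h.eq_zero_of_topHom_eq_zero (fun m hm t ht1 ht => ?_) (h.idealJ_le_ker_topHom hr)
    by_contra! hle
    refine hred m hm _ ⟨t, ht1, ht, rfl⟩ ?_
    rwa [h.degree_leadH hpoly ht1 ht, Finsupp.single_le_iff,
      show yIdx k t = t from Fin.ext (yIdx_val ht.le)]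

end KeyForms.HasPosWeights

/-! ### The semidegree of a standard polynomial -/

namespace KeyForms.HasPosWeights

variable {D : GenericPuiseux} {K : KeyForms D.fullSemidegree} {k : ℕ} {F : A k}

lemma coeff_topHom_weightedTotalDegree_ne_zero (h : K.HasPosWeights k)
    (hF : ∀ m ∈ F.support, IsStd D k m) (hne : F ≠ 0) :
    (K.topHom k F).coeff (MvPolynomial.weightedTotalDegree (weightA D K k) F) ≠ 0 := by
  classical
  intro hcoeff
  have hcomp : MvPolynomial.weightedHomogeneousComponent (weightA D K k)
      (MvPolynomial.weightedTotalDegree (weightA D K k) F) F = 0 := by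
    refine h.eq_zero_of_topHom_eq_zero (fun m hm => hF m ?_) ?_
    · rw [MvPolynomial.support_weightedHomogeneousComponent] at hm
      exact (Finset.mem_filter.1 hm).1
    · rw [K.topHom_weightedHomogeneousComponent, hcoeff, monomial_zero_right]
  obtain ⟨m, hm, hweight⟩ := Finset.exists_mem_eq_sup F.support
    (MvPolynomial.support_nonempty.2 hne) (Finsupp.weight (weightA D K k))
  have hzero := congrArg (MvPolynomial.coeff m) hcomp
  rw [MvPolynomial.coeff_weightedHomogeneousComponent, MvPolynomial.weightedTotalDegree,
    if_pos hweight.symm] at hzero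
  exact MvPolynomial.mem_support_iff.1 hm hzero

lemma semidegree_piA (h : K.HasPosWeights k) (hF : ∀ m ∈ F.support, IsStd D k m) (hne : F ≠ 0) :
    D.semidegree k (piA D K k F) =
      (((MvPolynomial.weightedTotalDegree (weightA D K k) F : ℕ) : ℚ) : WithBot ℚ) := by
  rw [D.semidegree_eq_of_hasTop
    (h.hasTop_piA fun m hm => MvPolynomial.le_weightedTotalDegree (weightA D K k) hm)
    (h.coeff_topHom_weightedTotalDegree_ne_zero hF hne), mul_div_cancel₀ _ (D.P_pos_rat h.le).ne']

lemma eq_zero_of_piA_eq_zero (h : K.HasPosWeights k) (hF : ∀ m ∈ F.support, IsStd D k m)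
    (h0 : piA D K k F = 0) : F = 0 := by
  by_contra hne
  have hdeg := h.semidegree_piA hF hne
  rw [h0] at hdeg
  simp [GenericPuiseux.semidegree, degX] at hdeg

lemma weight_le_of_semidegree_le (h : K.HasPosWeights k) (hF : ∀ m ∈ F.support, IsStd D k m)
    {d : ℕ} (hd : D.semidegree k (piA D K k F) ≤ ((d : ℚ) : WithBot ℚ)) {m : Fin (k + 1) →₀ ℕ}
    (hm : m ∈ F.support) : Finsupp.weight (weightA D K k) m ≤ d := by
  have hne : F ≠ 0 := MvPolynomial.support_nonempty.1 ⟨m, hm⟩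
  rw [h.semidegree_piA hF hne, WithBot.coe_le_coe, Nat.cast_le] at hd
  exact (MvPolynomial.le_weightedTotalDegree _ hm).trans hd

end KeyForms.HasPosWeights

/-! ### Homogenization -/

section Homogenization

variable {σ R : Type*} [CommSemiring R]

/-- The monomial `c x ^ m z ^ a`, where the variables `x` are indexed by `σ` and `z` is the
variable `none`. -/
def zMonomial (m : σ →₀ ℕ) (a : ℕ) (c : R) : MvPolynomial (Option σ) R :=
  MvPolynomial.monomial (m.optionElim a) c

lemma monomial_eq_zMonomial (n : Option σ →₀ ℕ) (c : R) :
    MvPolynomial.monomial n c = zMonomial n.some (n none) c := by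
  rw [zMonomial, Finsupp.optionElim_some]

lemma zMonomial_mul (m m' : σ →₀ ℕ) (a a' : ℕ) (c c' : R) :
    zMonomial m a c * zMonomial m' a' c' = zMonomial (m + m') (a + a') (c * c') := by
  have hadd : m.optionElim a + m'.optionElim a' = (m + m').optionElim (a + a') := by
    ext (_ | t) <;> simp [Finsupp.optionElim_apply_eq_elim]
  rw [zMonomial, zMonomial, MvPolynomial.monomial_mul, hadd, zMonomial]

lemma rename_monomial_mul_X_pow (m : σ →₀ ℕ) (a : ℕ) (c : R) :
    MvPolynomial.rename some (MvPolynomial.monomial m c) * MvPolynomial.X none ^ a =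
      zMonomial m a c := by
  have hadd : Finsupp.mapDomain some m + Finsupp.single none a = m.optionElim a := by
    ext (_ | t)
    · simp [Finsupp.mapDomain_of_notMem_range, Finsupp.optionElim_apply_eq_elim]
    · simp [Finsupp.mapDomain_apply (Option.some_injective σ), Finsupp.optionElim_apply_eq_elim]
  rw [MvPolynomial.rename_monomial, MvPolynomial.X_pow_eq_monomial, MvPolynomial.monomial_mul,
    mul_one, hadd, zMonomial]

lemma X_some_pow_eq_zMonomial (t : σ) (a : ℕ) :
    (MvPolynomial.X (some t) ^ a : MvPolynomial (Option σ) R) =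
      zMonomial (Finsupp.single t a) 0 1 := by
  rw [← rename_monomial_mul_X_pow, pow_zero, mul_one, ← MvPolynomial.X_pow_eq_monomial, map_pow,
    MvPolynomial.rename_X]

/-- The specialization `z = 1`. -/
def dehom : MvPolynomial (Option σ) R →ₐ[R] MvPolynomial σ R :=
  MvPolynomial.aeval fun v => v.elim 1 MvPolynomial.X

lemma dehom_rename_some (F : MvPolynomial σ R) : dehom (MvPolynomial.rename some F) = F := by
  rw [dehom, MvPolynomial.aeval_rename]
  exact MvPolynomial.aeval_X_left_apply F

lemma dehom_zMonomial (m : σ →₀ ℕ) (a : ℕ) (c : R) :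
    dehom (zMonomial m a c) = MvPolynomial.monomial m c := by
  rw [← rename_monomial_mul_X_pow, map_mul, map_pow, dehom_rename_some, dehom,
    MvPolynomial.aeval_X, Option.elim_none, one_pow, mul_one]

lemma dehom_monomial (n : Option σ →₀ ℕ) (c : R) :
    dehom (MvPolynomial.monomial n c) = MvPolynomial.monomial n.some c := by
  rw [monomial_eq_zMonomial, dehom_zMonomial]

lemma exists_of_mem_support_dehom {F : MvPolynomial (Option σ) R} {m : σ →₀ ℕ}
    (hm : m ∈ (dehom F).support) : ∃ n ∈ F.support, n.some = m := by
  classical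
  rw [F.as_sum, map_sum] at hm
  obtain ⟨n, hn, hmn⟩ := Finset.mem_biUnion.1 (MvPolynomial.support_sum hm)
  rw [dehom_monomial] at hmn
  exact ⟨n, hn, (Finset.mem_singleton.1 (MvPolynomial.support_monomial_subset hmn)).symm⟩

lemma isWeightedHomogeneous_zMonomial {w : Option σ → ℕ} (hw : w none = 1) (m : σ →₀ ℕ) (c : R)
    {a d : ℕ} (hd : a + Finsupp.weight (fun t => w (some t)) m = d) :
    MvPolynomial.IsWeightedHomogeneous w (zMonomial m a c) d := by
  refine MvPolynomial.isWeightedHomogeneous_monomial _ _ _ (Eq.trans ?_ hd)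
  rw [Finsupp.weight_apply, Finsupp.sum_option_index_smul, Finsupp.some_optionElim,
    Finsupp.weight_apply, Finsupp.optionElim_apply_none, hw, smul_eq_mul, mul_one]

lemma exists_isWeightedHomogeneous_dehom_eq {w : Option σ → ℕ} (hw : w none = 1)
    {F : MvPolynomial σ R} {d : ℕ}
    (hF : ∀ m ∈ F.support, Finsupp.weight (fun t => w (some t)) m ≤ d) :
    ∃ G, MvPolynomial.IsWeightedHomogeneous w G d ∧ dehom G = F := by
  refine ⟨∑ m ∈ F.support, zMonomial m (d - Finsupp.weight (fun t => w (some t)) m) (F.coeff m),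
    .sum _ _ _ fun m hm =>
      isWeightedHomogeneous_zMonomial hw _ _ (Nat.sub_add_cancel (hF m hm)), ?_⟩
  rw [map_sum, Finset.sum_congr rfl fun m _ => dehom_zMonomial _ _ _, ← MvPolynomial.as_sum]

lemma eq_zero_of_dehom_eq_zero {w : Option σ → ℕ} (hw : w none = 1)
    {F : MvPolynomial (Option σ) R} {d : ℕ} (hF : MvPolynomial.IsWeightedHomogeneous w F d)
    (h0 : dehom F = 0) : F = 0 := by
  classical
  by_contra hne
  obtain ⟨n, hn⟩ := MvPolynomial.ne_zero_iff.1 hne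
  have hweight : ∀ n', F.coeff n' ≠ 0 →
      n' none + Finsupp.weight (fun t => w (some t)) n'.some = d := fun n' hn' => by
    rw [← hF hn', Finsupp.weight_apply, Finsupp.weight_apply, Finsupp.sum_option_index_smul, hw,
      smul_eq_mul, mul_one]
  have hcoeff : (dehom F).coeff n.some = F.coeff n := by
    conv_lhs => rw [F.as_sum]
    rw [map_sum, MvPolynomial.coeff_sum,
      Finset.sum_eq_single_of_mem n (MvPolynomial.mem_support_iff.2 hn), dehom_monomial,
      MvPolynomial.coeff_monomial, if_pos rfl]
    intro n' hn' hne'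
    rw [dehom_monomial, MvPolynomial.coeff_monomial, if_neg]
    refine fun hsome => hne' ?_
    have hnone := (hweight n' (MvPolynomial.mem_support_iff.1 hn')).trans (hweight n hn).symm
    rw [hsome, add_left_inj] at hnone
    rw [← Finsupp.optionElim_some n', hsome, hnone, Finsupp.optionElim_some]
  rw [← hcoeff, h0] at hn
  exact hn (MvPolynomial.coeff_zero _)

end Homogenization

lemma piAz_eq (D : GenericPuiseux) (K : KeyForms D.fullSemidegree) (k : ℕ) (F : Az k) :
    piAz D K k F = piA D K k (dehom F) := by
  have hcomp : piAz D K k = (piA D K k).comp dehom := by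
    ext (_ | t) : 1 <;> simp [piAz, piA, dehom]
  rw [hcomp, AlgHom.comp_apply]

/-! ### The graded homomorphism -/

section Rees

variable {R B : Type*} [CommSemiring R] [CommSemiring B] [Algebra R B] (𝒜 : ℕ → Submodule R B)
  [SetLike.GradedMonoid 𝒜]

/-- The Rees algebra map `⨁ 𝒜 d → B[T]`, which sends `a ∈ 𝒜 d` to `a T ^ d`. -/
def reesHom : (DirectSum ℕ fun d => 𝒜 d) →ₐ[R] B[X] :=
  DirectSum.toAlgebra R (fun d => 𝒜 d)
    (fun d => ((monomial d).restrictScalars R).comp (𝒜 d).subtype)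
    (by rw [LinearMap.comp_apply]; exact monomial_zero_one)
    (fun a b => by
      simp only [LinearMap.comp_apply]
      exact (monomial_mul_monomial _ _ (a : B) (b : B)).symm)

lemma reesHom_of (d : ℕ) (a : 𝒜 d) :
    reesHom 𝒜 (DirectSum.of (fun d => 𝒜 d) d a) = monomial d (a : B) := by
  rw [reesHom, DirectSum.toAlgebra_apply]
  exact DirectSum.toSemiring_of (A := fun d => 𝒜 d)
    (fun d => (((monomial d).restrictScalars R).comp (𝒜 d).subtype).toAddMonoidHom) _ _ d a

lemma coeff_reesHom (y : DirectSum ℕ fun d => 𝒜 d) (d : ℕ) :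
    (reesHom 𝒜 y).coeff d = (y d : B) := by
  induction y using DirectSum.induction_on with
  | zero => simp
  | of e a =>
    rw [reesHom_of, coeff_monomial]
    split_ifs with hed
    · rw [← hed, DirectSum.of_eq_same]
    · rw [DirectSum.of_eq_of_ne _ _ _ (Ne.symm hed), ZeroMemClass.coe_zero]
  | add y y' hy hy' => rw [map_add, coeff_add, hy, hy', DirectSum.add_apply, Submodule.coe_add]

lemma coe_aeval_of_apply {σ : Type*} {w : σ → ℕ} (s : ∀ v, 𝒜 (w v)) (F : MvPolynomial σ R)
    (d : ℕ) :
    ((MvPolynomial.aeval (fun v => DirectSum.of (fun d => 𝒜 d) (w v) (s v)) F d : 𝒜 d) : B) =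
      MvPolynomial.aeval (fun v => (s v : B))
        (MvPolynomial.weightedHomogeneousComponent w d F) := by
  rw [← coeff_reesHom, ← coeff_aeval_monomial, ← AlgHom.comp_apply, MvPolynomial.comp_aeval]
  simp only [reesHom_of]

end Rees

namespace KeyForms.HasPosWeights

variable {D : GenericPuiseux} {K : KeyForms D.fullSemidegree} {k : ℕ}

lemma exists_filtration_incl_eq_piAz_X (h : K.HasPosWeights k)
    (hpoly : ∀ j ≤ k, K.ess j ∈ Set.range incl) (v : Option (Fin (k + 1))) :
    ∃ f : D.filtration k (weightAz D K k v), incl f = piAz D K k (MvPolynomial.X v) := by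
  rw [piAz, MvPolynomial.aeval_X]
  match v with
  | none =>
    refine ⟨⟨1, ?_⟩, map_one incl⟩
    have hle := (D.semidegree_algebraMap_le k 1).trans (WithBot.coe_le_coe.2 zero_le_one)
    rw [map_one] at hle
    exact_mod_cast hle
  | some t =>
    obtain ⟨f, hf⟩ := hpoly t t.is_le
    exact ⟨⟨f, (congrArg _ hf).trans (h.semidegree_ess t.is_le) |>.le⟩, hf⟩

/-- The homomorphism `ℂ[x, y_1, …, y_k, z] → ℂ[x, y]^δ_k` given by `z ↦ (1)_1`, `x ↦ (x)_{ω_0}`,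
`y_j ↦ (f_j)_{ω_j}`. -/
def gradedHom (h : K.HasPosWeights k) (hpoly : ∀ j ≤ k, K.ess j ∈ Set.range incl) :
    Az k →ₐ[ℂ] D.gradedRing k :=
  MvPolynomial.aeval fun v =>
    DirectSum.of (fun d => D.filtration k d) _ (h.exists_filtration_incl_eq_piAz_X hpoly v).choose

lemma incl_gradedHom_apply (h : K.HasPosWeights k) (hpoly : ∀ j ≤ k, K.ess j ∈ Set.range incl)
    (F : Az k) (d : ℕ) :
    incl (h.gradedHom hpoly F d) =
      piAz D K k (MvPolynomial.weightedHomogeneousComponent (weightAz D K k) d F) := by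
  rw [gradedHom, coe_aeval_of_apply, ← AlgHom.comp_apply]
  congr 1
  ext v : 1
  rw [AlgHom.comp_apply, MvPolynomial.aeval_X]
  exact (h.exists_filtration_incl_eq_piAz_X hpoly v).choose_spec

lemma gradedHom_eq_of (h : K.HasPosWeights k) (hpoly : ∀ j ≤ k, K.ess j ∈ Set.range incl)
    {F : Az k} {d : ℕ} (hF : MvPolynomial.IsWeightedHomogeneous (weightAz D K k) F d)
    {f : D.filtration k d} (hf : incl f = piAz D K k F) :
    h.gradedHom hpoly F = DirectSum.of (fun d => D.filtration k d) d f := by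
  refine DFinsupp.ext fun e => Subtype.ext (incl_injective ?_)
  rw [h.incl_gradedHom_apply hpoly]
  rcases eq_or_ne e d with rfl | hne
  · rw [hF.weightedHomogeneousComponent_same, DirectSum.of_eq_same, hf]
  · rw [hF.weightedHomogeneousComponent_ne _ hne, DirectSum.of_eq_of_ne _ _ _ hne, map_zero]
    exact (map_zero incl).symm

end KeyForms.HasPosWeights

/-! ### The relations -/

section Relations

variable {D : GenericPuiseux} {K : KeyForms D.fullSemidegree} {k : ℕ}

lemma relGen_eq (j : ℕ) :
    relGen D K k j = zMonomial (Finsupp.single (yIdx k (j + 1)) 1)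
        (D.p j * weight D K k j - weight D K k (j + 1)) 1 -
      (zMonomial (Finsupp.single (yIdx k j) (D.p j)) 0 1 -
        ∑ i ∈ K.steps j, zMonomial (K.expoA k i)
          (D.p j * weight D K k j - Finsupp.weight (weightA D K k) (K.expoA k i)) (K.θ i)) := by
  simp only [← rename_monomial_mul_X_pow _ (_ - _), ← X_some_pow_eq_zMonomial]
  rw [← MvPolynomial.X, MvPolynomial.rename_X]
  rfl

lemma zMonomial_eq_sub_relGen (m : Fin (k + 1) →₀ ℕ) (a : ℕ) (c : ℂ) (j : ℕ) :
    zMonomial (m + Finsupp.single (yIdx k j) (D.p j)) a c =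
      zMonomial m a c * zMonomial (Finsupp.single (yIdx k (j + 1)) 1)
          (D.p j * weight D K k j - weight D K k (j + 1)) 1 +
        ∑ i ∈ K.steps j, zMonomial m a c * zMonomial (K.expoA k i)
          (D.p j * weight D K k j - Finsupp.weight (weightA D K k) (K.expoA k i)) (K.θ i) -
        zMonomial m a c * relGen D K k j := by
  have hmul : zMonomial (m + Finsupp.single (yIdx k j) (D.p j)) a c =
      zMonomial m a c * zMonomial (Finsupp.single (yIdx k j) (D.p j)) 0 1 := by
    rw [zMonomial_mul, add_zero, mul_one]
  rw [hmul, relGen_eq, ← Finset.mul_sum]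
  ring

lemma piAz_relGen (hk : k ≤ D.l + 1) (hpoly : ∀ j ≤ k, K.ess j ∈ Set.range incl)
    {j : ℕ} (hj1 : 1 ≤ j) (hj : j < k) : piAz D K k (relGen D K k j) = 0 := by
  have hsingle : ∀ t a, t ≤ k →
      piA D K k (MvPolynomial.monomial (Finsupp.single (yIdx k t) a) 1) = K.ess t ^ a := by
    intro t a ht
    rw [← MvPolynomial.X_pow_eq_monomial, map_pow, piA, MvPolynomial.aeval_X, yIdx_val ht]
  rw [piAz_eq, relGen_eq]
  simp only [map_sub, map_sum, dehom_zMonomial]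
  rw [hsingle _ _ hj.le, hsingle _ _ hj, pow_one, K.ess_succ hj1 (by lia),
    Finset.sum_congr rfl fun i hi => K.piA_stepMonomial hk hpoly hj1 hj hi, sub_self]

lemma relGen_mem_idealJz {j : ℕ} (hj1 : 1 ≤ j) (hj : j < k) :
    relGen D K k j ∈ idealJz D K k :=
  Ideal.subset_span ⟨⟨j - 1, by lia⟩, by rw [relFamily, Nat.sub_add_cancel hj1]⟩

lemma idealJz_le {I : Ideal (Az k)} (hI : ∀ j, 1 ≤ j → j < k → relGen D K k j ∈ I) :
    idealJz D K k ≤ I := by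
  rw [idealJz, Ideal.span_le]
  rintro _ ⟨i, rfl⟩
  exact hI _ (Nat.le_add_left 1 i) (by have := i.2; lia)

lemma idealJz_le_ker_piAz (hk : k ≤ D.l + 1) (hpoly : ∀ j ≤ k, K.ess j ∈ Set.range incl) :
    idealJz D K k ≤ RingHom.ker (piAz D K k) :=
  idealJz_le fun _ hj1 hj => piAz_relGen hk hpoly hj1 hj

end Relations

/-- The span of the monomials `x ^ a y_1 ^ m_1 ⋯ y_k ^ m_k z ^ b` with `m_t < p_t` for
`1 ≤ t < k`. -/
def stdSubmodule (D : GenericPuiseux) (k : ℕ) : Submodule ℂ (Az k) :=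
  MvPolynomial.restrictSupport ℂ {n | IsStd D k n.some}

section Std

variable {D : GenericPuiseux} {k : ℕ}

lemma mem_stdSubmodule {F : Az k} :
    F ∈ stdSubmodule D k ↔ ∀ n ∈ F.support, IsStd D k n.some :=
  MvPolynomial.mem_restrictSupport_iff ℂ

lemma zMonomial_mem_stdSubmodule {m : Fin (k + 1) →₀ ℕ} (hm : IsStd D k m) (a : ℕ) (c : ℂ) :
    zMonomial m a c ∈ stdSubmodule D k := by
  rw [mem_stdSubmodule]
  intro n hn
  rwa [Finset.mem_singleton.1 (MvPolynomial.support_monomial_subset hn), Finsupp.some_optionElim]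

lemma isStd_of_mem_support_dehom {F : Az k} (hF : F ∈ stdSubmodule D k) {m : Fin (k + 1) →₀ ℕ}
    (hm : m ∈ (dehom F).support) : IsStd D k m := by
  obtain ⟨n, hn, rfl⟩ := exists_of_mem_support_dehom hm
  exact mem_stdSubmodule.1 hF n hn

lemma weightedHomogeneousComponent_mem_stdSubmodule {F : Az k} (hF : F ∈ stdSubmodule D k)
    (w : Option (Fin (k + 1)) → ℕ) (d : ℕ) :
    MvPolynomial.weightedHomogeneousComponent w d F ∈ stdSubmodule D k := by
  classical
  rw [mem_stdSubmodule] at hF ⊢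
  refine fun n hn => hF n (MvPolynomial.mem_support_iff.2 fun h0 => ?_)
  rw [MvPolynomial.mem_support_iff, MvPolynomial.coeff_weightedHomogeneousComponent, h0,
    ite_self] at hn
  exact hn rfl

end Std

namespace KeyForms.HasPosWeights

variable {D : GenericPuiseux} {K : KeyForms D.fullSemidegree} {k : ℕ}

lemma isWeightedHomogeneous_relGen (h : K.HasPosWeights k)
    (hpoly : ∀ j ≤ k, K.ess j ∈ Set.range incl) {j : ℕ} (hj1 : 1 ≤ j) (hj : j < k) :
    MvPolynomial.IsWeightedHomogeneous (weightAz D K k) (relGen D K k j)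
      (D.p j * weight D K k j) := by
  have hw : weightAz D K k none = 1 := rfl
  rw [relGen_eq]
  refine .sub (isWeightedHomogeneous_zMonomial hw _ _ ?_)
    (.sub (isWeightedHomogeneous_zMonomial hw _ _ ?_)
      (.sum _ _ _ fun i hi => isWeightedHomogeneous_zMonomial hw _ _ ?_))
  · rw [Finsupp.weight_single, one_smul, weightAz, weightA, yIdx_val (Nat.succ_le_of_lt hj)]
    exact Nat.sub_add_cancel (h.weight_succ_lt hj1 hj).le
  · rw [Finsupp.weight_single, weightAz, weightA, yIdx_val hj.le, smul_eq_mul, zero_add]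
  · exact Nat.sub_add_cancel (h.weight_expoA_le hpoly hj1 hj hi)

lemma idealJz_le_ker_gradedHom (h : K.HasPosWeights k)
    (hpoly : ∀ j ≤ k, K.ess j ∈ Set.range incl) :
    idealJz D K k ≤ RingHom.ker (h.gradedHom hpoly) := by
  refine idealJz_le fun j hj1 hj => ?_
  rw [RingHom.mem_ker, h.gradedHom_eq_of hpoly (h.isWeightedHomogeneous_relGen hpoly hj1 hj)
    (f := 0) ((map_zero incl).trans (piAz_relGen h.le hpoly hj1 hj).symm), map_zero]

/-! ### Reduction to standard monomials -/

lemma toSyn_single_succ_lt (h : K.HasPosWeights k) {j : ℕ} (hj1 : 1 ≤ j) (hj : j < k) :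
    (weightOrder (weightA D K k)).toSyn (Finsupp.single (yIdx k (j + 1)) 1) <
      (weightOrder (weightA D K k)).toSyn (Finsupp.single (yIdx k j) (D.p j)) := by
  rw [weightOrder_lt_iff]
  left
  rw [Finsupp.weight_single, Finsupp.weight_single, weightA, weightA, yIdx_val hj, yIdx_val hj.le,
    one_smul]
  exact h.weight_succ_lt hj1 hj

lemma zMonomial_mem_sup (h : K.HasPosWeights k) (hpoly : ∀ j ≤ k, K.ess j ∈ Set.range incl)
    (m : Fin (k + 1) →₀ ℕ) (a : ℕ) (c : ℂ) :
    zMonomial m a c ∈ (idealJz D K k).restrictScalars ℂ ⊔ stdSubmodule D k := by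
  induction hs : (weightOrder (weightA D K k)).toSyn m using WellFoundedLT.induction
    generalizing m a c with
  | _ s ih =>
    subst hs
    by_cases hm : IsStd D k m
    · exact Submodule.mem_sup_right (zMonomial_mem_stdSubmodule hm a c)
    obtain ⟨t, ht1, htk, hpt⟩ : ∃ t : Fin (k + 1), 1 ≤ t.val ∧ t.val < k ∧ D.p t ≤ m t := by
      simpa [IsStd] using hm
    obtain ⟨m, rfl⟩ : ∃ m', m = m' + Finsupp.single (yIdx k t) (D.p t) := by
      rw [show yIdx k t = t from Fin.ext (yIdx_val htk.le)]
      exact ⟨_, (tsub_add_cancel_of_le (Finsupp.single_le_iff.2 hpt)).symm⟩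
    have hsmaller : ∀ {e : Fin (k + 1) →₀ ℕ}, (weightOrder (weightA D K k)).toSyn e <
        (weightOrder (weightA D K k)).toSyn (Finsupp.single (yIdx k t) (D.p t)) →
        ∀ a' c', zMonomial m a c * zMonomial e a' c' ∈
          (idealJz D K k).restrictScalars ℂ ⊔ stdSubmodule D k := by
      intro e he a' c'
      rw [zMonomial_mul]
      refine ih _ ?_ _ _ _ rfl
      rw [map_add, map_add]
      exact add_lt_add_right he _
    rw [zMonomial_eq_sub_relGen (K := K)]
    exact sub_mem (add_mem (hsmaller (h.toSyn_single_succ_lt ht1 htk) _ _)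
      (sum_mem fun i hi => hsmaller (h.toSyn_expoA_lt hpoly ht1 htk hi) _ _))
      (Submodule.mem_sup_left (Ideal.mul_mem_left _ _ (relGen_mem_idealJz ht1 htk)))

lemma exists_add_eq (h : K.HasPosWeights k) (hpoly : ∀ j ≤ k, K.ess j ∈ Set.range incl)
    (F : Az k) : ∃ G ∈ idealJz D K k, ∃ N ∈ stdSubmodule D k, G + N = F := by
  refine Submodule.mem_sup.1 (show F ∈ (idealJz D K k).restrictScalars ℂ ⊔ stdSubmodule D k from ?_)
  rw [F.as_sum]
  refine sum_mem fun n _ => ?_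
  rw [monomial_eq_zMonomial]
  exact h.zMonomial_mem_sup hpoly _ _ _

lemma eq_zero_of_gradedHom_eq_zero (h : K.HasPosWeights k)
    (hpoly : ∀ j ≤ k, K.ess j ∈ Set.range incl) {N : Az k} (hN : N ∈ stdSubmodule D k)
    (h0 : h.gradedHom hpoly N = 0) : N = 0 := by
  rw [← MvPolynomial.sum_weightedHomogeneousComponent (weightAz D K k) N]
  refine finsum_eq_zero_of_forall_eq_zero fun d => ?_
  refine eq_zero_of_dehom_eq_zero rfl
    (MvPolynomial.weightedHomogeneousComponent_isWeightedHomogeneous d N) ?_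
  refine h.eq_zero_of_piA_eq_zero (fun m hm => isStd_of_mem_support_dehom
    (weightedHomogeneousComponent_mem_stdSubmodule hN _ d) hm) ?_
  rw [← piAz_eq, ← h.incl_gradedHom_apply hpoly, h0]
  exact map_zero incl

lemma idealJz_eq_ker_gradedHom (h : K.HasPosWeights k)
    (hpoly : ∀ j ≤ k, K.ess j ∈ Set.range incl) :
    idealJz D K k = RingHom.ker (h.gradedHom hpoly) := by
  refine le_antisymm (h.idealJz_le_ker_gradedHom hpoly) fun F hF => ?_
  obtain ⟨G, hG, N, hN, rfl⟩ := h.exists_add_eq hpoly F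
  have hG0 : h.gradedHom hpoly G = 0 := h.idealJz_le_ker_gradedHom hpoly hG
  rw [RingHom.mem_ker, map_add, hG0, zero_add] at hF
  rwa [h.eq_zero_of_gradedHom_eq_zero hpoly hN hF, add_zero]

end KeyForms.HasPosWeights

/-! ### Surjectivity -/

namespace KeyForms

variable {D : GenericPuiseux} {K : KeyForms D.fullSemidegree} {k : ℕ}

variable (K) in
lemma ess_mem_range_piA {t : ℕ} (ht : t ≤ k) : K.ess t ∈ (piA D K k).range :=
  ⟨MvPolynomial.X ⟨t, Nat.lt_succ_of_le ht⟩, MvPolynomial.aeval_X _ _⟩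

lemma C_toLaurent_mem_range_piA (q : ℂ[X]) : C (toLaurent q) ∈ (piA D K k).range := by
  have hx := K.ess_mem_range_piA (Nat.zero_le k)
  rw [K.ess_zero] at hx
  have haeval : CAlgHom.comp toLaurentAlg = aeval (R := ℂ) (C (LaurentPolynomial.T 1)) := by
    ext
    simp
  change (CAlgHom.comp toLaurentAlg : ℂ[X] →ₐ[ℂ] LaurentXY) q ∈ _
  rw [haeval]
  exact Algebra.adjoin_le (Set.singleton_subset_iff.2 hx) (aeval_mem_adjoin_singleton ℂ _)

lemma X_mem_range_piA (hk1 : 1 ≤ k) (hpoly : K.ess 1 ∈ Set.range incl) :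
    X ∈ (piA D K k).range := by
  obtain ⟨f, hf⟩ := hpoly
  have hess : K.ess 1 = X + C (toLaurent (f.coeff 0)) := by
    rw [← coeff_incl, hf]
    exact (K.ess_monic le_rfl (Nat.le_add_left 1 _)).eq_X_add_C
      ((K.natDegree_ess le_rfl (Nat.le_add_left 1 _)).trans (radix_one _))
  have hX : X = K.ess 1 - C (toLaurent (f.coeff 0)) := by rw [hess, add_sub_cancel_right]
  rw [hX]
  exact sub_mem (K.ess_mem_range_piA hk1) (C_toLaurent_mem_range_piA _)

lemma incl_mem_range_piA (hk1 : 1 ≤ k) (hpoly : K.ess 1 ∈ Set.range incl) (f : PolyXY) :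
    incl f ∈ (piA D K k).range := by
  rw [f.as_sum_range_C_mul_X_pow, map_sum]
  refine sum_mem fun n _ => ?_
  have hterm : incl (C (f.coeff n) * X ^ n) = C (toLaurent (f.coeff n)) * X ^ n := by
    rw [map_mul, map_pow, incl_C]
    exact congrArg (_ * · ^ n) (map_X _)
  rw [hterm]
  exact mul_mem (C_toLaurent_mem_range_piA _) (pow_mem (X_mem_range_piA hk1 hpoly) n)

namespace HasPosWeights

lemma exists_stdSubmodule_piA_dehom_eq (h : K.HasPosWeights k)
    (hpoly : ∀ j ≤ k, K.ess j ∈ Set.range incl) (f : PolyXY) :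
    ∃ N ∈ stdSubmodule D k, piA D K k (dehom N) = incl f := by
  obtain ⟨F, hF⟩ := incl_mem_range_piA h.one_le (hpoly 1 h.one_le) f
  obtain ⟨G, hG, N, hN, hGN⟩ := h.exists_add_eq hpoly (MvPolynomial.rename some F)
  have hG0 : piAz D K k G = 0 := idealJz_le_ker_piAz h.le hpoly hG
  refine ⟨N, hN, ?_⟩
  rw [← piAz_eq, ← zero_add (piAz D K k N), ← hG0, ← map_add, hGN, piAz_eq, dehom_rename_some]
  exact hF

lemma gradedHom_surjective (h : K.HasPosWeights k) (hpoly : ∀ j ≤ k, K.ess j ∈ Set.range incl) :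
    Function.Surjective (h.gradedHom hpoly) := by
  intro y
  induction y using DirectSum.induction_on with
  | zero => exact ⟨0, map_zero _⟩
  | add y y' hy hy' =>
    obtain ⟨F, rfl⟩ := hy
    obtain ⟨F', rfl⟩ := hy'
    exact ⟨F + F', map_add _ _ _⟩
  | of d f =>
    obtain ⟨N, hN, hNf⟩ := h.exists_stdSubmodule_piA_dehom_eq hpoly f
    have hle : D.semidegree k (piA D K k (dehom N)) ≤ ((d : ℚ) : WithBot ℚ) := hNf ▸ f.2
    obtain ⟨F, hF, hFN⟩ := exists_isWeightedHomogeneous_dehom_eq (w := weightAz D K k) rfl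
      fun m hm => h.weight_le_of_semidegree_le (fun _ => isStd_of_mem_support_dehom hN) hle hm
    exact ⟨F, h.gradedHom_eq_of hpoly hF (by rw [piAz_eq, hFN, hNf])⟩

/-- The isomorphism `ℂ[x, y_1, …, y_k, z] / J̃_k ≅ ℂ[x, y]^δ_k` induced by `gradedHom`. -/
def gradedEquiv (h : K.HasPosWeights k) (hpoly : ∀ j ≤ k, K.ess j ∈ Set.range incl) :
    (Az k ⧸ idealJz D K k) ≃ₐ[ℂ] D.gradedRing k :=
  (Ideal.quotientEquivAlgOfEq ℂ (h.idealJz_eq_ker_gradedHom hpoly)).trans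
    (Ideal.quotientKerAlgEquivOfSurjective (h.gradedHom_surjective hpoly))

lemma exists_gradedEquiv_mk_eq_of (h : K.HasPosWeights k)
    (hpoly : ∀ j ≤ k, K.ess j ∈ Set.range incl) {d : ℕ} {F : Az k}
    (hF : MvPolynomial.IsWeightedHomogeneous (weightAz D K k) F d) :
    ∃ f : D.filtration k d, h.gradedEquiv hpoly (Ideal.Quotient.mk (idealJz D K k) F) =
      DirectSum.of (fun d => D.filtration k d) d f ∧ incl f = piAz D K k F := by
  have hincl : incl (h.gradedHom hpoly F d) = piAz D K k F := by
    rw [h.incl_gradedHom_apply hpoly, hF.weightedHomogeneousComponent_same]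
  exact ⟨_, h.gradedHom_eq_of hpoly hF hincl, hincl⟩

end HasPosWeights

end KeyForms

/-! ### Dimension -/

lemma ringKrullDim_eq_of_isIntegral (R S : Type*) [CommRing R] [CommRing S] [Algebra R S]
    [FaithfulSMul R S] [Algebra.IsIntegral R S] : ringKrullDim S = ringKrullDim R := by
  refine le_antisymm (Order.krullDim_le_of_strictMono (PrimeSpectrum.comap (algebraMap R S))
    fun I J hIJ => Ideal.IsIntegral.comap_lt_comap (I := I.asIdeal) (J := J.asIdeal) hIJ)
    (iSup_le fun l => ?_)
  obtain ⟨Q, hQ⟩ := Algebra.IsIntegral.comap_surjective R S l.head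
  have : Q.asIdeal.LiesOver l.head.asIdeal := ⟨congrArg PrimeSpectrum.asIdeal hQ.symm⟩
  obtain ⟨L, hL, -⟩ := Ideal.exists_ltSeries_of_hasGoingUp l Q.asIdeal
  exact hL ▸ Order.LTSeries.length_le_krullDim L

lemma ringKrullDim_eq_of_finite_of_injective {R S : Type*} [CommRing R] [CommRing S] {f : R →+* S}
    (hfin : f.Finite) (hinj : Function.Injective f) : ringKrullDim S = ringKrullDim R := by
  algebraize [f]
  have : FaithfulSMul R S := (faithfulSMul_iff_algebraMap_injective R S).2 hinj
  exact ringKrullDim_eq_of_isIntegral R S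

lemma monomial_eq_rename_mul_monomial {σ R : Type*} [CommSemiring R] (p : σ → Prop)
    [DecidablePred p] (n : σ →₀ ℕ) (c : R) :
    MvPolynomial.monomial n c =
      MvPolynomial.rename Subtype.val (MvPolynomial.monomial (n.subtypeDomain p) c) *
        MvPolynomial.monomial (n.filter fun v => ¬ p v) 1 := by
  have hadd : (n.subtypeDomain p).mapDomain Subtype.val + n.filter (fun v => ¬ p v) = n := by
    ext v
    by_cases hv : p v
    · rw [Finsupp.add_apply, Finsupp.filter_apply_neg (fun v => ¬ p v) _ (not_not.2 hv), add_zero,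
        Finsupp.mapDomain_apply Subtype.val_injective _ (⟨v, hv⟩ : Subtype p),
        Finsupp.subtypeDomain_apply]
    · rw [Finsupp.add_apply, Finsupp.filter_apply_pos (fun v => ¬ p v) _ hv,
        Finsupp.mapDomain_of_notMem_range _ _ (by simpa using hv), zero_add]
  rw [MvPolynomial.rename_monomial, MvPolynomial.monomial_mul, hadd, mul_one]

/-- The variables `z`, `x`, `y_k` of `A_k[z]`. By `paramHom_injective` and `finite_paramHom` they
are parameters of `A_k[z] / J̃_k`. -/
def params (k : ℕ) : Finset (Option (Fin (k + 1))) := {none, some 0, some (Fin.last k)}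

section Params

variable {D : GenericPuiseux} {K : KeyForms D.fullSemidegree} {k : ℕ}

lemma card_params (hk1 : 1 ≤ k) : (params k).card = 3 :=
  Finset.card_eq_three.2 ⟨none, some 0, some (Fin.last k), by simp, by simp, by
    rw [ne_eq, Option.some_inj, Fin.ext_iff, Fin.val_zero, Fin.val_last]
    lia, rfl⟩

lemma some_notMem_params_iff {t : Fin (k + 1)} : some t ∉ params k ↔ 1 ≤ t.val ∧ t.val < k := by
  have := t.is_le
  simp only [params, Finset.mem_insert, Finset.mem_singleton, reduceCtorEq, Option.some_inj,
    Fin.ext_iff, Fin.val_zero, Fin.val_last]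
  lia

lemma rename_val_mem_stdSubmodule (hk : k ≤ D.l + 1) (F : MvPolynomial (params k) ℂ) :
    MvPolynomial.rename Subtype.val F ∈ stdSubmodule D k := by
  classical
  rw [mem_stdSubmodule]
  intro n hn t ht1 htk
  rw [MvPolynomial.support_rename_of_injective Subtype.val_injective] at hn
  obtain ⟨m, -, rfl⟩ := Finset.mem_image.1 hn
  rw [Finsupp.some_apply, Finsupp.mapDomain_of_notMem_range]
  · exact D.p_pos ht1 (htk.le.trans hk)
  · simpa using some_notMem_params_iff.2 ⟨ht1, htk⟩

variable (K k) in
/-- The map `ℂ[x, y_k, z] → A_k[z] / J̃_k` induced by the inclusion of the variables `params k`. -/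
def paramHom : MvPolynomial (params k) ℂ →ₐ[ℂ] Az k ⧸ idealJz D K k :=
  (Ideal.Quotient.mkₐ ℂ (idealJz D K k)).comp (MvPolynomial.rename Subtype.val)

namespace KeyForms.HasPosWeights

lemma paramHom_injective (h : K.HasPosWeights k) (hpoly : ∀ j ≤ k, K.ess j ∈ Set.range incl) :
    Function.Injective (paramHom K k) := by
  rw [injective_iff_map_eq_zero]
  intro F hF
  have hmem : MvPolynomial.rename Subtype.val F ∈ idealJz D K k :=
    Ideal.Quotient.eq_zero_iff_mem.1 hF
  have hzero := h.eq_zero_of_gradedHom_eq_zero hpoly (rename_val_mem_stdSubmodule h.le F)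
    (h.idealJz_le_ker_gradedHom hpoly hmem)
  exact MvPolynomial.rename_injective _ Subtype.val_injective (hzero.trans (map_zero _).symm)

lemma finite_paramHom (h : K.HasPosWeights k) (hpoly : ∀ j ≤ k, K.ess j ∈ Set.range incl) :
    (paramHom K k).toRingHom.Finite := by
  let bound : Option (Fin (k + 1)) →₀ ℕ :=
    Finsupp.equivFunOnFinite.symm fun v => v.elim 0 fun t => D.p t
  let _ : Module (MvPolynomial (params k) ℂ) (Az k ⧸ idealJz D K k) :=
    (paramHom K k).toRingHom.toModule
  refine ⟨Submodule.fg_def.2 ⟨(fun n => Ideal.Quotient.mk (idealJz D K k)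
    (MvPolynomial.monomial n 1)) '' Set.Iic bound, (Set.finite_Iic bound).image _,
    eq_top_iff.2 fun y _ => ?_⟩⟩
  obtain ⟨F, rfl⟩ := Ideal.Quotient.mk_surjective y
  obtain ⟨G, hG, N, hN, rfl⟩ := h.exists_add_eq hpoly F
  rw [map_add, Ideal.Quotient.eq_zero_iff_mem.2 hG, zero_add, N.as_sum, map_sum]
  refine sum_mem fun n hn => ?_
  have hle : n.filter (fun v => ¬ v ∈ params k) ≤ bound := by
    rintro (_ | t)
    · exact (Finsupp.filter_apply_neg _ _ (by simp [params])).le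
    · rw [Finsupp.filter_apply]
      split_ifs with ht
      · exact Nat.zero_le _
      · obtain ⟨ht1, htk⟩ := some_notMem_params_iff.1 ht
        exact (mem_stdSubmodule.1 hN n hn t ht1 htk).le
  rw [monomial_eq_rename_mul_monomial (· ∈ params k), map_mul]
  exact Submodule.smul_mem _ (MvPolynomial.monomial _ _) (Submodule.subset_span ⟨_, hle, rfl⟩)

lemma isWeightedCompleteIntersection_relFamily (h : K.HasPosWeights k)
    (hpoly : ∀ j ≤ k, K.ess j ∈ Set.range incl) :
    IsWeightedCompleteIntersection (weightAz D K k) (relFamily D K k) := by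
  refine ⟨?_, fun i => ?_, ?_⟩
  · rintro (_ | t)
    · exact Nat.one_pos
    · exact h.weight_pos t.is_le
  · have hi : i.val + 1 < k := by have := i.2; lia
    exact ⟨_, (Nat.zero_le _).trans_lt (h.weight_succ_lt (Nat.le_add_left 1 _) hi),
      h.isWeightedHomogeneous_relGen hpoly (Nat.le_add_left 1 _) hi⟩
  · change ringKrullDim (Az k ⧸ idealJz D K k) + _ = _
    rw [ringKrullDim_eq_of_finite_of_injective (h.finite_paramHom hpoly)
      (h.paramHom_injective hpoly), MvPolynomial.ringKrullDim_of_isNoetherianRing,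
      MvPolynomial.ringKrullDim_of_isNoetherianRing, ringKrullDim_eq_zero_of_field,
      Nat.card_eq_finsetCard, card_params h.one_le, Nat.card_eq_fintype_card,
      Fintype.card_option, Fintype.card_fin, zero_add, zero_add]
    have hcard : 3 + (k - 1) = k + 1 + 1 := by have := h.one_le; lia
    exact_mod_cast hcard

end KeyForms.HasPosWeights

end Params

end KeyFormsAtInfinity

end

open KeyFormsAtInfinity in
theorem lemma4p6 (D : GenericPuiseux) (K : KeyForms D.fullSemidegree) (k : ℕ)
    (hk1 : 1 ≤ k) (hk : k ≤ D.l + 1)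
    (hpos : ∀ j ≤ k, 0 < D.semidegree k (K.ess j))
    (hpoly : ∀ j ≤ k, K.ess j ∈ Set.range incl) :
    -- the weights and exponents that occur are exact: no rounding or truncation takes place
    ((∀ j ≤ k, D.semidegree k (K.ess j) = ((weight D K k j : ℚ) : WithBot ℚ)) ∧
      ∀ j, 1 ≤ j → j < k →
        weight D K k (j + 1) < D.p j * weight D K k j ∧
        ∀ i ∈ K.steps j, 0 ≤ K.β₀ i ∧
          Finsupp.weight (weightA D K k) (K.expoA k i) ≤ D.p j * weight D K k j) ∧
    -- the graded isomorphism, given by `z ↦ (1)_1`, `x ↦ (x)_{ω_0}`, `y_j ↦ (f_j)_{ω_j}`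
    (∃ e : (Az k ⧸ idealJz D K k) ≃ₐ[ℂ] D.gradedRing k,
      ∀ (d : ℕ) (F : Az k), MvPolynomial.IsWeightedHomogeneous (weightAz D K k) F d →
        ∃ h : D.filtration k d,
          e (Ideal.Quotient.mk (idealJz D K k) F) =
            DirectSum.of (fun d => D.filtration k d) d h ∧
          incl (h : PolyXY) = piAz D K k F) ∧
    IsWeightedCompleteIntersection (weightAz D K k) (relFamily D K k) ∧
    IsGroebnerBasis (weightOrder (weightA D K k))
      {H | ∃ j, 1 ≤ j ∧ j < k ∧ H = leadH D K k j} (idealJ D K k) := by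
  have h : K.HasPosWeights k := ⟨hk1, hk, hpos⟩
  exact ⟨⟨fun j hj => h.semidegree_ess hj, fun j hj1 hj => ⟨h.weight_succ_lt hj1 hj,
      fun i hi => ⟨K.β₀_nonneg hj1 (by lia) (fun t ht => hpoly t (by lia)) hi,
        h.weight_expoA_le hpoly hj1 hj hi⟩⟩⟩,
    ⟨h.gradedEquiv hpoly, fun _ _ hF => h.exists_gradedEquiv_mk_eq_of hpoly hF⟩,
    h.isWeightedCompleteIntersection_relFamily hpoly, h.isGroebnerBasis_idealJ hpoly⟩
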